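/- Let $x_0,x_1,x_2,\dots$ be i.i.d. bounded real random variables with mean zero and variance one. For $n\ge 1$ let $BT_n$ and $BH_n$ be the balanced Toeplitz and Hankel matrices, i.e. the $n\times n$ symmetric matrices whose $(i,j)$ entries ($1\le i,j\le n$) are $$(BT_n)_{ij}=\frac{x_{|i-j|}}{\sqrt{n-|i-j|}},\qquad (BH_n)_{ij}=\frac{x_{i+j-1}}{\sqrt{\min(i+j-1,\;2n-i-j+1)}} .$$ For a real symmetric matrix $B$ of order $n$, the empirical spectral distribution (ESD) puts mass $1/n$ at each eigenvalue of $B$ (with multiplicity), and $\beta_h(B)$ is its $h$-th moment. A pair-matched word of length $2k$ is a sequence $w=w[1]\cdots w[2k]$ of letters in which every letter occurs exactly twice and the first occurrences of the letters are in alphabetical order. It is symmetric if every letter occurs once in an odd and once in an even position. Let $S=S(w)\subset\{0,\dots,2k\}$ consist of $0$ and of all $i\ge 1$ such that $w[i]$ is the first occurrence of its letter, so $|S|=k+1$. For $u=(u_i)_{i\in S}$ let $L_i^T(u)$ and $L_i^H(u)$, $0\le i\le 2k$, be the linear forms with $L_i(u)=u_i$ for $i\in S$ that are determined by the following relations for $i<j$,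 $w[i]=w[j]$: $$L^T_{i-1}-L^T_i+L^T_{j-1}-L^T_j=0,\qquad L^H_{i-1}+L^H_i=L^H_{j-1}+L^H_j .$$ Put $\phi_T(x,y)=1-|x-y|$ and $\phi_H(x,y)=\min(x+y,\,2-x-y)$. Let $U_S=(U_i)_{i\in S}$ be independent random variables, uniform on $(0,1)$, and define $$m^T_{2k}=\sum_{w\text{ pair-matched}}\mathbb E\left[\frac{\mathbb I\big(L^T_i(U_S)\in(0,1)\ \text{for all } i\notin S\cup\{2k\}\big)}{\prod_{i\in S\setminus\{0\}}\phi_T\big(L^T_{i-1}(U_S),U_i\big)}\right],$$ $$m^H_{2k}=\sum_{w\text{ pair-matched and symmetric}}\mathbb E\left[\frac{\mathbb I\big(L^H_i(U_S)\in(0,1)\ \text{for all } i\notin S\cup\{2k\}\big)}{\prod_{i\in S\setminus\{0\}}\phi_H\big(L^H_{i-1}(U_S),U_i\big)}\right],$$ the sums being over words of length $2k$. Then: 1. All the expectations in these two formulas are finite. 2. For every $h\ge 0$ the limits $\lim_{n\to\infty}\mathbb E[\beta_h(BT_n)]$ and $\lim_{n\to\infty}\mathbb E[\beta_h(BH_n)]$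 exist (and the expectations are finite). Both limits are $0$ for odd $h$; for $h=2k$ they are $m^T_{2k}$ and $m^H_{2k}$ respectively. 3. There are probability measures $BT$ and $BH$ on $\mathbb R$, not depending on the distribution of the input sequence, such that almost surely the ESDs of $BT_n$ and $BH_n$ converge weakly to $BT$ and $BH$ respectively. All moments of $BT$ and $BH$ are finite, their odd moments are $0$, and for every $k\ge 0$ their $2k$-th moments are $m^T_{2k}$ and $m^H_{2k}$ respectively. -/

import Mathlib

open MeasureTheory ProbabilityTheory Filter Topology

namespace BalancedMatrix

noncomputable section

/-! ### The matrices and their empirical spectral distributions -/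

/-- The balanced Toeplitz matrix: the entry at `(i, j)` is `x_{|i-j|} / √(n - |i-j|)`. -/
def toeplitz (n : ℕ) (x : ℕ → ℝ) : Matrix (Fin n) (Fin n) ℝ :=
  Matrix.of fun i j =>
    x ((i : ℤ) - (j : ℤ)).natAbs / √((n : ℝ) - |(i : ℝ) - (j : ℝ)|)

/-- The balanced Hankel matrix. With rows and columns numbered from `1`, the entry at `(i, j)` is
`x_{i+j-1} / √(min (i+j-1) (2n-(i+j-1)))`; here `Fin n` numbers them from `0`, so that `i+j-1`
becomes `i+j+1`. -/
def hankel (n : ℕ) (x : ℕ → ℝ) : Matrix (Fin n) (Fin n) ℝ :=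
  Matrix.of fun i j =>
    x ((i : ℕ) + (j : ℕ) + 1) /
      √(min ((i : ℝ) + (j : ℝ) + 1) (2 * (n : ℝ) - ((i : ℝ) + (j : ℝ) + 1)))

theorem toeplitz_isHermitian (n : ℕ) (x : ℕ → ℝ) : (toeplitz n x).IsHermitian := by
  ext i j
  have h : ((j : ℤ) - (i : ℤ)).natAbs = ((i : ℤ) - (j : ℤ)).natAbs := by omega
  simp [toeplitz, h, abs_sub_comm (j : ℝ) (i : ℝ)]

theorem hankel_isHermitian (n : ℕ) (x : ℕ → ℝ) : (hankel n x).IsHermitian := by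
  ext i j
  simp [hankel, add_comm (j : ℝ) (i : ℝ), add_comm (j : ℕ) (i : ℕ)]

/-- The empirical spectral distribution of a real symmetric matrix of order `n ≥ 1`: mass `1 / n`
at each eigenvalue, with multiplicity. -/
def esd {n : ℕ} [NeZero n] (A : Matrix (Fin n) (Fin n) ℝ) (hA : A.IsHermitian) :
    ProbabilityMeasure ℝ :=
  ⟨(n : ENNReal)⁻¹ • ∑ i, Measure.dirac (hA.eigenvalues i), ⟨by
    simp [ENNReal.inv_mul_cancel, NeZero.ne n]⟩⟩

/-- `β_h(A)`, the `h`-th moment of the empirical spectral distribution of `A`. -/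
def esdMoment (h : ℕ) {n : ℕ} [NeZero n] (A : Matrix (Fin n) (Fin n) ℝ) (hA : A.IsHermitian) :
    ℝ :=
  ∫ y, y ^ h ∂(esd A hA : Measure ℝ)

/-! ### Pair-matched words

A word with `h` positions over the letters `0 < 1 < ⋯ < k - 1` is a map `w : Fin h → Fin k`.
The position numbered `i` from `1` is the element `i - 1` of `Fin h`; it stands for the edge from
the vertex `i - 1` to the vertex `i`, and the vertices are the elements `0, …, h` of
`Fin (h + 1)`. So the edge at `p : Fin h` goes from `p.castSucc` to `p.succ`. -/

/-- The first occurrences of the letters are in alphabetical order. -/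
def IsWord {h k : ℕ} (w : Fin h → Fin k) : Prop :=
  ∀ p : Fin h, ∀ a : Fin k, a < w p → ∃ q : Fin h, q < p ∧ w q = a

/-- Every letter occurs exactly twice. -/
def IsPairMatched {h k : ℕ} (w : Fin h → Fin k) : Prop :=
  ∀ a : Fin k, (Finset.univ.filter fun p => w p = a).card = 2

/-- Every letter occurs exactly once in an odd and exactly once in an even position, positions
being numbered from `1`. -/
def IsSymmetric {h k : ℕ} (w : Fin h → Fin k) : Prop :=
  ∀ a : Fin k, (∃! p : Fin h, w p = a ∧ Odd ((p : ℕ) + 1)) ∧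
    (∃! p : Fin h, w p = a ∧ Even ((p : ℕ) + 1))

open Classical in
/-- The pair-matched words of length `2 * k`; they have exactly `k` letters. -/
def pairWords (k : ℕ) : Finset (Fin (2 * k) → Fin k) :=
  Finset.univ.filter fun w => IsWord w ∧ IsPairMatched w

open Classical in
/-- The symmetric pair-matched words of length `2 * k`. -/
def symPairWords (k : ℕ) : Finset (Fin (2 * k) → Fin k) :=
  (pairWords k).filter fun w => IsSymmetric w

/-- The first position that carries the same letter as the position `p`. -/
def firstOcc {h k : ℕ} (w : Fin h → Fin k) (p : Fin h) : Fin h :=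
  (Finset.univ.filter fun q => w q = w p).min' ⟨p, by simp⟩

theorem firstOcc_le {h k : ℕ} (w : Fin h → Fin k) (p : Fin h) : firstOcc w p ≤ p :=
  Finset.min'_le _ _ (by simp)

/-- The set `S` of independent vertices: the vertex `0` and the end points of the edges at which
a letter occurs for the first time. -/
def indepVertices {h k : ℕ} (w : Fin h → Fin k) : Finset (Fin (h + 1)) :=
  insert 0 ((Finset.univ.filter fun p => firstOcc w p = p).image Fin.succ)

theorem zero_mem_indepVertices {h k : ℕ} (w : Fin h → Fin k) : 0 ∈ indepVertices w :=
  Finset.mem_insert_self _ _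

theorem succ_mem_indepVertices {h k : ℕ} (w : Fin h → Fin k) (p : Fin h)
    (hp : firstOcc w p = p) : p.succ ∈ indepVertices w :=
  Finset.mem_insert_of_mem (Finset.mem_image_of_mem _ (by simpa using hp))

/-- The linear forms `L_v(u)`, `v = 0, …, h`, in the variables `u = (u_v)_{v ∈ S}`. For `v ∈ S`,
`L_v(u) = u_v`. If the position that ends in `v` repeats the letter of an earlier position, with
first occurrence the edge from `a` to `b`, then `L_v = step L_a L_b L_{v-1}`, which is the solution
for `L_v` of the linear relation between the two matched edges. -/
def vertexForm (step : ℝ → ℝ → ℝ → ℝ) {h k : ℕ} (w : Fin h → Fin k)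
    (u : indepVertices w → ℝ) : Fin (h + 1) → ℝ
  | ⟨0, _⟩ => u ⟨0, zero_mem_indepVertices w⟩
  | ⟨i + 1, hi⟩ =>
    if hp : firstOcc w ⟨i, Nat.lt_of_succ_lt_succ hi⟩ = ⟨i, Nat.lt_of_succ_lt_succ hi⟩ then
      u ⟨Fin.succ ⟨i, Nat.lt_of_succ_lt_succ hi⟩, succ_mem_indepVertices w _ hp⟩
    else
      step (vertexForm step w u (firstOcc w ⟨i, Nat.lt_of_succ_lt_succ hi⟩).castSucc)
        (vertexForm step w u (firstOcc w ⟨i, Nat.lt_of_succ_lt_succ hi⟩).succ)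
        (vertexForm step w u ⟨i, Nat.lt_of_succ_lt hi⟩)
  termination_by v => v.val
  decreasing_by
    all_goals
      have h1 := firstOcc_le w ⟨i, Nat.lt_of_succ_lt_succ hi⟩
      have h2 : (firstOcc w ⟨i, Nat.lt_of_succ_lt_succ hi⟩ : ℕ) ≤ i := h1
      have h3 : (firstOcc w ⟨i, Nat.lt_of_succ_lt_succ hi⟩ : ℕ) = i →
          firstOcc w ⟨i, Nat.lt_of_succ_lt_succ hi⟩ = ⟨i, Nat.lt_of_succ_lt_succ hi⟩ :=
        fun e => Fin.ext e
      try simp only [Fin.val_castSucc, Fin.val_succ]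
      omega

theorem vertexForm_zero (step : ℝ → ℝ → ℝ → ℝ) {h k : ℕ} (w : Fin h → Fin k)
    (u : indepVertices w → ℝ) :
    vertexForm step w u 0 = u ⟨0, zero_mem_indepVertices w⟩ :=
  vertexForm.eq_def step w u 0

theorem vertexForm_succ (step : ℝ → ℝ → ℝ → ℝ) {h k : ℕ} (w : Fin h → Fin k)
    (u : indepVertices w → ℝ) (p : Fin h) :
    vertexForm step w u p.succ =
      if hp : firstOcc w p = p then u ⟨p.succ, succ_mem_indepVertices w p hp⟩
      else step (vertexForm step w u (firstOcc w p).castSucc)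
        (vertexForm step w u (firstOcc w p).succ) (vertexForm step w u p.castSucc) :=
  vertexForm.eq_def step w u p.succ

/-- Toeplitz: the solution `d` of `(a - b) + (c - d) = 0`. -/
def stepT (a b c : ℝ) : ℝ := a - b + c

/-- Hankel: the solution `d` of `a + b = c + d`. -/
def stepH (a b c : ℝ) : ℝ := a + b - c

/-- The limiting balancing function in the Toeplitz case. -/
def phiT (x y : ℝ) : ℝ := 1 - |x - y|

/-- The limiting balancing function in the Hankel case, the limit of
`min (x + y - 1 / n) (2 - x - y + 1 / n)`. -/
def phiH (x y : ℝ) : ℝ := min (x + y) (2 - x - y)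

open Classical in
/-- The random variable whose expectation is the contribution of the word `w`: the indicator of
`L_v(u) ∈ (0, 1)` for all vertices `v ∉ S` other than the last one, divided by the product of
`φ (L_{v-1}(u), u_v)` over `v ∈ S`, `v ≠ 0` (recall that `u_v = L_v(u)` for these `v`). -/
def wordIntegrand (step : ℝ → ℝ → ℝ → ℝ) (φ : ℝ → ℝ → ℝ) {h k : ℕ} (w : Fin h → Fin k)
    (u : indepVertices w → ℝ) : ℝ :=
  (if ∀ v : Fin (h + 1), v ∉ indepVertices w → v ≠ Fin.last h →
      vertexForm step w u v ∈ Set.Ioo (0 : ℝ) 1 then 1 else 0) /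
    ∏ p ∈ Finset.univ.filter (fun p => firstOcc w p = p),
      φ (vertexForm step w u p.castSucc) (vertexForm step w u p.succ)

/-- The joint law of independent random variables `U_v`, `v ∈ S`, each uniform on `(0, 1)`. -/
def uniformLaw {h k : ℕ} (w : Fin h → Fin k) : Measure (indepVertices w → ℝ) :=
  Measure.pi fun _ => (volume : Measure ℝ).restrict (Set.Ioo 0 1)

/-- The `2k`-th limiting moment in the Toeplitz case. -/
def momentT (k : ℕ) : ℝ :=
  ∑ w ∈ pairWords k, ∫ u, wordIntegrand stepT phiT w u ∂(uniformLaw w)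

/-- The `2k`-th limiting moment in the Hankel case. -/
def momentH (k : ℕ) : ℝ :=
  ∑ w ∈ symPairWords k, ∫ u, wordIntegrand stepH phiH w u ∂(uniformLaw w)

/-- Independent, identically distributed, bounded input with mean zero and variance one. -/
structure IsBoundedIIDInput {Ω : Type*} [MeasurableSpace Ω] (P : Measure Ω)
    (x : ℕ → Ω → ℝ) : Prop where
  measurable : ∀ i, Measurable (x i)
  indep : iIndepFun x P
  ident : ∀ i, IdentDistrib (x i) (x 0) P P
  bounded : ∃ C : ℝ, ∀ i, ∀ᵐ ω ∂P, |x i ω| ≤ C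
  mean_zero : ∀ i, ∫ ω, x i ω ∂P = 0
  variance_one : ∀ i, variance (x i) P = 1

end

end BalancedMatrix

/-!
The two ensembles are treated at once, through a `Model`: the entry at `(i, j)` is the variable of
index `link i j` divided by `√(n φ(y_i, y_j))`, where `y_i = (i + 1/2) / n` is the midpoint of the
`i`-th of the `n` equal subintervals of `(0, 1)`. With these midpoints the limiting balancing
function `φ` gives the exact weights of the finite matrices, and two entries share a variable exactly
if their edge values `y_j + κ y_i` agree up to a sign, where `κ = -1` for Toeplitz and `κ = 1` for
Hankel matrices.

*Moments.* The expected trace of a power is a sum over closed paths of vertices. Grouped by the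
matching of their links and by the signs that relate matched edge values, the paths of a group are
determined by their values at the independent vertices, all other vertices being given by linear
forms (`signedForm`) with integer coefficients. The sum over a group is therefore the integral, over
independent uniform variables, of a step function (`Model.sum_weight_circuits`), and this step
function converges pointwise to the integrand of the word. Domination comes from
`φ(x, y) ≥ ‖x‖ + ‖y‖`, where `‖·‖` is the distance to the nearest integer: the weights are bounded by
a product of singular factors `(‖L‖ + ‖u‖)⁻¹`, and on the torus such a product is integrable, even
with further small negative powers of linear forms, because each new variable `u` occurs in only one
factor of full strength (`lintegral_prod_inv_mul_prod_rpow_le`: the factor is split as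
`‖L‖ ^ (-a) ‖u‖ ^ (-b)` with `a + b = 1` and `b < 1`, and the new variable is integrated by Hölder's
inequality, which moves only a small power to the earlier ones). A group in which some link occurs
three times loses a power of `n`, and a group whose linear forms do not close up lives on a null set
of the torus, so that the domination makes both vanish in the limit
(`Model.tendsto_sum_weight_zero_of_blockSize`, `Model.tendsto_sum_weight_zero_of_closeCoeff`). What
survives are the pair-matched words whose forms close up: all of them for Toeplitz matrices, the
symmetric ones for Hankel matrices (`closeCoeff_neg_one`, `closeCoeff_one`).

*The limit law.* The torus bound is uniform enough to bound the `2k`-th limiting moment by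
`A C ^ k (2k)!` (`Model.moment_le`), so that the moments determine a measure (`eq_of_moments_eq`).
Tightness and the method of moments give its existence and the weak convergence of the mean
spectral distribution. The existence is applied to one particular input, a sequence of fair signs;
since the moments do not depend on the input, neither does the limit.

*Almost sure convergence.* A smooth linear spectral statistic `F = n⁻¹ tr f(B)` changes to first
order by `n⁻¹ tr (f'(B) D)` when the matrix changes by `D`. The matrices that belong to different
variables occupy disjoint places and have bounded Frobenius norm, so that the squares of the changes
in all variables add up to `O(1 / n)` (`Model.IsBalanced.exists_gradient_bound`). The Efron–Stein
inequality (`variance_pi_le`), used for `F` and again for `(F - E F) ^ 2`, bounds the fourth central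
moment by `O(1 / n ^ 2)`, which is summable. With `f` a cosine or a sine this shows that the
characteristic functions of the empirical spectral distributions converge almost surely.
-/

open MeasureTheory ProbabilityTheory Filter Topology

namespace BalancedMatrix

noncomputable section

/-! ### Singular integrals over the torus -/

theorem lintegral_enorm_rpow_neg_le {σ : ℝ} (h0 : 0 ≤ σ) (h1 : σ < 1) :
    ∫⁻ x : UnitAddCircle, ‖x‖ₑ ^ (-σ) ≤ ENNReal.ofReal (2 / (1 - σ)) := by
  have i1 : IntervalIntegrable (fun a : ℝ => a ^ (-σ)) volume 0 1 :=
    intervalIntegral.intervalIntegrable_rpow' (by linarith)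
  have i2 : IntervalIntegrable (fun a : ℝ => (1 - a) ^ (-σ)) volume 0 1 := by
    simpa using (i1.comp_sub_left 1).symm
  have e1 : ∫ a in (0 : ℝ)..1, a ^ (-σ) = 1 / (1 - σ) := by
    rw [integral_rpow (Or.inl (by linarith)), Real.one_rpow, Real.zero_rpow (by linarith)]
    congr 1 <;> ring
  have e2 : ∫ a in (0 : ℝ)..1, (1 - a) ^ (-σ) = 1 / (1 - σ) := by
    rw [← e1]; simpa using intervalIntegral.integral_comp_sub_left (fun a : ℝ => a ^ (-σ)) 1
      (a := 0) (b := 1)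
  rw [← UnitAddCircle.lintegral_preimage 0]
  calc ∫⁻ a in Set.Ioc (0 : ℝ) (0 + 1), ‖(a : UnitAddCircle)‖ₑ ^ (-σ)
      ≤ ∫⁻ a in Set.Ioc (0 : ℝ) (0 + 1), ENNReal.ofReal (a ^ (-σ) + (1 - a) ^ (-σ)) := by
        rw [zero_add, ← restrict_Ioo_eq_restrict_Ioc]
        refine setLIntegral_mono' measurableSet_Ioo fun a ha => ?_
        obtain ⟨ha0, ha1⟩ := ha
        have hn : (a ≤ ‖(a : UnitAddCircle)‖) ∨ (1 - a ≤ ‖(a : UnitAddCircle)‖) := by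
          rw [UnitAddCircle.norm_eq]
          rcases le_or_gt a (1 / 2) with h | h
          · left
            rcases h.lt_or_eq with h | h
            · rw [round_eq_zero_iff.2 ⟨by linarith, h⟩]; simp [abs_of_pos ha0]
            · subst h; norm_num
          · right
            have : round a = 1 := by
              rw [round_eq, Int.floor_eq_iff]; constructor <;> push_cast <;> linarith
            rw [this, abs_of_nonpos (by push_cast; linarith)]; push_cast; linarith
        have key : ∀ r : ℝ, 0 < r → r ≤ ‖(a : UnitAddCircle)‖ →
            ‖(a : UnitAddCircle)‖ₑ ^ (-σ) ≤ ENNReal.ofReal (r ^ (-σ)) := by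
          intro r hr hle
          rw [← ofReal_norm, ENNReal.ofReal_rpow_of_pos (hr.trans_le hle)]
          exact ENNReal.ofReal_le_ofReal
            (Real.rpow_le_rpow_of_nonpos hr hle (by linarith))
        have p1 : 0 ≤ a ^ (-σ) := Real.rpow_nonneg ha0.le _
        have p2 : 0 ≤ (1 - a) ^ (-σ) := Real.rpow_nonneg (by linarith) _
        rcases hn with h | h
        · exact (key _ ha0 h).trans (ENNReal.ofReal_le_ofReal (by linarith))
        · exact (key _ (by linarith) h).trans (ENNReal.ofReal_le_ofReal (by linarith))
    _ = ENNReal.ofReal (∫ a in Set.Ioc (0 : ℝ) (0 + 1), (a ^ (-σ) + (1 - a) ^ (-σ))) := by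
        rw [zero_add]
        refine (ofReal_integral_eq_lintegral_ofReal ?_ ?_).symm
        · exact (i1.add i2).1
        · refine (ae_restrict_iff' measurableSet_Ioc).2 (Eventually.of_forall fun a ha => ?_)
          exact add_nonneg (Real.rpow_nonneg ha.1.le _) (Real.rpow_nonneg (by linarith [ha.2]) _)
    _ = ENNReal.ofReal (2 / (1 - σ)) := by
        rw [zero_add, ← intervalIntegral.integral_of_le zero_le_one,
          intervalIntegral.integral_add i1 i2, e1, e2]
        congr 1; ring

theorem lintegral_enorm_zsmul_add_rpow {c : ℤ} (hc : c ≠ 0) (t : UnitAddCircle) (r : ℝ) :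
    ∫⁻ x : UnitAddCircle, ‖c • x + t‖ₑ ^ r = ∫⁻ x : UnitAddCircle, ‖x‖ₑ ^ r := by
  have h : MeasurePreserving (fun x : UnitAddCircle => c • x + t) volume volume :=
    (measurePreserving_add_right volume t).comp (Measure.measurePreserving_zsmul volume hc)
  exact h.lintegral_comp (f := fun x : UnitAddCircle => ‖x‖ₑ ^ r) (by fun_prop)

/-- By Hölder's inequality the factors may be integrated separately, and each `c • x + t` is again
uniformly distributed on the circle. -/
theorem lintegral_prod_enorm_rpow_le {ι : Type*} (s : Finset ι) (c : ι → ℤ) (t : ι → UnitAddCircle)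
    (b : ι → ℝ) (hc : ∀ i ∈ s, c i ≠ 0) (hb : ∀ i ∈ s, 0 ≤ b i) {θ : ℝ} (hθ : 0 < θ)
    (hsum : ∑ i ∈ s, b i ≤ 1 - θ) :
    ∫⁻ x : UnitAddCircle, ∏ i ∈ s, ‖c i • x + t i‖ₑ ^ (-b i) ≤ ENNReal.ofReal (2 / θ) := by
  set σ := ∑ i ∈ s, b i with hσ
  have hσ0 : 0 ≤ σ := Finset.sum_nonneg hb
  have hmono : ENNReal.ofReal (2 / (1 - σ)) ≤ ENNReal.ofReal (2 / θ) :=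
    ENNReal.ofReal_le_ofReal (div_le_div_of_nonneg_left (by norm_num) hθ (by linarith))
  rcases hσ0.eq_or_lt with h | h
  · have hz : ∀ i ∈ s, b i = 0 := (Finset.sum_eq_zero_iff_of_nonneg hb).1 h.symm
    calc ∫⁻ x : UnitAddCircle, ∏ i ∈ s, ‖c i • x + t i‖ₑ ^ (-b i)
        = ∫⁻ x : UnitAddCircle, 1 := by
          refine lintegral_congr fun x => Finset.prod_eq_one fun i hi => by simp [hz i hi]
      _ = ENNReal.ofReal 1 := by simp
      _ ≤ _ := ENNReal.ofReal_le_ofReal (by rw [le_div_iff₀ hθ]; linarith)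
  · have hrw : ∀ x : UnitAddCircle, ∏ i ∈ s, ‖c i • x + t i‖ₑ ^ (-b i)
        = ∏ i ∈ s, (‖c i • x + t i‖ₑ ^ (-σ)) ^ (b i / σ) := fun x =>
      Finset.prod_congr rfl fun i _ => by
        rw [← ENNReal.rpow_mul]; congr 1; field_simp
    simp_rw [hrw]
    refine (ENNReal.lintegral_prod_norm_pow_le s (fun i _ => by fun_prop)
      (by rw [← Finset.sum_div, ← hσ, div_self h.ne']) (fun i hi => div_nonneg (hb i hi) hσ0)).trans ?_
    have hI : ∀ i ∈ s, (∫⁻ x : UnitAddCircle, ‖c i • x + t i‖ₑ ^ (-σ)) ^ (b i / σ)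
        ≤ (ENNReal.ofReal (2 / θ)) ^ (b i / σ) := fun i hi => by
      rw [lintegral_enorm_zsmul_add_rpow (hc i hi)]
      exact ENNReal.rpow_le_rpow ((lintegral_enorm_rpow_neg_le hσ0 (by linarith)).trans hmono)
        (div_nonneg (hb i hi) hσ0)
    refine (Finset.prod_le_prod' hI).trans (le_of_eq ?_)
    have hadd : ∀ s' : Finset ι, ∏ i ∈ s', ENNReal.ofReal (2 / θ) ^ (b i / σ)
        = ENNReal.ofReal (2 / θ) ^ (∑ i ∈ s', b i / σ) := fun s' => by
      classical
      induction s' using Finset.induction with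
      | empty => simp
      | insert a s' ha ih =>
        rw [Finset.prod_insert ha, Finset.sum_insert ha, ih, ENNReal.rpow_add _ _
          (by simpa using by positivity) ENNReal.ofReal_ne_top]
    rw [hadd, ← Finset.sum_div, ← hσ, div_self h.ne', ENNReal.rpow_one]

theorem lintegral_pi_fin_succ {m : ℕ} {α : Type*} [MeasureSpace α]
    [SigmaFinite (volume : Measure α)] {F : (Fin (m + 1) → α) → ENNReal} (hF : Measurable F) :
    ∫⁻ u, F u = ∫⁻ v : Fin m → α, ∫⁻ x : α, F (Fin.snoc v x) := by
  have h := (volume_preserving_piFinSuccAbove (fun _ : Fin (m + 1) => α) (Fin.last m)).symm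
  rw [← h.lintegral_comp hF, Measure.volume_eq_prod, lintegral_prod_symm]
  · refine lintegral_congr fun v => lintegral_congr fun x => ?_
    congr 1
    exact Fin.insertNth_last (α := fun _ => α) x v
  · exact (hF.comp h.measurable).aemeasurable

theorem inv_add_le_rpow_mul_rpow (x y : ENNReal) {s r : ℝ} (hs : 0 ≤ s) (hr : 0 ≤ r)
    (hsr : s + r = 1) (hx : x ≠ ⊤) (hy : y ≠ ⊤) : (x + y)⁻¹ ≤ x ^ (-s) * y ^ (-r) := by
  rw [ENNReal.rpow_neg, ENNReal.rpow_neg, ← ENNReal.mul_inv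
    (Or.inr (ENNReal.rpow_ne_top_of_nonneg hr hy)) (Or.inl (ENNReal.rpow_ne_top_of_nonneg hs hx)),
    ENNReal.inv_le_inv]
  calc x ^ s * y ^ r ≤ (x + y) ^ s * (x + y) ^ r := by
        gcongr
        · exact le_self_add
        · exact le_add_self
    _ = x + y := by rw [← ENNReal.rpow_add_of_nonneg _ _ hs hr, hsr, ENNReal.rpow_one]

/-- The exponents `b i` form a budget. Integrating out the last coordinate trades the singular
factors in which it occurs for one singularity of `p j`, at the price of `θ` per factor. -/
theorem lintegral_prod_inv_mul_prod_rpow_le {θ : ℝ} (hθ : 0 < θ) (m : ℕ) :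
    ∀ (A : Fin m → Prop) [DecidablePred A] (p : Fin m → Fin m → ℤ),
      (∀ j, A j → p j ≠ 0) → (∀ j i, j ≤ i → p j i = 0) →
      ∀ {ι : Type} (s : Finset ι) (c : ι → Fin m → ℤ) (b : ι → ℝ),
      (∀ i ∈ s, c i ≠ 0) → (∀ i ∈ s, 0 ≤ b i) →
      (∑ i ∈ s, b i + (∑ j, if A j then 1 else 0) * θ ≤ 1 / 2) →
      ∫⁻ u : Fin m → UnitAddCircle,
        (∏ j, if A j then (‖∑ i, p j i • u i‖ₑ + ‖u j‖ₑ)⁻¹ else 1) *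
          ∏ i ∈ s, ‖∑ l, c i l • u l‖ₑ ^ (-b i)
        ≤ 4 ^ m * ENNReal.ofReal (1 / θ) ^ (∑ j, if A j then 1 else 0) := by
  induction m with
  | zero =>
    intro A _ p _ _ ι s c b hc _ _
    have : s = ∅ := Finset.eq_empty_of_forall_notMem fun i hi =>
      hc i hi (Subsingleton.elim _ _)
    subst this
    simp [volume_pi]
  | succ m ih =>
    intro A _ p hp hps ι s c b hc hb hsum
    classical
    set s0 := s.filter fun i => c i (Fin.last m) = 0 with hs0
    set s1 := s.filter fun i => ¬ c i (Fin.last m) = 0 with hs1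
    have hsplit : ∀ g : ι → ENNReal, ∏ i ∈ s, g i = (∏ i ∈ s0, g i) * ∏ i ∈ s1, g i := fun g =>
      (Finset.prod_filter_mul_prod_filter_not s _ g).symm
    have hsplitb : ∑ i ∈ s, b i = ∑ i ∈ s0, b i + ∑ i ∈ s1, b i :=
      (Finset.sum_filter_add_sum_filter_not s _ b).symm
    have hb0 : ∀ i ∈ s0, 0 ≤ b i := fun i hi => hb i (Finset.mem_filter.1 hi).1
    have hb1 : ∀ i ∈ s1, 0 ≤ b i := fun i hi => hb i (Finset.mem_filter.1 hi).1
    have hB0 : 0 ≤ ∑ i ∈ s0, b i := Finset.sum_nonneg hb0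
    have hB1 : 0 ≤ ∑ i ∈ s1, b i := Finset.sum_nonneg hb1
    set p' : Fin m → Fin m → ℤ := fun j i => p j.castSucc i.castSucc with hp'
    have hplast : ∀ j, p j (Fin.last m) = 0 := fun j => hps j _ (Fin.le_last j)
    have hne : ∀ d : Fin (m + 1) → ℤ, d ≠ 0 → d (Fin.last m) = 0 →
        (fun i : Fin m => d i.castSucc) ≠ 0 := fun d hd hl h0 => hd <| by
      ext i
      refine Fin.lastCases hl (fun i => ?_) i
      exact congrFun h0 i
    have hp'1 : ∀ j : Fin m, A j.castSucc → p' j ≠ 0 := fun j hj => hne _ (hp _ hj) (hplast _)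
    have hp'2 : ∀ j i, j ≤ i → p' j i = 0 := fun j i hji => hps _ _ (by simpa using hji)
    set Q : (Fin m → UnitAddCircle) → ENNReal := fun v =>
      ∏ j : Fin m, if A j.castSucc then (‖∑ i, p' j i • v i‖ₑ + ‖v j‖ₑ)⁻¹ else 1 with hQ
    set R : (Fin m → UnitAddCircle) → ENNReal := fun v =>
      ∏ i ∈ s0, ‖∑ l, (fun l : Fin m => c i l.castSucc) l • v l‖ₑ ^ (-b i) with hR
    set t : (Fin m → UnitAddCircle) → ι → UnitAddCircle := fun v i =>
      ∑ l : Fin m, c i l.castSucc • v l with ht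
    have hmeasF : Measurable fun u : Fin (m + 1) → UnitAddCircle =>
        (∏ j, if A j then (‖∑ i, p j i • u i‖ₑ + ‖u j‖ₑ)⁻¹ else 1) *
          ∏ i ∈ s, ‖∑ l, c i l • u l‖ₑ ^ (-b i) := by
      refine Measurable.mul (Finset.measurable_prod _ fun j _ => ?_) ?_
      · split_ifs <;> fun_prop
      · fun_prop
    rw [lintegral_pi_fin_succ hmeasF]
    have hform : ∀ v x, (∏ j, if A j then (‖∑ i, p j i • (Fin.snoc v x : Fin (m + 1) → UnitAddCircle) i‖ₑ
          + ‖(Fin.snoc v x : Fin (m + 1) → UnitAddCircle) j‖ₑ)⁻¹ else 1) *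
          ∏ i ∈ s, ‖∑ l, c i l • (Fin.snoc v x : Fin (m + 1) → UnitAddCircle) l‖ₑ ^ (-b i)
        = Q v * R v * ((if A (Fin.last m) then
            (‖∑ i : Fin m, p (Fin.last m) i.castSucc • v i‖ₑ + ‖x‖ₑ)⁻¹ else 1) *
          ∏ i ∈ s1, ‖c i (Fin.last m) • x + t v i‖ₑ ^ (-b i)) := by
      intro v x
      rw [hsplit, Fin.prod_univ_castSucc]
      have e0 : ∏ i ∈ s0, ‖∑ l, c i l • (Fin.snoc v x : Fin (m + 1) → UnitAddCircle) l‖ₑ ^ (-b i)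
          = R v := Finset.prod_congr rfl fun i hi => by
        rw [Fin.sum_univ_castSucc, (Finset.mem_filter.1 hi).2]; simp
      have e1 : ∏ i ∈ s1, ‖∑ l, c i l • (Fin.snoc v x : Fin (m + 1) → UnitAddCircle) l‖ₑ ^ (-b i)
          = ∏ i ∈ s1, ‖c i (Fin.last m) • x + t v i‖ₑ ^ (-b i) :=
        Finset.prod_congr rfl fun i hi => by
          rw [Fin.sum_univ_castSucc]; simp [ht, add_comm]
      rw [e0, e1]
      simp only [Fin.sum_univ_castSucc, hplast, Fin.snoc_castSucc, Fin.snoc_last, zero_smul,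
        add_zero]
      ring
    simp_rw [hform]
    rw [Fin.sum_univ_castSucc] at hsum ⊢
    have hcard0 : (0 : ℝ) ≤ ∑ j : Fin m, if A j.castSucc then (1 : ℝ) else 0 :=
      Finset.sum_nonneg fun _ _ => by split_ifs <;> norm_num
    have hs1c : ∀ i ∈ s1, c i (Fin.last m) ≠ 0 := fun i hi => (Finset.mem_filter.1 hi).2
    have hs0c : ∀ i ∈ s0, (fun l : Fin m => c i l.castSucc) ≠ 0 := fun i hi =>
      hne _ (hc i (Finset.mem_filter.1 hi).1) (Finset.mem_filter.1 hi).2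
    by_cases hA : A (Fin.last m)
    · simp only [hA, if_true] at hsum ⊢
      set B := ∑ i ∈ s1, b i with hB
      set q : Fin m → ℤ := fun i => p (Fin.last m) i.castSucc with hq
      have hq0 : q ≠ 0 := hne _ (hp _ hA) (hplast _)
      have hBθ : B + θ ≤ 1 / 2 := by nlinarith [mul_nonneg hcard0 hθ.le]
      have hin : ∀ v, ∫⁻ x : UnitAddCircle, (‖∑ i, q i • v i‖ₑ + ‖x‖ₑ)⁻¹ *
            ∏ i ∈ s1, ‖c i (Fin.last m) • x + t v i‖ₑ ^ (-b i)
          ≤ ‖∑ i, q i • v i‖ₑ ^ (-(B + θ)) * ENNReal.ofReal (2 / θ) := by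
        intro v
        -- The exponent `1 - B - θ` left to `‖x‖` brings the total up to `1 - θ`, the most that the
        -- integral over `x` admits. `none` is the index of this additional factor.
        calc _ ≤ ∫⁻ x : UnitAddCircle, ‖∑ i, q i • v i‖ₑ ^ (-(B + θ)) *
              (∏ i ∈ Finset.insertNone s1, ‖(Option.elim i 1 fun i => c i (Fin.last m)) • x +
                Option.elim i 0 (t v)‖ₑ ^ (-(Option.elim i (1 - B - θ) b))) := by
              refine lintegral_mono fun x => ?_
              rw [Finset.prod_insertNone, ← mul_assoc]
              simp only [Option.elim_none, Option.elim_some, one_smul, add_zero]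
              gcongr
              exact inv_add_le_rpow_mul_rpow _ _ (by linarith) (by linarith) (by ring)
                enorm_ne_top enorm_ne_top
          _ ≤ _ := by
              rw [lintegral_const_mul _ (by fun_prop)]
              gcongr
              refine lintegral_prod_enorm_rpow_le _ _ _ _ ?_ ?_ hθ ?_
              · rw [Finset.forall_mem_insertNone]
                exact ⟨one_ne_zero, hs1c⟩
              · rw [Finset.forall_mem_insertNone]
                exact ⟨by simp only [Option.elim_none]; linarith, hb1⟩
              · rw [Finset.sum_insertNone]; simp only [Option.elim_none, Option.elim_some]
                linarith
      -- The factors of `s1` are gone, and the form `q`, with index `none`, has inherited their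
      -- exponents together with an additional `θ`.
      calc _ ≤ ∫⁻ v : Fin m → UnitAddCircle, Q v * (∏ i ∈ Finset.insertNone s0,
              ‖∑ l, (Option.elim i q fun i l => c i l.castSucc) l • v l‖ₑ ^
                (-(Option.elim i (B + θ) b))) * ENNReal.ofReal (2 / θ) := by
            refine lintegral_mono fun v => ?_
            rw [lintegral_const_mul _ (by fun_prop), Finset.prod_insertNone]
            calc _ ≤ Q v * R v * (‖∑ i, q i • v i‖ₑ ^ (-(B + θ)) * ENNReal.ofReal (2 / θ)) :=
                  mul_le_mul_right (hin v) _
              _ = _ := by simp only [hR, Option.elim_none, Option.elim_some]; ring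
        _ ≤ (4 ^ m * ENNReal.ofReal (1 / θ) ^ (∑ j : Fin m, if A j.castSucc then 1 else 0)) *
              ENNReal.ofReal (2 / θ) := by
            rw [lintegral_mul_const' _ _ ENNReal.ofReal_ne_top]
            gcongr
            refine ih (fun j => A j.castSucc) p' hp'1 hp'2 _ _ _ ?_ ?_ ?_
            · rw [Finset.forall_mem_insertNone]; exact ⟨hq0, hs0c⟩
            · rw [Finset.forall_mem_insertNone]
              exact ⟨by simp only [Option.elim_none]; linarith, hb0⟩
            · rw [Finset.sum_insertNone]; simp only [Option.elim_none, Option.elim_some]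
              rw [hsplitb] at hsum
              linarith
        _ ≤ _ := by
            rw [pow_succ, pow_succ, div_eq_mul_one_div 2 θ, ENNReal.ofReal_mul (by norm_num)]
            calc _ = 4 ^ m * 2 * (ENNReal.ofReal (1 / θ) ^
                    (∑ j : Fin m, if A j.castSucc then 1 else 0) * ENNReal.ofReal (1 / θ)) := by
                  rw [ENNReal.ofReal_ofNat]; ring
              _ ≤ _ := by gcongr; norm_num
    · simp only [hA, if_false, add_zero, one_mul] at hsum ⊢
      have hin : ∀ v, ∫⁻ x : UnitAddCircle,
          ∏ i ∈ s1, ‖c i (Fin.last m) • x + t v i‖ₑ ^ (-b i) ≤ 4 := by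
        intro v
        refine (lintegral_prod_enorm_rpow_le s1 _ _ b hs1c hb1 (θ := 1 / 2) (by norm_num) ?_).trans
          (by norm_num)
        nlinarith [mul_nonneg hcard0 hθ.le]
      calc _ ≤ ∫⁻ v : Fin m → UnitAddCircle, Q v * R v * 4 := by
            refine lintegral_mono fun v => ?_
            rw [lintegral_const_mul _ (by fun_prop)]
            exact mul_le_mul_right (hin v) _
        _ ≤ _ := by
            rw [lintegral_mul_const' _ _ (by norm_num), pow_succ]
            calc _ ≤ (4 ^ m * ENNReal.ofReal (1 / θ) ^
                  (∑ j : Fin m, if A j.castSucc then 1 else 0)) * 4 := by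
                  gcongr
                  refine ih (fun j => A j.castSucc) p' hp'1 hp'2 _ _ _ hs0c hb0 ?_
                  linarith
              _ = _ := by ring

/-! ### Linear forms attached to a word with signs -/

/-- The vertex forms with values in an arbitrary abelian group and with signs: for the edge values
`L_{p+1} + κ • L_p`, the value at a repeated letter is `ε p` times the value at the first
occurrence of that letter. The Toeplitz case is `κ = -1`, and there `ε = -1` gives the forms `stepT`;
the Hankel case is `κ = 1`, `ε = 1`. -/
def signedForm (κ : ℤˣ) {h k : ℕ} (ε : Fin h → ℤˣ) (w : Fin h → Fin k) {M : Type*}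
    [AddCommGroup M] (u : indepVertices w → M) : Fin (h + 1) → M
  | ⟨0, _⟩ => u ⟨0, zero_mem_indepVertices w⟩
  | ⟨i + 1, hi⟩ =>
    if hp : firstOcc w ⟨i, Nat.lt_of_succ_lt_succ hi⟩ = ⟨i, Nat.lt_of_succ_lt_succ hi⟩ then
      u ⟨Fin.succ ⟨i, Nat.lt_of_succ_lt_succ hi⟩, succ_mem_indepVertices w _ hp⟩
    else
      (ε ⟨i, Nat.lt_of_succ_lt_succ hi⟩ : ℤ) •
        (signedForm κ ε w u (firstOcc w ⟨i, Nat.lt_of_succ_lt_succ hi⟩).succ +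
          (κ : ℤ) • signedForm κ ε w u (firstOcc w ⟨i, Nat.lt_of_succ_lt_succ hi⟩).castSucc) -
        (κ : ℤ) • signedForm κ ε w u ⟨i, Nat.lt_of_succ_lt hi⟩
  termination_by v => v.val
  decreasing_by
    all_goals
      have h1 := firstOcc_le w ⟨i, Nat.lt_of_succ_lt_succ hi⟩
      have h2 : (firstOcc w ⟨i, Nat.lt_of_succ_lt_succ hi⟩ : ℕ) ≤ i := h1
      have h3 : (firstOcc w ⟨i, Nat.lt_of_succ_lt_succ hi⟩ : ℕ) = i →
          firstOcc w ⟨i, Nat.lt_of_succ_lt_succ hi⟩ = ⟨i, Nat.lt_of_succ_lt_succ hi⟩ :=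
        fun e => Fin.ext e
      try simp only [Fin.val_castSucc, Fin.val_succ]
      omega

section Forms

variable {h k : ℕ} (κ : ℤˣ) (ε : Fin h → ℤˣ) (w : Fin h → Fin k)

theorem signedForm_zero {M : Type*} [AddCommGroup M] (u : indepVertices w → M) :
    signedForm κ ε w u 0 = u ⟨0, zero_mem_indepVertices w⟩ :=
  signedForm.eq_def κ ε w u 0

theorem signedForm_succ {M : Type*} [AddCommGroup M] (u : indepVertices w → M) (p : Fin h) :
    signedForm κ ε w u p.succ =
      if hp : firstOcc w p = p then u ⟨p.succ, succ_mem_indepVertices w p hp⟩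
      else (ε p : ℤ) • (signedForm κ ε w u (firstOcc w p).succ +
        (κ : ℤ) • signedForm κ ε w u (firstOcc w p).castSucc) -
        (κ : ℤ) • signedForm κ ε w u p.castSucc :=
  signedForm.eq_def κ ε w u p.succ

/-- Induction along the recursion that defines the vertex forms. -/
@[elab_as_elim]
theorem vertex_induction {P : Fin (h + 1) → Prop} (h0 : P 0)
    (hfirst : ∀ p, firstOcc w p = p → P p.succ)
    (hstep : ∀ p, firstOcc w p < p → P (firstOcc w p).castSucc → P (firstOcc w p).succ →
      P p.castSucc → P p.succ) (v : Fin (h + 1)) : P v := by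
  induction hv : v.val using Nat.strong_induction_on generalizing v with
  | _ n ih =>
    subst hv
    refine Fin.cases (fun _ => h0) (fun p ih => ?_) v ih
    by_cases hp : firstOcc w p = p
    · exact hfirst p hp
    · have hlt : firstOcc w p < p := lt_of_le_of_ne (firstOcc_le w p) hp
      have hlt' : (firstOcc w p : ℕ) < p := hlt
      refine hstep p hlt (ih _ ?_ _ rfl) (ih _ ?_ _ rfl) (ih _ ?_ _ rfl) <;> simp <;> omega

theorem apply_firstOcc (p : Fin h) : w (firstOcc w p) = w p :=
  (Finset.mem_filter.1
    (Finset.min'_mem (Finset.univ.filter fun q => w q = w p) ⟨p, by simp⟩)).2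

theorem firstOcc_eq_iff {p q : Fin h} : firstOcc w p = firstOcc w q ↔ w p = w q := by
  constructor
  · intro e
    rw [← apply_firstOcc w p, e, apply_firstOcc w q]
  · intro e
    simp only [firstOcc, e]

theorem firstOcc_idem (p : Fin h) : firstOcc w (firstOcc w p) = firstOcc w p :=
  (firstOcc_eq_iff w).2 (apply_firstOcc w p)

/-- The value of the edge `p` in the vertex labelling `y`. -/
def edgeValue {M : Type*} [AddCommGroup M] (y : Fin (h + 1) → M) (p : Fin h) : M :=
  y p.succ + (κ : ℤ) • y p.castSucc

theorem edgeValue_signedForm {M : Type*} [AddCommGroup M] (u : indepVertices w → M) {p : Fin h}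
    (hp : firstOcc w p ≠ p) :
    edgeValue κ (signedForm κ ε w u) p =
      (ε p : ℤ) • edgeValue κ (signedForm κ ε w u) (firstOcc w p) := by
  rw [edgeValue, signedForm_succ, dif_neg hp, edgeValue]
  abel

/-- A labelling that satisfies the relations between matched edges is determined by its values at
the independent vertices. -/
theorem signedForm_restrict_eq {M : Type*} [AddCommGroup M] (y : Fin (h + 1) → M)
    (hy : ∀ p, firstOcc w p ≠ p → edgeValue κ y p = (ε p : ℤ) • edgeValue κ y (firstOcc w p)) :
    signedForm κ ε w (fun s => y s) = y := by
  funext v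
  refine vertex_induction w ?_ (fun p hp => ?_) (fun p hp ha hb hc => ?_) v
  · rw [signedForm_zero]
  · rw [signedForm_succ, dif_pos hp]
  · rw [signedForm_succ, dif_neg hp.ne, ha, hb, hc, ← edgeValue, ← hy p hp.ne, edgeValue]
    abel

theorem signedForm_map {M N : Type*} [AddCommGroup M] [AddCommGroup N] (ψ : M →+ N)
    (u : indepVertices w → M) (v : Fin (h + 1)) :
    signedForm κ ε w (fun s => ψ (u s)) v = ψ (signedForm κ ε w u v) := by
  refine vertex_induction w ?_ (fun p hp => ?_) (fun p hp ha hb hc => ?_) v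
  · rw [signedForm_zero, signedForm_zero]
  · rw [signedForm_succ, dif_pos hp, signedForm_succ, dif_pos hp]
  · rw [signedForm_succ, dif_neg hp.ne, signedForm_succ κ ε w u p, dif_neg hp.ne, ha, hb, hc]
    simp only [map_sub, map_add, map_zsmul]

/-- The coefficients of the vertex forms. -/
def formCoeff (v : Fin (h + 1)) : indepVertices w → ℤ :=
  signedForm κ ε w (fun s => (Pi.single s 1 : indepVertices w → ℤ)) v

theorem signedForm_eq_sum {M : Type*} [AddCommGroup M] (u : indepVertices w → M)
    (v : Fin (h + 1)) : signedForm κ ε w u v = ∑ s, formCoeff κ ε w v s • u s := by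
  let ψ : (indepVertices w → ℤ) →+ M :=
    { toFun := fun c => ∑ s, c s • u s
      map_zero' := by simp
      map_add' := fun c d => by simp [add_smul, Finset.sum_add_distrib] }
  have hψ : ∀ s, ψ (Pi.single s 1) = u s := fun s => by
    change ∑ s', (Pi.single s 1 : indepVertices w → ℤ) s' • u s' = u s
    simp [Pi.single_apply]
  have := signedForm_map κ ε w ψ (fun s => Pi.single s 1) v
  simp only [hψ] at this
  rw [this]; rfl

theorem formCoeff_zero : formCoeff κ ε w 0 = Pi.single ⟨0, zero_mem_indepVertices w⟩ 1 :=
  signedForm_zero κ ε w _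

theorem formCoeff_succ {p : Fin h} (hp : firstOcc w p = p) :
    formCoeff κ ε w p.succ = Pi.single ⟨p.succ, succ_mem_indepVertices w p hp⟩ 1 := by
  rw [formCoeff, signedForm_succ, dif_pos hp]

theorem formCoeff_eq_zero_of_lt (v : Fin (h + 1)) :
    ∀ s : indepVertices w, v < s.1 → formCoeff κ ε w v s = 0 := by
  refine vertex_induction w ?_ (fun p hp => ?_) (fun p hp ha hb hc => ?_) v
  · intro s hs
    rw [formCoeff_zero, Pi.single_apply, if_neg]
    rintro rfl
    exact lt_irrefl _ hs
  · intro s hs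
    rw [formCoeff_succ κ ε w hp, Pi.single_apply, if_neg]
    rintro rfl
    exact lt_irrefl _ hs
  · intro s hs
    have h1 : p.castSucc < s.1 := (Fin.castSucc_lt_succ).trans hs
    have h2 : (firstOcc w p).succ < s.1 := (Fin.succ_lt_succ_iff.2 hp).trans hs
    have h3 : (firstOcc w p).castSucc < s.1 := (Fin.castSucc_lt_succ).trans h2
    have e := congrFun (signedForm_succ κ ε w
      (fun s => (Pi.single s 1 : indepVertices w → ℤ)) p) s
    rw [dif_neg hp.ne] at e
    change formCoeff κ ε w p.succ s = (ε p : ℤ) • (formCoeff κ ε w (firstOcc w p).succ s +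
      (κ : ℤ) • formCoeff κ ε w (firstOcc w p).castSucc s) -
        (κ : ℤ) • formCoeff κ ε w p.castSucc s at e
    rw [e, ha s h3, hb s h2, hc s h1]
    simp

/-- The coefficient sum of every vertex form is odd, since modulo two the recursion sends
constants to themselves. -/
theorem formCoeff_ne_zero (v : Fin (h + 1)) : formCoeff κ ε w v ≠ 0 := by
  intro h0
  have hodd : ∀ z : ℤˣ, ((z : ℤ) : ZMod 2) = 1 := fun z => by
    rcases Int.units_eq_one_or z with rfl | rfl <;> decide
  have h1 : signedForm κ ε w (fun _ => (1 : ZMod 2)) v = 1 := by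
    refine vertex_induction w ?_ (fun p hp => ?_) (fun p hp ha hb hc => ?_) v
    · rw [signedForm_zero]
    · rw [signedForm_succ, dif_pos hp]
    · rw [signedForm_succ, dif_neg hp.ne, ha, hb, hc]
      simp only [zsmul_eq_mul, hodd]; decide
  rw [signedForm_eq_sum, h0] at h1
  simp at h1

theorem signedForm_const {M : Type*} [AddCommGroup M] {κ ε₀ : ℤˣ}
    (hκ : (ε₀ : ℤ) * (1 + κ) - κ = 1) (m : M) (v : Fin (h + 1)) :
    signedForm κ (fun _ => ε₀) w (fun _ => m) v = m := by
  refine vertex_induction w ?_ (fun p hp => ?_) (fun p hp ha hb hc => ?_) v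
  · rw [signedForm_zero]
  · rw [signedForm_succ, dif_pos hp]
  · rw [signedForm_succ, dif_neg hp.ne, ha, hb, hc]
    calc _ = ((ε₀ : ℤ) * (1 + κ) - κ) • m := by
          rw [sub_smul, mul_smul, add_smul, one_smul]
      _ = m := by rw [hκ, one_smul]

theorem signedForm_add {M : Type*} [AddCommGroup M] (u u' : indepVertices w → M)
    (v : Fin (h + 1)) : signedForm κ ε w (fun s => u s + u' s) v =
      signedForm κ ε w u v + signedForm κ ε w u' v := by
  simp only [signedForm_eq_sum, smul_add, Finset.sum_add_distrib]

theorem vertexForm_stepT (u : indepVertices w → ℝ) (v : Fin (h + 1)) :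
    vertexForm stepT w u v = signedForm (-1) (fun _ => -1) w u v := by
  refine vertex_induction w ?_ (fun p hp => ?_) (fun p hp ha hb hc => ?_) v
  · rw [signedForm_zero, vertexForm_zero]
  · rw [signedForm_succ, vertexForm_succ, dif_pos hp, dif_pos hp]
  · rw [signedForm_succ, vertexForm_succ, dif_neg hp.ne, dif_neg hp.ne, ha, hb, hc, stepT]
    simp; ring

theorem vertexForm_stepH (u : indepVertices w → ℝ) (v : Fin (h + 1)) :
    vertexForm stepH w u v = signedForm 1 (fun _ => 1) w u v := by
  refine vertex_induction w ?_ (fun p hp => ?_) (fun p hp ha hb hc => ?_) v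
  · rw [signedForm_zero, vertexForm_zero]
  · rw [signedForm_succ, vertexForm_succ, dif_pos hp, dif_pos hp]
  · rw [signedForm_succ, vertexForm_succ, dif_neg hp.ne, dif_neg hp.ne, ha, hb, hc, stepH]
    simp; ring

end Forms

/-! ### Closing up the circuit -/

theorem last_eq_add_sum_edgeValue (κ : ℤˣ) {M : Type*} [AddCommGroup M] :
    ∀ {h : ℕ} (y : Fin (h + 1) → M), y (Fin.last h) = (-(κ : ℤ)) ^ h • y 0 +
      ∑ p : Fin h, (-(κ : ℤ)) ^ (h - 1 - p) • edgeValue κ y p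
  | 0, y => by simp
  | h + 1, y => by
    have ih := last_eq_add_sum_edgeValue κ (fun v : Fin (h + 1) => y v.castSucc)
    have e : ∑ p : Fin h, (-(κ : ℤ)) ^ (h + 1 - 1 - p) • edgeValue κ y p.castSucc =
        (-(κ : ℤ)) • ∑ p : Fin h, (-(κ : ℤ)) ^ (h - 1 - p) •
          edgeValue κ (fun v : Fin (h + 1) => y v.castSucc) p := by
      rw [Finset.smul_sum]
      refine Finset.sum_congr rfl fun p _ => ?_
      rw [← mul_smul, ← pow_succ', show h + 1 - 1 - (p : ℕ) = h - 1 - p + 1 by omega]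
      rfl
    rw [Fin.sum_univ_castSucc]
    simp only [Fin.val_castSucc, Fin.val_last]
    rw [e, ← sub_eq_iff_eq_add'.2 ih, edgeValue, show h + 1 - 1 - h = 0 by omega, pow_succ',
      mul_smul, Fin.succ_last, Fin.castSucc_zero]
    simp only [smul_sub, pow_zero, one_smul, neg_smul]
    abel

section Closing

variable {h k : ℕ} (κ : ℤˣ) (ε : Fin h → ℤˣ) (w : Fin h → Fin k)

/-- The coefficient of the edge value of the first occurrence `i` in the last vertex form. -/
def closeCoeff (i : Fin h) : ℤ :=
  ∑ p with firstOcc w p = i, (-(κ : ℤ)) ^ (h - 1 - (p : ℕ)) *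
    (if firstOcc w p = p then 1 else (ε p : ℤ))

theorem signedForm_last {M : Type*} [AddCommGroup M] (u : indepVertices w → M) :
    signedForm κ ε w u (Fin.last h) = (-(κ : ℤ)) ^ h • signedForm κ ε w u 0 +
      ∑ i with firstOcc w i = i, closeCoeff κ ε w i • edgeValue κ (signedForm κ ε w u) i := by
  rw [last_eq_add_sum_edgeValue κ (signedForm κ ε w u)]
  congr 1
  rw [← Finset.sum_fiberwise_of_maps_to (s := Finset.univ) (g := firstOcc w)
    (t := Finset.univ.filter fun i => firstOcc w i = i)
    (fun p _ => by simpa using firstOcc_idem w p)]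
  refine Finset.sum_congr rfl fun i _ => ?_
  rw [closeCoeff, Finset.sum_smul]
  refine Finset.sum_congr rfl fun p hp => ?_
  rw [mul_smul]
  congr 1
  have hpi : firstOcc w p = i := (Finset.mem_filter.1 hp).2
  split_ifs with hf
  · rw [one_smul, ← hpi, hf]
  · rw [edgeValue_signedForm κ ε w u hf, hpi]

theorem signedForm_last_eq {M : Type*} [AddCommGroup M] (u : indepVertices w → M)
    (heven : Even h) (h0 : ∀ i, firstOcc w i = i → closeCoeff κ ε w i = 0) :
    signedForm κ ε w u (Fin.last h) = signedForm κ ε w u 0 := by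
  rw [signedForm_last, Finset.sum_eq_zero fun i hi => ?_]
  · rcases Int.units_eq_one_or κ with rfl | rfl <;> simp [heven.neg_one_pow]
  · rw [h0 i (by simpa using hi), zero_smul]

/-- The value of the edge that is the last one with a nonzero coefficient involves a variable
that occurs in no other term. -/
theorem formCoeff_last_ne {i : Fin h} (hi : firstOcc w i = i) (h0 : closeCoeff κ ε w i ≠ 0) :
    formCoeff κ ε w (Fin.last h) - formCoeff κ ε w 0 ≠ 0 := by
  set T := Finset.univ.filter fun i => firstOcc w i = i ∧ closeCoeff κ ε w i ≠ 0
  have hT : T.Nonempty := ⟨i, by simp [T, hi, h0]⟩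
  have hm := T.max'_mem hT
  set j := T.max' hT with hj
  obtain ⟨-, hj1, hj2⟩ := Finset.mem_filter.1 hm
  intro heq
  set s : indepVertices w := ⟨j.succ, succ_mem_indepVertices w j hj1⟩ with hs
  have e := congrFun (signedForm_last κ ε w (fun s => (Pi.single s 1 : indepVertices w → ℤ))) s
  have e2 := congrFun heq s
  change formCoeff κ ε w (Fin.last h) s - formCoeff κ ε w 0 s = 0 at e2
  have z0 : formCoeff κ ε w 0 s = 0 := formCoeff_eq_zero_of_lt κ ε w 0 s (Fin.succ_pos j)
  change formCoeff κ ε w (Fin.last h) s = _ at e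
  rw [z0, sub_zero] at e2
  rw [e2] at e
  simp only [Pi.add_apply, Pi.smul_apply, Finset.sum_apply] at e
  change 0 = _ • formCoeff κ ε w 0 s + ∑ i with firstOcc w i = i, closeCoeff κ ε w i •
    (formCoeff κ ε w i.succ s + (κ : ℤ) • formCoeff κ ε w i.castSucc s) at e
  rw [z0, smul_zero, zero_add, Finset.sum_eq_single j] at e
  · rw [formCoeff_succ κ ε w hj1, formCoeff_eq_zero_of_lt κ ε w j.castSucc s
      Fin.castSucc_lt_succ] at e
    simp [hs] at e
    exact hj2 e.symm
  · intro i hi hij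
    rcases lt_or_gt_of_ne hij with hlt | hlt
    · rw [formCoeff_eq_zero_of_lt κ ε w i.succ s (Fin.succ_lt_succ_iff.2 hlt),
        formCoeff_eq_zero_of_lt κ ε w i.castSucc s
          ((Fin.castSucc_lt_succ).trans (Fin.succ_lt_succ_iff.2 hlt))]
      simp
    · have : closeCoeff κ ε w i = 0 := by
        by_contra hne
        exact absurd (T.le_max' i (by simpa [T, hne] using hi)) (not_le.2 hlt)
      rw [this, zero_smul]
  · intro hn
    exact absurd (by simpa using hj1) hn

/-- The edge values at two different first occurrences are independent linear forms. -/
theorem edgeValue_formCoeff_add_ne {i j : Fin h} (hi : firstOcc w i = i) (hij : j < i) (σ : ℤˣ) :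
    edgeValue κ (formCoeff κ ε w) i + (σ : ℤ) • edgeValue κ (formCoeff κ ε w) j ≠ 0 := by
  intro heq
  set s : indepVertices w := ⟨i.succ, succ_mem_indepVertices w i hi⟩ with hs
  have e := congrFun heq s
  simp only [edgeValue, Pi.add_apply, Pi.smul_apply, Pi.zero_apply] at e
  rw [formCoeff_succ κ ε w hi, formCoeff_eq_zero_of_lt κ ε w i.castSucc s Fin.castSucc_lt_succ,
    formCoeff_eq_zero_of_lt κ ε w j.succ s (Fin.succ_lt_succ_iff.2 hij),
    formCoeff_eq_zero_of_lt κ ε w j.castSucc s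
      ((Fin.castSucc_lt_succ).trans (Fin.succ_lt_succ_iff.2 hij))] at e
  simp [hs] at e

end Closing

/-! ### The dominating singular weight -/

section Weight

variable {h k : ℕ} (κ : ℤˣ) (ε : Fin h → ℤˣ) (w : Fin h → Fin k)

instance : IsProbabilityMeasure ((volume : Measure ℝ).restrict (Set.Ioo 0 1)) :=
  ⟨by simp⟩

theorem measurePreserving_coe_uniformLaw :
    MeasurePreserving (fun (u : indepVertices w → ℝ) s => (u s : UnitAddCircle))
      (uniformLaw w) volume := by
  refine measurePreserving_pi _ _ fun _ => ?_
  have := UnitAddCircle.measurePreserving_mk 0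
  rwa [zero_add, ← restrict_Ioo_eq_restrict_Ioc] at this

theorem measurePreserving_restrict_finset {ι α : Type*} [Fintype ι] [MeasureSpace α]
    [IsProbabilityMeasure (volume : Measure α)] (S : Finset ι) :
    MeasurePreserving (fun (u : ι → α) (s : S) => u s) volume volume := by
  classical
  convert! measurePreserving_fst.comp
    (volume_preserving_piEquivPiSubtypeProd (fun _ : ι => α) (fun i => i ∈ S))

/-- The number of letters of a word. -/
def numLetters : ℕ := (Finset.univ.filter fun p => firstOcc w p = p).card

/-- The product of `1 / (d x + d y)` over the first edges `(x, y)` of the letters, where `d` is the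
distance to the nearest integer. It dominates the integrands of both models, as well as their
discretizations. -/
def singularWeight (u : indepVertices w → ℝ) : ℝ :=
  ∏ p with firstOcc w p = p, (‖((signedForm κ ε w u p.castSucc : ℝ) : UnitAddCircle)‖ +
    ‖((signedForm κ ε w u p.succ : ℝ) : UnitAddCircle)‖)⁻¹

theorem measurable_signedForm (v : Fin (h + 1)) :
    Measurable fun u : indepVertices w → ℝ => signedForm κ ε w u v := by
  simp only [signedForm_eq_sum]
  fun_prop

theorem continuous_signedForm (v : Fin (h + 1)) :
    Continuous fun u : indepVertices w → ℝ => signedForm κ ε w u v := by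
  simp only [signedForm_eq_sum]
  fun_prop

theorem measurable_singularWeight : Measurable (singularWeight κ ε w) := by
  refine Finset.measurable_prod _ fun p _ => ?_
  have h1 := measurable_signedForm κ ε w p.castSucc
  have h2 := measurable_signedForm κ ε w p.succ
  have h3 : Measurable fun x : ℝ => (x : UnitAddCircle) :=
    (AddCircle.continuous_mk' (1 : ℝ)).measurable
  exact ((h3.comp h1).norm.add (h3.comp h2).norm).inv

theorem singularWeight_nonneg (u : indepVertices w → ℝ) : 0 ≤ singularWeight κ ε w u :=
  Finset.prod_nonneg fun _ _ => by positivity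

theorem lintegral_prod_inv_enorm_le :
    ∫⁻ u, ∏ p with firstOcc w p = p, (‖((signedForm κ ε w u p.castSucc : ℝ) : UnitAddCircle)‖ₑ +
      ‖((signedForm κ ε w u p.succ : ℝ) : UnitAddCircle)‖ₑ)⁻¹ ∂uniformLaw w ≤
      4 ^ (h + 1) * ENNReal.ofReal (2 * (numLetters w + 1)) ^ numLetters w := by
  set Φ : (indepVertices w → UnitAddCircle) → ENNReal := fun u =>
    ∏ p with firstOcc w p = p, (‖signedForm κ ε w u p.castSucc‖ₑ +
      ‖signedForm κ ε w u p.succ‖ₑ)⁻¹ with hΦ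
  have hΦm : Measurable Φ := by
    simp only [hΦ, signedForm_eq_sum]
    fun_prop
  have e1 : ∫⁻ u, ∏ p with firstOcc w p = p, (‖((signedForm κ ε w u p.castSucc : ℝ) : UnitAddCircle)‖ₑ +
      ‖((signedForm κ ε w u p.succ : ℝ) : UnitAddCircle)‖ₑ)⁻¹ ∂uniformLaw w = ∫⁻ u, Φ u := by
    rw [← (measurePreserving_coe_uniformLaw w).lintegral_comp hΦm]
    refine lintegral_congr fun u => Finset.prod_congr rfl fun p _ => ?_
    have hm : ∀ v, signedForm κ ε w (fun s => (u s : UnitAddCircle)) v =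
        ((signedForm κ ε w u v : ℝ) : UnitAddCircle) := fun v =>
      signedForm_map κ ε w (QuotientAddGroup.mk' (AddSubgroup.zmultiples (1 : ℝ))) u v
    rw [hm, hm]
  have : IsProbabilityMeasure (volume : Measure UnitAddCircle) := ⟨UnitAddCircle.measure_univ⟩
  rw [e1, ← (measurePreserving_restrict_finset (indepVertices w)).lintegral_comp hΦm]
  set A : Fin (h + 1) → Prop := Fin.cases False fun p => firstOcc w p = p with hA
  classical
  set P : Fin (h + 1) → Fin (h + 1) → ℤ := Fin.cases 0 fun p i =>
    if hi : i ∈ indepVertices w then formCoeff κ ε w p.castSucc ⟨i, hi⟩ else 0 with hP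
  have hsumA : ∀ (R : Type) [NonAssocSemiring R],
      (∑ j, if A j then (1 : R) else 0) = numLetters w := fun R _ => by
    rw [Fin.sum_univ_succ]
    simp [hA, numLetters]
  have hsumP : ∀ (u : Fin (h + 1) → UnitAddCircle) (p : Fin h),
      ∑ i, P p.succ i • u i = signedForm κ ε w (fun s => u s) p.castSucc := fun u p => by
    rw [signedForm_eq_sum]
    have : ∀ i, P p.succ i • u i = if hi : i ∈ indepVertices w then
        formCoeff κ ε w p.castSucc ⟨i, hi⟩ • u i else 0 := fun i => by
      simp only [hP, Fin.cases_succ]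
      split_ifs <;> simp
    simp_rw [this]
    rw [← Finset.sum_subset (Finset.subset_univ (indepVertices w)), ← Finset.sum_attach]
    · refine Finset.sum_congr rfl fun s _ => ?_
      rw [dif_pos s.2]
    · intro i _ hi
      rw [dif_neg hi]
  -- With no further factors at the start, this `θ` exhausts the budget of `1 / 2` up to one unit.
  have main := lintegral_prod_inv_mul_prod_rpow_le (θ := 1 / (2 * (numLetters w + 1)))
    (by positivity) (h + 1) A P ?_ ?_ (∅ : Finset Unit) (fun _ _ => 0) (fun _ => 0) (by simp)
    (by simp) ?_
  · rw [hsumA ℕ] at main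
    refine le_trans (le_of_eq ?_) (main.trans (le_of_eq ?_))
    · refine lintegral_congr fun u => ?_
      rw [Finset.prod_empty, mul_one, Fin.prod_univ_succ]
      simp only [hΦ]
      rw [Finset.prod_filter]
      simp only [hA, Fin.cases_zero, Fin.cases_succ, if_false, one_mul]
      refine Finset.prod_congr rfl fun p _ => ?_
      split_ifs with hp
      · rw [hsumP, signedForm_succ, dif_pos hp]
      · rfl
    · rw [one_div_one_div]; simp
  · intro j hj
    induction j using Fin.cases with
    | zero => exact hj.elim
    | succ p =>
      intro h0
      refine formCoeff_ne_zero κ ε w p.castSucc (funext fun s => ?_)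
      have := congrFun h0 s.1
      simp only [hP, Fin.cases_succ] at this
      rwa [dif_pos s.2] at this
  · intro j i hji
    induction j using Fin.cases with
    | zero => rfl
    | succ p =>
      simp only [hP, Fin.cases_succ]
      split_ifs with hi
      · exact formCoeff_eq_zero_of_lt κ ε w _ _ (Fin.castSucc_lt_succ.trans_le hji)
      · rfl
  · rw [hsumA ℝ]
    simp only [Finset.sum_empty, zero_add]
    have : (0 : ℝ) ≤ numLetters w := Nat.cast_nonneg _
    rw [mul_one_div, div_le_div_iff₀ (by positivity) (by norm_num)]
    linarith

theorem ofReal_singularWeight_le (u : indepVertices w → ℝ) :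
    ENNReal.ofReal (singularWeight κ ε w u) ≤
      ∏ p with firstOcc w p = p, (‖((signedForm κ ε w u p.castSucc : ℝ) : UnitAddCircle)‖ₑ +
      ‖((signedForm κ ε w u p.succ : ℝ) : UnitAddCircle)‖ₑ)⁻¹ := by
  rw [singularWeight, ENNReal.ofReal_prod_of_nonneg fun _ _ => by positivity]
  refine Finset.prod_le_prod' fun p _ => ?_
  rw [← ofReal_norm, ← ofReal_norm, ← ENNReal.ofReal_add (norm_nonneg _) (norm_nonneg _)]
  exact ENNReal.ofReal_inv_le

theorem lintegral_singularWeight_le :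
    ∫⁻ u, ENNReal.ofReal (singularWeight κ ε w u) ∂uniformLaw w ≤
      4 ^ (h + 1) * ENNReal.ofReal (2 * (numLetters w + 1)) ^ numLetters w :=
  (lintegral_mono fun u => ofReal_singularWeight_le κ ε w u).trans
    (lintegral_prod_inv_enorm_le κ ε w)

theorem integrable_singularWeight : Integrable (singularWeight κ ε w) (uniformLaw w) := by
  refine ⟨(measurable_singularWeight κ ε w).aestronglyMeasurable, ?_⟩
  rw [hasFiniteIntegral_iff_ofReal (Eventually.of_forall (singularWeight_nonneg κ ε w))]
  refine (lintegral_singularWeight_le κ ε w).trans_lt (ENNReal.mul_lt_top (by simp) ?_)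
  exact ENNReal.pow_lt_top ENNReal.ofReal_lt_top

theorem integral_singularWeight_le :
    ∫ u, singularWeight κ ε w u ∂uniformLaw w ≤
      4 ^ (h + 1) * (2 * (numLetters w + 1)) ^ numLetters w := by
  rw [integral_eq_lintegral_of_nonneg_ae (Eventually.of_forall (singularWeight_nonneg κ ε w))
    (measurable_singularWeight κ ε w).aestronglyMeasurable]
  refine ENNReal.toReal_le_of_le_ofReal (by positivity)
    ((lintegral_singularWeight_le κ ε w).trans (le_of_eq ?_))
  rw [ENNReal.ofReal_mul (p := 4 ^ (h + 1)) (by positivity), ENNReal.ofReal_pow (by norm_num),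
    ENNReal.ofReal_pow (by positivity)]
  simp

theorem ae_mem_Ioo : ∀ᵐ u ∂uniformLaw w, ∀ s, u s ∈ Set.Ioo (0 : ℝ) 1 := by
  rw [ae_all_iff]
  intro s
  have h1 : ∀ᵐ x ∂((volume : Measure ℝ).restrict (Set.Ioo 0 1)), x ∈ Set.Ioo (0 : ℝ) 1 :=
    ae_restrict_mem measurableSet_Ioo
  exact (measurePreserving_eval (fun _ : indepVertices w =>
    (volume : Measure ℝ).restrict (Set.Ioo 0 1)) s).quasiMeasurePreserving.ae h1

theorem ae_sum_smul_ne {c : indepVertices w → ℤ} (hc : c ≠ 0) (t : ℝ) :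
    ∀ᵐ u ∂uniformLaw w, ∑ s, c s • u s ≠ t := by
  have hac : uniformLaw w ≪ volume := by
    rw [uniformLaw, ← Measure.restrict_pi_pi, ← volume_pi]
    exact Measure.restrict_le_self.absolutelyContinuous
  suffices hv : ∀ᵐ u : indepVertices w → ℝ, ∑ s, c s • u s ≠ t from hac.ae_le hv
  let ℓ : (indepVertices w → ℝ) →ₗ[ℝ] ℝ :=
    { toFun := fun u => ∑ s, c s • u s
      map_add' := fun u v => by simp [Finset.sum_add_distrib]
      map_smul' := fun a u => by
        simp only [Pi.smul_apply, smul_eq_mul, RingHom.id_apply, Finset.mul_sum]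
        exact Finset.sum_congr rfl fun s _ => by simp; ring }
  have hset : {u : indepVertices w → ℝ | ¬ ∑ s, c s • u s ≠ t} =
      ((AffineSubspace.mk' t ⊥ : AffineSubspace ℝ ℝ).comap ℓ.toAffineMap :
        Set (indepVertices w → ℝ)) := by
    ext u
    simp [ℓ, AffineSubspace.mem_mk', sub_eq_zero]
  rw [ae_iff, hset]
  refine Measure.addHaar_affineSubspace _ _ fun htop => ?_
  obtain ⟨s, hs⟩ := Function.ne_iff.1 hc
  have hall : ∀ u : indepVertices w → ℝ, ∑ s, c s • u s = t := fun u => by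
    have : u ∈ (AffineSubspace.mk' t ⊥ : AffineSubspace ℝ ℝ).comap ℓ.toAffineMap := by
      rw [htop]; trivial
    simpa [ℓ, AffineSubspace.mem_mk', sub_eq_zero] using this
  classical
  have h0 := hall 0
  have h1 := hall (Pi.single s 1)
  simp [Pi.single_apply] at h0 h1
  rw [← h0] at h1
  exact hs (by simpa using h1)

theorem ae_signedForm_ne (v : Fin (h + 1)) (t : ℝ) :
    ∀ᵐ u ∂uniformLaw w, signedForm κ ε w u v ≠ t := by
  simpa only [signedForm_eq_sum] using ae_sum_smul_ne w (formCoeff_ne_zero κ ε w v) t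

theorem ae_signedForm_last_ne {i : Fin h} (hi : firstOcc w i = i)
    (h0 : closeCoeff κ ε w i ≠ 0) :
    ∀ᵐ u ∂uniformLaw w, signedForm κ ε w u (Fin.last h) ≠ signedForm κ ε w u 0 := by
  filter_upwards [ae_sum_smul_ne w (formCoeff_last_ne κ ε w hi h0) 0] with u hu heq
  refine hu ?_
  simp only [Pi.sub_apply, sub_smul, Finset.sum_sub_distrib]
  rw [← signedForm_eq_sum, ← signedForm_eq_sum, heq, sub_self]

theorem ae_edgeValue_add_ne {i j : Fin h} (hi : firstOcc w i = i) (hj : firstOcc w j = j)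
    (hij : i ≠ j) (σ : ℤˣ) : ∀ᵐ u ∂uniformLaw w,
      edgeValue κ (signedForm κ ε w u) i ≠ (σ : ℤ) • edgeValue κ (signedForm κ ε w u) j := by
  have key : ∀ {i j : Fin h}, firstOcc w i = i → j < i → ∀ σ : ℤˣ, ∀ᵐ u ∂uniformLaw w,
      edgeValue κ (signedForm κ ε w u) i ≠ (σ : ℤ) • edgeValue κ (signedForm κ ε w u) j := by
    intro i j hi hij σ
    filter_upwards [ae_sum_smul_ne w (edgeValue_formCoeff_add_ne κ ε w hi hij (-σ)) 0] with u hu heq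
    refine hu ?_
    have : ∑ s, (edgeValue κ (formCoeff κ ε w) i +
        ((-σ : ℤˣ) : ℤ) • edgeValue κ (formCoeff κ ε w) j) s • u s =
        edgeValue κ (signedForm κ ε w u) i +
          ((-σ : ℤˣ) : ℤ) • edgeValue κ (signedForm κ ε w u) j := by
      simp only [edgeValue, signedForm_eq_sum, Finset.smul_sum, ← Finset.sum_add_distrib]
      refine Finset.sum_congr rfl fun s _ => ?_
      simp only [Pi.add_apply, Pi.smul_apply, add_smul, smul_add, mul_smul, smul_eq_mul]
    rw [this, heq, Units.val_neg, neg_smul, add_neg_cancel]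
  rcases lt_or_gt_of_ne hij with hlt | hlt
  · filter_upwards [key hj hlt σ] with u hu heq
    refine hu ?_
    rw [heq, ← mul_smul]
    rcases Int.units_eq_one_or σ with rfl | rfl <;> simp
  · exact key hi hlt σ

end Weight

/-! ### The two matrix models and their circuits -/

/-- The midpoint of the `i`-th of the `n` equal subintervals of `(0, 1)`. -/
def mid (n i : ℕ) : ℝ := ((i : ℝ) + 1 / 2) / n

/-- The data common to the balanced Toeplitz and Hankel matrices: the entry at `(i, j)` is
`x (link i j)` divided by the square root of `n * φ (mid n i) (mid n j)`, and two entries carry the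
same variable exactly if their edge values `j + κ * i` agree up to the sign `ε₀` or, when `κ = -1`,
up to either sign. -/
structure Model where
  /-- The sign in the edge value `j + κ * i`. -/
  κ : ℤˣ
  /-- The sign relating matched edge values in the words that survive in the limit. -/
  ε₀ : ℤˣ
  /-- The index of the variable at an entry. -/
  link : ℕ → ℕ → ℕ
  /-- The balancing function. -/
  φ : ℝ → ℝ → ℝ
  /-- The recursion for the vertex forms. -/
  step : ℝ → ℝ → ℝ → ℝ
  normalized : (ε₀ : ℤ) * (1 + κ) - κ = 1
  link_lt : ∀ {n i j : ℕ}, i < n → j < n → link i j < 2 * n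
  link_eq : ∀ {i j i' j' : ℕ}, (j + κ * i : ℤ) = ε₀ * (j' + κ * i') → link i j = link i' j'
  of_link_eq : ∀ {i j i' j' : ℕ}, link i j = link i' j' →
    (j + κ * i : ℤ) = ε₀ * (j' + κ * i') ∨ (κ = -1 ∧ (j + κ * i : ℤ) = (-ε₀ : ℤˣ) * (j' + κ * i'))
  continuous_φ : Continuous fun z : ℝ × ℝ => φ z.1 z.2
  le_φ : ∀ {x y : ℝ}, x ∈ Set.Ioo (0 : ℝ) 1 → y ∈ Set.Ioo (0 : ℝ) 1 →
    ‖(x : UnitAddCircle)‖ + ‖(y : UnitAddCircle)‖ ≤ φ x y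
  φ_congr : ∀ {n i j i' j' : ℕ}, link i j = link i' j' →
    φ (mid n i) (mid n j) = φ (mid n i') (mid n j')
  vertexForm_eq : ∀ {h k : ℕ} (w : Fin h → Fin k) (u : indepVertices w → ℝ) (v : Fin (h + 1)),
    vertexForm step w u v = signedForm κ (fun _ => ε₀) w u v

theorem mid_mem_Ioo {n i : ℕ} (hi : i < n) : mid n i ∈ Set.Ioo (0 : ℝ) 1 := by
  have hn : (0 : ℝ) < n := by exact_mod_cast (Nat.zero_le i).trans_lt hi
  have hi' : (i : ℝ) + 1 ≤ n := by exact_mod_cast hi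
  refine ⟨by unfold mid; positivity, ?_⟩
  rw [mid, div_lt_one hn]; linarith

theorem mid_injective {n i j : ℕ} (hn : n ≠ 0) (hij : mid n i = mid n j) : i = j := by
  have hn' : (n : ℝ) ≠ 0 := by exact_mod_cast hn
  rw [mid, mid, div_left_inj' hn'] at hij
  exact_mod_cast add_right_cancel hij

/-- Twice a midpoint is an odd multiple of `1 / n`. -/
theorem le_norm_mid {n : ℕ} (hn : n ≠ 0) (i : ℕ) :
    1 / (2 * n) ≤ ‖(mid n i : UnitAddCircle)‖ := by
  have hn' : (0 : ℝ) < n := by positivity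
  rw [UnitAddCircle.norm_eq]
  set z := round (mid n i)
  have e : mid n i - z = ((2 * i + 1 - 2 * n * z : ℤ) : ℝ) / (2 * n) := by
    rw [mid]; push_cast; field_simp
  rw [e, abs_div, abs_of_pos (by positivity : (0 : ℝ) < 2 * n)]
  gcongr
  have : (2 * i + 1 - 2 * n * z : ℤ) ≠ 0 := by
    intro h0
    have : (2 * (n * z - i) : ℤ) = 1 := by linarith
    omega
  exact_mod_cast Int.one_le_abs this

/-- The index of the subinterval of `(0, 1)` that contains `x`. -/
def cell (n : ℕ) [NeZero n] (x : ℝ) : Fin n := Fin.ofNat n ⌊(n : ℝ) * x⌋₊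

theorem measurable_cell (n : ℕ) [NeZero n] : Measurable (cell n) :=
  (measurable_from_top (f := fun m : ℕ => Fin.ofNat n m)).comp
    (Nat.measurable_floor.comp (measurable_const_mul _))

theorem cell_val {n : ℕ} [NeZero n] {x : ℝ} (hx : x ∈ Set.Ioo (0 : ℝ) 1) :
    (cell n x : ℕ) = ⌊(n : ℝ) * x⌋₊ := by
  have hn : (0 : ℝ) < n := by exact_mod_cast NeZero.pos n
  refine Nat.mod_eq_of_lt ?_
  rw [Nat.floor_lt (by have := hx.1; positivity)]
  nlinarith [hx.2]

theorem abs_sub_mid_cell_le {n : ℕ} [NeZero n] {x : ℝ} (hx : x ∈ Set.Ioo (0 : ℝ) 1) :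
    |x - mid n (cell n x)| ≤ 1 / (2 * n) := by
  have hn : (0 : ℝ) < n := by exact_mod_cast NeZero.pos n
  have h0 : 0 ≤ (n : ℝ) * x := by have := hx.1; positivity
  rw [cell_val hx, mid]
  have h1 := Nat.floor_le h0
  have h2 := Nat.lt_floor_add_one ((n : ℝ) * x)
  have e : x - ((⌊(n : ℝ) * x⌋₊ : ℝ) + 1 / 2) / n =
      (2 * (n * x - ⌊(n : ℝ) * x⌋₊) - 1) / (2 * n) := by field_simp; ring
  rw [e, abs_div, abs_of_pos (by positivity : (0 : ℝ) < 2 * n)]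
  gcongr
  rw [abs_le]; constructor <;> linarith

theorem map_cell (n : ℕ) [NeZero n] (i : Fin n) :
    ((volume : Measure ℝ).restrict (Set.Ioo 0 1)).map (cell n) {i} = ENNReal.ofReal (1 / n) := by
  have hn : (0 : ℝ) < n := by exact_mod_cast NeZero.pos n
  rw [Measure.map_apply (measurable_cell n) (measurableSet_singleton i),
    restrict_Ioo_eq_restrict_Ico,
    Measure.restrict_apply (measurable_cell n (measurableSet_singleton i))]
  have hi1 : (i : ℝ) + 1 ≤ n := by exact_mod_cast i.2
  have : cell n ⁻¹' {i} ∩ Set.Ico 0 1 = Set.Ico ((i : ℝ) / n) ((i + 1) / n) := by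
    ext x
    simp only [Set.mem_inter_iff, Set.mem_preimage, Set.mem_singleton_iff, Set.mem_Ico]
    have key : 0 ≤ x → x < 1 → (cell n x = i ↔ (i : ℝ) / n ≤ x ∧ x < (i + 1) / n) := by
      intro h0 h1
      have hx : (cell n x : ℕ) = ⌊(n : ℝ) * x⌋₊ :=
        Nat.mod_eq_of_lt ((Nat.floor_lt (by positivity)).2 (by nlinarith))
      rw [Fin.ext_iff, hx, Nat.floor_eq_iff (by positivity), div_le_iff₀ hn, lt_div_iff₀ hn,
        mul_comm x]
    constructor
    · rintro ⟨h, h0, h1⟩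
      exact (key h0 h1).1 h
    · rintro ⟨ha, hb⟩
      have h0 : 0 ≤ x := le_trans (by positivity) ha
      have h1 : x < 1 := hb.trans_le ((div_le_one hn).2 hi1)
      exact ⟨(key h0 h1).2 ⟨ha, hb⟩, h0, h1⟩
  rw [this, Real.volume_Ico]
  congr 1
  field_simp; ring

theorem card_indepVertices {h k : ℕ} (w : Fin h → Fin k) :
    Fintype.card (indepVertices w) = numLetters w + 1 := by
  rw [Fintype.card_coe, indepVertices, Finset.card_insert_of_notMem, Finset.card_image_of_injective _
    (Fin.succ_injective h), numLetters]
  simp [Fin.succ_ne_zero]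

theorem integral_comp_cell {h k : ℕ} (w : Fin h → Fin k) (n : ℕ) [NeZero n]
    (H : (indepVertices w → Fin n) → ℝ) :
    ∫ u, H (fun s => cell n (u s)) ∂uniformLaw w =
      (1 / n : ℝ) ^ (numLetters w + 1) * ∑ a, H a := by
  have hm : MeasurePreserving (fun (u : indepVertices w → ℝ) s => cell n (u s)) (uniformLaw w)
      (Measure.pi fun _ => ((volume : Measure ℝ).restrict (Set.Ioo 0 1)).map (cell n)) := by
    have : IsProbabilityMeasure (((volume : Measure ℝ).restrict (Set.Ioo 0 1)).map (cell n)) :=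
      Measure.isProbabilityMeasure_map (measurable_cell n).aemeasurable
    exact measurePreserving_pi _ _ fun _ => (measurable_cell n).measurePreserving _
  have : IsProbabilityMeasure (((volume : Measure ℝ).restrict (Set.Ioo 0 1)).map (cell n)) :=
    Measure.isProbabilityMeasure_map (measurable_cell n).aemeasurable
  have e := integral_map (μ := uniformLaw w) hm.measurable.aemeasurable
    (measurable_of_finite H).aestronglyMeasurable
  rw [← e, hm.map_eq, integral_fintype (Integrable.of_finite), Finset.mul_sum]
  refine Finset.sum_congr rfl fun a _ => ?_
  rw [measureReal_def, Measure.pi_singleton]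
  simp_rw [map_cell]
  rw [Finset.prod_const, Finset.card_univ, card_indepVertices, ENNReal.toReal_pow,
    ENNReal.toReal_ofReal (by positivity), smul_eq_mul]

section Circuits

variable (𝓜 : Model) {h : ℕ} (n : ℕ)

/-- The word of links along a path of vertices. -/
def Model.linkWord (π : Fin (h + 1) → Fin n) (p : Fin h) : Fin (2 * n) :=
  ⟨𝓜.link (π p.castSucc) (π p.succ), 𝓜.link_lt (π p.castSucc).2 (π p.succ).2⟩

/-- The edge value of a path, as an integer. -/
def Model.intEdge {n : ℕ} (π : Fin (h + 1) → Fin n) (p : Fin h) : ℤ :=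
  ((π p.succ : ℕ) : ℤ) + 𝓜.κ * ((π p.castSucc : ℕ) : ℤ)

open Classical in
/-- The signs that relate the edge values of a path to those at the first occurrences of the same
links. -/
def Model.pathSign (π : Fin (h + 1) → Fin n) (p : Fin h) : ℤˣ :=
  if 𝓜.intEdge π p = 𝓜.ε₀ * 𝓜.intEdge π (firstOcc (𝓜.linkWord n π) p) ∨
    firstOcc (𝓜.linkWord n π) p = p then 𝓜.ε₀ else -𝓜.ε₀

open Classical in
/-- The closed paths with a given matching of their links and given signs. -/
def Model.circuits (f : Fin h → Fin h) (ε : Fin h → ℤˣ) : Finset (Fin (h + 1) → Fin n) :=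
  Finset.univ.filter fun π => π (Fin.last h) = π 0 ∧ firstOcc (𝓜.linkWord n π) = f ∧
    𝓜.pathSign n π = ε

/-- The product of the balancing weights along a path. -/
def Model.weight (y : Fin (h + 1) → ℝ) : ℝ :=
  ∏ p : Fin h, (√(n * 𝓜.φ (y p.castSucc) (y p.succ)))⁻¹

variable {n}

theorem Model.intEdge_eq_pathSign {π : Fin (h + 1) → Fin n} {p : Fin h}
    (hp : firstOcc (𝓜.linkWord n π) p ≠ p) :
    𝓜.intEdge π p = 𝓜.pathSign n π p * 𝓜.intEdge π (firstOcc (𝓜.linkWord n π) p) ∧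
      (1 + (𝓜.κ : ℤ)) * 𝓜.pathSign n π p = 1 + 𝓜.κ := by
  have hl := congrArg Fin.val (apply_firstOcc (𝓜.linkWord n π) p)
  have hl' := 𝓜.of_link_eq hl.symm
  by_cases hc : 𝓜.intEdge π p = 𝓜.ε₀ * 𝓜.intEdge π (firstOcc (𝓜.linkWord n π) p)
  · rw [Model.pathSign, if_pos (Or.inl hc)]
    exact ⟨hc, by linarith [𝓜.normalized]⟩
  · rw [Model.pathSign, if_neg (by tauto)]
    rcases hl' with h1 | ⟨h1, h2⟩
    · exact absurd h1 hc
    · exact ⟨h2, by simp [h1]⟩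

theorem edgeValue_mid {n : ℕ} (π : Fin (h + 1) → Fin n) (p : Fin h) :
    edgeValue 𝓜.κ (fun v => mid n (π v)) p =
      ((𝓜.intEdge π p : ℝ) + (1 + (𝓜.κ : ℤ) : ℤ) / 2) / n := by
  simp only [edgeValue, mid, Model.intEdge, zsmul_eq_mul]
  push_cast
  ring

theorem edgeValue_mid_eq {n : ℕ} (π : Fin (h + 1) → Fin n) {p q : Fin h} {σ : ℤˣ}
    (h1 : 𝓜.intEdge π p = σ * 𝓜.intEdge π q) (h2 : (1 + (𝓜.κ : ℤ)) * σ = 1 + 𝓜.κ) :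
    edgeValue 𝓜.κ (fun v => mid n (π v)) p =
      (σ : ℤ) • edgeValue 𝓜.κ (fun v => mid n (π v)) q := by
  rw [edgeValue_mid, edgeValue_mid, h1, zsmul_eq_mul]
  nth_rewrite 1 [← h2]
  push_cast
  ring

theorem Model.signedForm_mid {k : ℕ} {w : Fin h → Fin k} {ε : Fin h → ℤˣ}
    {π : Fin (h + 1) → Fin n} (hπ : π ∈ 𝓜.circuits n (firstOcc w) ε) (v : Fin (h + 1)) :
    signedForm 𝓜.κ ε w (fun s => mid n (π s)) v = mid n (π v) := by
  obtain ⟨-, -, hf, hε⟩ := Finset.mem_filter.1 hπ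
  refine congrFun (signedForm_restrict_eq 𝓜.κ ε w (fun v => mid n (π v)) fun p hp => ?_) v
  rw [← hf] at hp ⊢
  obtain ⟨h1, h2⟩ := 𝓜.intEdge_eq_pathSign hp
  rw [hε] at h1 h2
  exact edgeValue_mid_eq 𝓜 π h1 h2

/-- The edges of a circuit at which a letter repeats have the same weight as the first one. -/
theorem Model.φ_firstOcc {k : ℕ} {w : Fin h → Fin k} {ε : Fin h → ℤˣ}
    {π : Fin (h + 1) → Fin n} (hπ : π ∈ 𝓜.circuits n (firstOcc w) ε) (p : Fin h) :
    𝓜.φ (mid n (π p.castSucc)) (mid n (π p.succ)) =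
      𝓜.φ (mid n (π (firstOcc w p).castSucc)) (mid n (π (firstOcc w p).succ)) := by
  obtain ⟨-, -, hf, -⟩ := Finset.mem_filter.1 hπ
  refine 𝓜.φ_congr ?_
  have hl := congrArg Fin.val (apply_firstOcc (𝓜.linkWord n π) p)
  rw [hf] at hl
  exact hl.symm

variable (n) {k : ℕ} (w : Fin h → Fin k) (ε : Fin h → ℤˣ)

open Classical in
/-- The summand of a circuit, in terms of the values of the circuit at the independent vertices,
scaled so that it has a limit. -/
def Model.latticeIntegrand (a : indepVertices w → Fin n) : ℝ :=
  if ∃ π ∈ 𝓜.circuits n (firstOcc w) ε, ∀ s : indepVertices w, π s = a s then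
    (n : ℝ) ^ numLetters w * 𝓜.weight n (signedForm 𝓜.κ ε w fun s => mid n (a s)) else 0

theorem Model.sum_weight_circuits [NeZero n] :
    (1 / n : ℝ) * ∑ π ∈ 𝓜.circuits n (firstOcc w) ε, 𝓜.weight n (fun v => mid n (π v)) =
      ∫ u, 𝓜.latticeIntegrand n w ε (fun s => cell n (u s)) ∂uniformLaw w := by
  classical
  have hn : (n : ℝ) ≠ 0 := by exact_mod_cast NeZero.ne n
  rw [integral_comp_cell]
  have e : ∑ a, 𝓜.latticeIntegrand n w ε a = (n : ℝ) ^ numLetters w *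
      ∑ π ∈ 𝓜.circuits n (firstOcc w) ε, 𝓜.weight n (fun v => mid n (π v)) := by
    simp only [Model.latticeIntegrand]
    rw [← Finset.sum_filter, Finset.mul_sum]
    symm
    refine Finset.sum_bij (fun π _ s => π s) (fun π hπ => ?_) (fun π hπ π' hπ' he => ?_)
      (fun a ha => ?_) (fun π hπ => ?_)
    · simpa using ⟨π, hπ, fun _ _ => rfl⟩
    · funext v
      refine Fin.ext (mid_injective (NeZero.ne n) ?_)
      rw [← 𝓜.signedForm_mid hπ v, ← 𝓜.signedForm_mid hπ' v]
      congr 1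
      funext s
      rw [congrFun he s]
    · obtain ⟨π, hπ, hs⟩ := (Finset.mem_filter.1 ha).2
      exact ⟨π, hπ, funext hs⟩
    · congr 2
      funext v
      exact (𝓜.signedForm_mid hπ v).symm
  rw [e, pow_succ, one_div, inv_pow]
  field_simp

end Circuits

/-! ### Limits of the sums over circuits -/

section Limits

variable (𝓜 : Model) {h k : ℕ} (w : Fin h → Fin k) (ε : Fin h → ℤˣ)

/-- The number of positions that carry the same letter as the first occurrence `i`. -/
def blockSize (i : Fin h) : ℕ := (Finset.univ.filter fun p => firstOcc w p = i).card

theorem Model.φ_mid_pos {n : ℕ} (i j : Fin n) :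
    1 ≤ n * 𝓜.φ (mid n i) (mid n j) := by
  have hn : n ≠ 0 := by rintro rfl; exact i.elim0
  have hn' : (0 : ℝ) < n := by positivity
  have h1 := 𝓜.le_φ (mid_mem_Ioo i.2) (mid_mem_Ioo j.2)
  have h2 := le_norm_mid hn i
  have h3 := le_norm_mid hn j
  calc (1 : ℝ) = n * (1 / (2 * n) + 1 / (2 * n)) := by field_simp; norm_num
    _ ≤ _ := by gcongr; linarith

theorem Model.pow_mul_weight {n : ℕ} {π : Fin (h + 1) → Fin n}
    (hπ : π ∈ 𝓜.circuits n (firstOcc w) ε) :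
    (n : ℝ) ^ numLetters w * 𝓜.weight n (fun v => mid n (π v)) =
      ∏ i with firstOcc w i = i, n *
        (√(n * 𝓜.φ (mid n (π i.castSucc)) (mid n (π i.succ))))⁻¹ ^ blockSize w i := by
  rw [Finset.prod_mul_distrib, Finset.prod_const, ← numLetters, Model.weight]
  congr 1
  rw [← Finset.prod_fiberwise_of_maps_to (s := Finset.univ) (g := firstOcc w)
    (t := Finset.univ.filter fun i => firstOcc w i = i)
    (fun p _ => by simpa using firstOcc_idem w p)]
  refine Finset.prod_congr rfl fun i _ => ?_
  rw [blockSize, ← Finset.prod_const]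
  refine Finset.prod_congr rfl fun p hp => ?_
  rw [𝓜.φ_firstOcc hπ p, (Finset.mem_filter.1 hp).2]

theorem mul_inv_sqrt_pow_two {n x : ℝ} (hn : 0 < n) (hx : 0 < x) :
    n * (√(n * x))⁻¹ ^ 2 = x⁻¹ := by
  rw [inv_pow, Real.sq_sqrt (by positivity)]
  field_simp

theorem inv_sqrt_le_one {y : ℝ} (hy : 1 ≤ y) : (√y)⁻¹ ≤ 1 :=
  inv_le_one_of_one_le₀ (Real.one_le_sqrt.2 hy)

theorem mul_inv_sqrt_pow_le {n x : ℝ} (hn : 0 < n) (hx : 1 ≤ n * x) {m : ℕ} (hm : 2 ≤ m) :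
    n * (√(n * x))⁻¹ ^ m ≤ x⁻¹ := by
  have hx0 : 0 < x := pos_of_mul_pos_right (by linarith) hn.le
  rw [← mul_inv_sqrt_pow_two hn hx0]
  gcongr ?_ * ?_
  exact pow_le_pow_of_le_one (by positivity) (inv_sqrt_le_one hx) hm

theorem mul_inv_sqrt_pow_le' {n x : ℝ} (hn : 0 < n) (hx : 1 ≤ n * x) {m : ℕ} (hm : 3 ≤ m) :
    n * (√(n * x))⁻¹ ^ m ≤ x⁻¹ * (√(n * x))⁻¹ := by
  have hx0 : 0 < x := pos_of_mul_pos_right (by linarith) hn.le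
  rw [← mul_inv_sqrt_pow_two hn hx0, mul_assoc, ← pow_succ]
  gcongr ?_ * ?_
  exact pow_le_pow_of_le_one (by positivity) (inv_sqrt_le_one hx) hm

/-- A Lipschitz constant of all the vertex forms, plus one. -/
def formBound (κ : ℤˣ) : ℝ := 1 + ∑ v, ∑ s, |(formCoeff κ ε w v s : ℝ)|

theorem one_le_formBound (κ : ℤˣ) : 1 ≤ formBound w ε κ :=
  le_add_of_nonneg_right (Finset.sum_nonneg fun _ _ => Finset.sum_nonneg fun _ _ => abs_nonneg _)

theorem abs_signedForm_sub_le (κ : ℤˣ) (u u' : indepVertices w → ℝ) {δ : ℝ} (hδ : 0 ≤ δ)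
    (hu : ∀ s, |u s - u' s| ≤ δ) (v : Fin (h + 1)) :
    |signedForm κ ε w u v - signedForm κ ε w u' v| ≤ (formBound w ε κ - 1) * δ := by
  rw [signedForm_eq_sum, signedForm_eq_sum, ← Finset.sum_sub_distrib]
  calc _ ≤ ∑ s, |formCoeff κ ε w v s • u s - formCoeff κ ε w v s • u' s| :=
        Finset.abs_sum_le_sum_abs _ _
    _ ≤ ∑ s, |(formCoeff κ ε w v s : ℝ)| * δ := by
        refine Finset.sum_le_sum fun s _ => ?_
        rw [← smul_sub, zsmul_eq_mul, abs_mul]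
        gcongr
        exact hu s
    _ = (∑ s, |(formCoeff κ ε w v s : ℝ)|) * δ := by rw [Finset.sum_mul]
    _ ≤ _ := by
        gcongr
        rw [formBound, add_sub_cancel_left]
        exact Finset.single_le_sum (f := fun v => ∑ s, |(formCoeff κ ε w v s : ℝ)|)
          (fun _ _ => Finset.sum_nonneg fun _ _ => abs_nonneg _) (Finset.mem_univ v)

theorem norm_coe_le_abs (x : ℝ) : ‖(x : UnitAddCircle)‖ ≤ |x| := by
  rw [UnitAddCircle.norm_eq]
  simpa using round_le x 0

/-- The values of a circuit stay away from the integers by half a cell, so passing to the midpoints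
of the cells changes the distance to the integers by a bounded factor only. -/
theorem norm_signedForm_le {n : ℕ} [NeZero n] {u : indepVertices w → ℝ}
    (hu : ∀ s, u s ∈ Set.Ioo (0 : ℝ) 1) {κ : ℤˣ} {v : Fin (h + 1)} {j : Fin n}
    (hj : signedForm κ ε w (fun s => mid n (cell n (u s))) v = mid n j) :
    ‖((signedForm κ ε w u v : ℝ) : UnitAddCircle)‖ ≤
      formBound w ε κ * ‖(mid n j : UnitAddCircle)‖ := by
  have hδ : (0 : ℝ) ≤ 1 / (2 * n) := by positivity
  have h1 := abs_signedForm_sub_le w ε κ u (fun s => mid n (cell n (u s))) hδ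
    (fun s => abs_sub_mid_cell_le (hu s)) v
  rw [hj] at h1
  have h2 := le_norm_mid (NeZero.ne n) (j : ℕ)
  have hK := one_le_formBound w ε κ
  calc ‖((signedForm κ ε w u v : ℝ) : UnitAddCircle)‖
      = ‖((mid n j : ℝ) : UnitAddCircle) + ((signedForm κ ε w u v - mid n j : ℝ) : UnitAddCircle)‖ := by
        rw [← AddCircle.coe_add]; congr 2; ring
    _ ≤ ‖(mid n j : UnitAddCircle)‖ + |signedForm κ ε w u v - mid n j| :=
        (norm_add_le _ _).trans (add_le_add_right (norm_coe_le_abs _) _)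
    _ ≤ ‖(mid n j : UnitAddCircle)‖ + (formBound w ε κ - 1) * ‖(mid n j : UnitAddCircle)‖ := by
        refine add_le_add_right (h1.trans ?_) _
        gcongr
    _ = _ := by ring

variable {w ε}

theorem norm_coe_pos {x : ℝ} (hx : x ∈ Set.Ioo (0 : ℝ) 1) : 0 < ‖(x : UnitAddCircle)‖ := by
  rw [norm_pos_iff, Ne, AddCircle.coe_eq_zero_iff_of_mem_Ico ⟨hx.1.le, by simpa using hx.2⟩]
  exact hx.1.ne'

theorem Model.le_φ_of_circuit {n : ℕ} [NeZero n] {u : indepVertices w → ℝ}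
    (hu : ∀ s, u s ∈ Set.Ioo (0 : ℝ) 1) {π : Fin (h + 1) → Fin n}
    (hπ : π ∈ 𝓜.circuits n (firstOcc w) ε)
    (hs : ∀ s : indepVertices w, π s = cell n (u s)) (p : Fin h) :
    ‖((signedForm 𝓜.κ ε w u p.castSucc : ℝ) : UnitAddCircle)‖ +
      ‖((signedForm 𝓜.κ ε w u p.succ : ℝ) : UnitAddCircle)‖ ≤
      formBound w ε 𝓜.κ * 𝓜.φ (mid n (π p.castSucc)) (mid n (π p.succ)) := by
  have hm : ∀ v, signedForm 𝓜.κ ε w (fun s => mid n (cell n (u s))) v = mid n (π v) := fun v => by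
    simp_rw [← hs]
    exact 𝓜.signedForm_mid hπ v
  have h1 := norm_signedForm_le w ε hu (hm p.castSucc)
  have h2 := norm_signedForm_le w ε hu (hm p.succ)
  have h3 := 𝓜.le_φ (mid_mem_Ioo (π p.castSucc).2) (mid_mem_Ioo (π p.succ).2)
  have hK := one_le_formBound w ε 𝓜.κ
  nlinarith

theorem pos_of_firstOcc {κ : ℤˣ} {u : indepVertices w → ℝ}
    (hu : ∀ s, u s ∈ Set.Ioo (0 : ℝ) 1) {p : Fin h} (hp : firstOcc w p = p) :
    0 < ‖((signedForm κ ε w u p.castSucc : ℝ) : UnitAddCircle)‖ +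
      ‖((signedForm κ ε w u p.succ : ℝ) : UnitAddCircle)‖ := by
  refine add_pos_of_nonneg_of_pos (norm_nonneg _) ?_
  rw [signedForm_succ, dif_pos hp]
  exact norm_coe_pos (hu _)

theorem Model.prod_inv_φ_le {n : ℕ} [NeZero n] {u : indepVertices w → ℝ}
    (hu : ∀ s, u s ∈ Set.Ioo (0 : ℝ) 1) {π : Fin (h + 1) → Fin n}
    (hπ : π ∈ 𝓜.circuits n (firstOcc w) ε)
    (hs : ∀ s : indepVertices w, π s = cell n (u s)) :
    ∏ i with firstOcc w i = i, (𝓜.φ (mid n (π i.castSucc)) (mid n (π i.succ)))⁻¹ ≤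
      formBound w ε 𝓜.κ ^ numLetters w * singularWeight 𝓜.κ ε w u := by
  have hK := one_le_formBound w ε 𝓜.κ
  rw [numLetters, ← Finset.prod_const, singularWeight, ← Finset.prod_mul_distrib]
  refine Finset.prod_le_prod (fun i _ => ?_) fun i hi => ?_
  · have := 𝓜.φ_mid_pos (π i.castSucc) (π i.succ)
    exact inv_nonneg.2 (pos_of_mul_pos_right (by linarith) (Nat.cast_nonneg n)).le
  · have hpos := pos_of_firstOcc (κ := 𝓜.κ) (ε := ε) hu (Finset.mem_filter.1 hi).2
    have hle := 𝓜.le_φ_of_circuit hu hπ hs i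
    have hφ : 0 < 𝓜.φ (mid n (π i.castSucc)) (mid n (π i.succ)) :=
      pos_of_mul_pos_right (hpos.trans_le hle) (by linarith)
    rw [← div_eq_mul_inv, inv_eq_one_div, div_le_div_iff₀ hφ hpos]
    linarith

theorem Model.latticeIntegrand_nonneg {n : ℕ} (a : indepVertices w → Fin n) :
    0 ≤ 𝓜.latticeIntegrand n w ε a := by
  rw [Model.latticeIntegrand]
  split_ifs
  · exact mul_nonneg (by positivity) (Finset.prod_nonneg fun _ _ => by positivity)
  · exact le_rfl

theorem Model.latticeIntegrand_eq {n : ℕ} {a : indepVertices w → Fin n}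
    {π : Fin (h + 1) → Fin n} (hπ : π ∈ 𝓜.circuits n (firstOcc w) ε)
    (hs : ∀ s : indepVertices w, π s = a s) :
    𝓜.latticeIntegrand n w ε a = ∏ i with firstOcc w i = i, n *
        (√(n * 𝓜.φ (mid n (π i.castSucc)) (mid n (π i.succ))))⁻¹ ^ blockSize w i := by
  rw [Model.latticeIntegrand, if_pos ⟨π, hπ, hs⟩, ← 𝓜.pow_mul_weight w ε hπ]
  congr 2
  funext v
  simp_rw [← hs]
  exact 𝓜.signedForm_mid hπ v

theorem Model.latticeIntegrand_le (hb : ∀ i, firstOcc w i = i → 2 ≤ blockSize w i)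
    {n : ℕ} [NeZero n] {u : indepVertices w → ℝ} (hu : ∀ s, u s ∈ Set.Ioo (0 : ℝ) 1) :
    𝓜.latticeIntegrand n w ε (fun s => cell n (u s)) ≤
      formBound w ε 𝓜.κ ^ numLetters w * singularWeight 𝓜.κ ε w u := by
  have hn : (0 : ℝ) < n := by exact_mod_cast NeZero.pos n
  by_cases hv : ∃ π ∈ 𝓜.circuits n (firstOcc w) ε, ∀ s : indepVertices w, π s = cell n (u s)
  · obtain ⟨π, hπ, hs⟩ := hv
    rw [𝓜.latticeIntegrand_eq hπ hs]
    refine le_trans (Finset.prod_le_prod (fun i _ => by positivity) fun i hi => ?_)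
      (𝓜.prod_inv_φ_le hu hπ hs)
    exact mul_inv_sqrt_pow_le hn (𝓜.φ_mid_pos _ _) (hb i (Finset.mem_filter.1 hi).2)
  · rw [Model.latticeIntegrand, if_neg hv]
    exact mul_nonneg (pow_nonneg (by linarith [one_le_formBound w ε 𝓜.κ]) _)
      (singularWeight_nonneg _ _ _ _)

/-- A letter that occurs at least three times contributes an additional small factor. -/
theorem Model.latticeIntegrand_le' (hb : ∀ i, firstOcc w i = i → 2 ≤ blockSize w i)
    {i₀ : Fin h} (hi₀ : firstOcc w i₀ = i₀) (hb₀ : 3 ≤ blockSize w i₀)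
    {n : ℕ} [NeZero n] {u : indepVertices w → ℝ} (hu : ∀ s, u s ∈ Set.Ioo (0 : ℝ) 1) :
    𝓜.latticeIntegrand n w ε (fun s => cell n (u s)) ≤
      formBound w ε 𝓜.κ ^ numLetters w * singularWeight 𝓜.κ ε w u *
        (√(n * ((‖((signedForm 𝓜.κ ε w u i₀.castSucc : ℝ) : UnitAddCircle)‖ +
          ‖((signedForm 𝓜.κ ε w u i₀.succ : ℝ) : UnitAddCircle)‖) / formBound w ε 𝓜.κ)))⁻¹ := by
  have hn : (0 : ℝ) < n := by exact_mod_cast NeZero.pos n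
  have hK := one_le_formBound w ε 𝓜.κ
  by_cases hv : ∃ π ∈ 𝓜.circuits n (firstOcc w) ε, ∀ s : indepVertices w, π s = cell n (u s)
  · obtain ⟨π, hπ, hs⟩ := hv
    rw [𝓜.latticeIntegrand_eq hπ hs]
    have hmem : i₀ ∈ Finset.univ.filter fun i => firstOcc w i = i := by simpa using hi₀
    calc _ ≤ ∏ i with firstOcc w i = i, (𝓜.φ (mid n (π i.castSucc)) (mid n (π i.succ)))⁻¹ *
            (if i = i₀ then
              (√(n * 𝓜.φ (mid n (π i.castSucc)) (mid n (π i.succ))))⁻¹ else 1) := by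
          refine Finset.prod_le_prod (fun i _ => by positivity) fun i hi => ?_
          split_ifs with h0
          · subst h0
            exact mul_inv_sqrt_pow_le' hn (𝓜.φ_mid_pos _ _) hb₀
          · rw [mul_one]
            exact mul_inv_sqrt_pow_le hn (𝓜.φ_mid_pos _ _) (hb i (Finset.mem_filter.1 hi).2)
      _ = (∏ i with firstOcc w i = i, (𝓜.φ (mid n (π i.castSucc)) (mid n (π i.succ)))⁻¹) *
            (√(n * 𝓜.φ (mid n (π i₀.castSucc)) (mid n (π i₀.succ))))⁻¹ := by
          rw [Finset.prod_mul_distrib, Finset.prod_ite_eq' _ i₀, if_pos hmem]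
      _ ≤ _ := by
          have hpos := pos_of_firstOcc (κ := 𝓜.κ) (ε := ε) hu hi₀
          gcongr
          · exact mul_nonneg (by positivity) (singularWeight_nonneg _ _ _ _)
          · exact 𝓜.prod_inv_φ_le hu hπ hs
          · rw [div_le_iff₀' (by linarith)]
            exact 𝓜.le_φ_of_circuit hu hπ hs i₀
  · rw [Model.latticeIntegrand, if_neg hv]
    exact mul_nonneg (mul_nonneg (pow_nonneg (by linarith) _)
      (singularWeight_nonneg _ _ _ _)) (by positivity)

theorem measurable_latticeIntegrand_cell (n : ℕ) [NeZero n] :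
    Measurable fun u : indepVertices w → ℝ =>
      𝓜.latticeIntegrand n w ε (fun s => cell n (u s)) :=
  (measurable_of_finite (𝓜.latticeIntegrand n w ε)).comp
    (measurable_pi_iff.2 fun s => (measurable_cell n).comp (measurable_pi_apply s))

/-- Dominated convergence for the sums over circuits. -/
theorem Model.tendsto_sum_weight (hb : ∀ i, firstOcc w i = i → 2 ≤ blockSize w i)
    {g : (indepVertices w → ℝ) → ℝ}
    (hlim : ∀ᵐ u ∂uniformLaw w, (∀ s, u s ∈ Set.Ioo (0 : ℝ) 1) →
      Tendsto (fun n : ℕ => 𝓜.latticeIntegrand (n + 1) w ε (fun s => cell (n + 1) (u s))) atTop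
        (𝓝 (g u))) :
    Tendsto (fun n : ℕ => (1 / (n + 1 : ℕ) : ℝ) * ∑ π ∈ 𝓜.circuits (n + 1) (firstOcc w) ε,
      𝓜.weight (n + 1) (fun v => mid (n + 1) (π v))) atTop (𝓝 (∫ u, g u ∂uniformLaw w)) := by
  simp_rw [𝓜.sum_weight_circuits (n := _ + 1) w ε]
  refine tendsto_integral_of_dominated_convergence
    (fun u => formBound w ε 𝓜.κ ^ numLetters w * singularWeight 𝓜.κ ε w u)
    (fun n => (measurable_latticeIntegrand_cell 𝓜 (n + 1)).aestronglyMeasurable)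
    ((integrable_singularWeight 𝓜.κ ε w).const_mul _) (fun n => ?_) ?_
  · filter_upwards [ae_mem_Ioo w] with u hu
    rw [Real.norm_of_nonneg (𝓜.latticeIntegrand_nonneg _)]
    exact 𝓜.latticeIntegrand_le hb hu
  · filter_upwards [ae_mem_Ioo w, hlim] with u hu hl using hl hu

theorem tendsto_mid_cell {u : indepVertices w → ℝ} (hu : ∀ s, u s ∈ Set.Ioo (0 : ℝ) 1) :
    Tendsto (fun n : ℕ => fun s => mid (n + 1) (cell (n + 1) (u s))) atTop (𝓝 u) := by
  refine tendsto_pi_nhds.2 fun s => tendsto_iff_dist_tendsto_zero.2 ?_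
  refine squeeze_zero (fun _ => dist_nonneg) (fun n => ?_)
    (tendsto_one_div_add_atTop_nhds_zero_nat (𝕜 := ℝ))
  rw [dist_comm, Real.dist_eq]
  refine (abs_sub_mid_cell_le (n := n + 1) (hu s)).trans ?_
  push_cast
  exact one_div_le_one_div_of_le (by positivity) (by nlinarith [(Nat.cast_nonneg n : (0:ℝ) ≤ n)])

theorem tendsto_signedForm_mid_cell {u : indepVertices w → ℝ}
    (hu : ∀ s, u s ∈ Set.Ioo (0 : ℝ) 1) (κ : ℤˣ) (v : Fin (h + 1)) :
    Tendsto (fun n : ℕ => signedForm κ ε w (fun s => mid (n + 1) (cell (n + 1) (u s))) v) atTop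
      (𝓝 (signedForm κ ε w u v)) :=
  ((continuous_signedForm κ ε w v).tendsto u).comp (tendsto_mid_cell hu)

/-- A variable that occurs three times leaves a factor `(n φ)⁻¹ᐟ²` uncompensated by the number of
paths, and this factor tends to zero almost everywhere. -/
theorem Model.tendsto_sum_weight_zero_of_blockSize
    (hb : ∀ i, firstOcc w i = i → 2 ≤ blockSize w i)
    {i₀ : Fin h} (hi₀ : firstOcc w i₀ = i₀) (hb₀ : 3 ≤ blockSize w i₀) :
    Tendsto (fun n : ℕ => (1 / (n + 1 : ℕ) : ℝ) * ∑ π ∈ 𝓜.circuits (n + 1) (firstOcc w) ε,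
      𝓜.weight (n + 1) (fun v => mid (n + 1) (π v))) atTop (𝓝 0) := by
  rw [← integral_zero (indepVertices w → ℝ) ℝ (μ := uniformLaw w)]
  refine 𝓜.tendsto_sum_weight hb (Eventually.of_forall fun u hu => ?_)
  refine squeeze_zero (fun n => 𝓜.latticeIntegrand_nonneg _)
    (fun n => 𝓜.latticeIntegrand_le' hb hi₀ hb₀ hu) ?_
  have hpos := pos_of_firstOcc (κ := 𝓜.κ) (ε := ε) hu hi₀
  have hc := div_pos hpos (by linarith [one_le_formBound w ε 𝓜.κ] : 0 < formBound w ε 𝓜.κ)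
  have h1 : Tendsto (fun n : ℕ => ((n + 1 : ℕ) : ℝ) * ((‖((signedForm 𝓜.κ ε w u i₀.castSucc : ℝ) :
      UnitAddCircle)‖ + ‖((signedForm 𝓜.κ ε w u i₀.succ : ℝ) : UnitAddCircle)‖) /
        formBound w ε 𝓜.κ)) atTop atTop :=
    (tendsto_natCast_atTop_atTop.comp (tendsto_add_atTop_nat 1)).atTop_mul_const hc
  have h2 := (tendsto_inv_atTop_zero.comp (Real.tendsto_sqrt_atTop.comp h1)).const_mul
    (formBound w ε 𝓜.κ ^ numLetters w * singularWeight 𝓜.κ ε w u)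
  rw [mul_zero] at h2
  exact h2

/-- Outside a null set the two ends of the path have different limits, so that for large `n` the
cell of `u` contains no circuit. -/
theorem Model.tendsto_sum_weight_zero_of_closeCoeff
    (hb : ∀ i, firstOcc w i = i → 2 ≤ blockSize w i)
    {i₀ : Fin h} (hi₀ : firstOcc w i₀ = i₀) (hc : closeCoeff 𝓜.κ ε w i₀ ≠ 0) :
    Tendsto (fun n : ℕ => (1 / (n + 1 : ℕ) : ℝ) * ∑ π ∈ 𝓜.circuits (n + 1) (firstOcc w) ε,
      𝓜.weight (n + 1) (fun v => mid (n + 1) (π v))) atTop (𝓝 0) := by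
  rw [← integral_zero (indepVertices w → ℝ) ℝ (μ := uniformLaw w)]
  refine 𝓜.tendsto_sum_weight hb ?_
  filter_upwards [ae_signedForm_last_ne 𝓜.κ ε w hi₀ hc] with u hne hu
  refine Tendsto.congr' ?_ tendsto_const_nhds
  have h1 := (tendsto_signedForm_mid_cell (ε := ε) hu 𝓜.κ (Fin.last h)).sub
    (tendsto_signedForm_mid_cell (ε := ε) hu 𝓜.κ 0)
  filter_upwards [h1.eventually_ne (sub_ne_zero.2 hne)] with n hn
  rw [Model.latticeIntegrand, if_neg]
  rintro ⟨π, hπ, hs⟩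
  refine hn ?_
  simp_rw [← hs]
  rw [𝓜.signedForm_mid hπ, 𝓜.signedForm_mid hπ, (Finset.mem_filter.1 hπ).2.1, sub_self]

end Limits

/-! ### The words that survive in the limit -/

theorem firstOcc_congr {h k k' : ℕ} {w : Fin h → Fin k} {w' : Fin h → Fin k'}
    (hw : ∀ p q, w p = w q ↔ w' p = w' q) : firstOcc w = firstOcc w' := by
  funext p
  simp only [firstOcc]
  congr 1
  ext q
  simp [hw]

section Survive

variable (𝓜 : Model) {h k : ℕ} {w : Fin h → Fin k}

theorem signedForm_apply_mem {κ : ℤˣ} {ε : Fin h → ℤˣ} {M : Type*} [AddCommGroup M]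
    (u : indepVertices w → M) (s : indepVertices w) : signedForm κ ε w u s = u s := by
  obtain ⟨v, hv⟩ := s
  rcases Finset.mem_insert.1 hv with rfl | hv'
  · exact signedForm_zero κ ε w u
  · obtain ⟨p, hp, rfl⟩ := Finset.mem_image.1 hv'
    have hp' : firstOcc w p = p := (Finset.mem_filter.1 hp).2
    exact (signedForm_succ κ ε w u p).trans (dif_pos hp')

/-- If the vertex forms of the midpoints stay in `(0, 1)`, they are the midpoints of a circuit. -/
theorem Model.exists_circuit {n : ℕ} (hn : n ≠ 0) {a : indepVertices w → Fin n} (heven : Even h)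
    (hclose : ∀ i, firstOcc w i = i → closeCoeff 𝓜.κ (fun _ => 𝓜.ε₀) w i = 0)
    (hL : ∀ v, signedForm 𝓜.κ (fun _ => 𝓜.ε₀) w (fun s => mid n (a s)) v ∈ Set.Ioo (0 : ℝ) 1)
    (hne : ∀ i j, firstOcc w i = i → firstOcc w j = j → i ≠ j → ∀ σ : ℤˣ,
      edgeValue 𝓜.κ (signedForm 𝓜.κ (fun _ => 𝓜.ε₀) w (fun s => mid n (a s))) i ≠
        (σ : ℤ) • edgeValue 𝓜.κ (signedForm 𝓜.κ (fun _ => 𝓜.ε₀) w (fun s => mid n (a s))) j) :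
    ∃ π ∈ 𝓜.circuits n (firstOcc w) (fun _ => 𝓜.ε₀), ∀ s : indepVertices w, π s = a s := by
  have hn' : (0 : ℝ) < n := by positivity
  set L := signedForm 𝓜.κ (fun _ => 𝓜.ε₀) w (fun s => mid n (a s)) with hLdef
  set j : Fin (h + 1) → ℤ := signedForm 𝓜.κ (fun _ => 𝓜.ε₀) w (fun s => ((a s : ℕ) : ℤ)) with hj
  have hLj : ∀ v, L v = ((j v : ℝ) + 1 / 2) / n := fun v => by
    have e := signedForm_map 𝓜.κ (fun _ => 𝓜.ε₀) w
      ((AddMonoidHom.mulRight (1 / n : ℝ)).comp (Int.castAddHom ℝ)) (fun s => ((a s : ℕ) : ℤ)) v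
    have e2 : L v = signedForm 𝓜.κ (fun _ => 𝓜.ε₀) w (fun s =>
        ((AddMonoidHom.mulRight (1 / n : ℝ)).comp (Int.castAddHom ℝ)) ((a s : ℕ) : ℤ) +
          1 / 2 / (n : ℝ)) v := by
      rw [hLdef]
      congr 1
      funext s
      simp [mid]; ring
    rw [e2, signedForm_add _ _ _ _ (fun _ => 1 / 2 / (n : ℝ)), e,
      signedForm_const w 𝓜.normalized]
    simp [hj]; ring
  have hj0 : ∀ v, 0 ≤ j v ∧ j v < n := fun v => by
    obtain ⟨h0, h1⟩ := hL v
    rw [hLj] at h0 h1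
    rw [div_pos_iff_of_pos_right hn'] at h0
    rw [div_lt_one hn'] at h1
    constructor
    · have : (-1 : ℝ) < j v := by linarith
      have : (-1 : ℤ) < j v := by exact_mod_cast this
      omega
    · have : (j v : ℝ) < n := by linarith
      exact_mod_cast this
  set π : Fin (h + 1) → Fin n := fun v => ⟨(j v).toNat, by have := hj0 v; omega⟩ with hπ
  have hπj : ∀ v, ((π v : ℕ) : ℤ) = j v := fun v => Int.toNat_of_nonneg (hj0 v).1
  have hπs : ∀ s : indepVertices w, π s = a s := fun s => by
    refine Fin.ext ?_
    have := hπj s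
    rw [hj, signedForm_apply_mem] at this
    exact_mod_cast this
  have hmid : (fun v => mid n (π v)) = L := by
    funext v
    have e : ((π v : ℕ) : ℝ) = (j v : ℝ) := by exact_mod_cast hπj v
    rw [hLj, mid, e]
  have hedge : ∀ p, 𝓜.intEdge π p = edgeValue 𝓜.κ j p := fun p => by
    simp only [Model.intEdge, edgeValue, hπj, smul_eq_mul]
  have hrel : ∀ p, firstOcc w p ≠ p → 𝓜.intEdge π p = 𝓜.ε₀ * 𝓜.intEdge π (firstOcc w p) :=
    fun p hp => by
      rw [hedge, hedge, hj, edgeValue_signedForm _ _ _ _ hp, smul_eq_mul]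
  have hlink : ∀ p, 𝓜.linkWord n π p = 𝓜.linkWord n π (firstOcc w p) := fun p => by
    by_cases hp : firstOcc w p = p
    · rw [hp]
    · exact Fin.ext (𝓜.link_eq (hrel p hp))
  have hfirst : firstOcc (𝓜.linkWord n π) = firstOcc w := by
    refine firstOcc_congr fun p q => ⟨fun heq => ?_, fun heq => ?_⟩
    · rw [hlink p, hlink q] at heq
      by_contra hpq
      have hfne : firstOcc w p ≠ firstOcc w q := fun h' => hpq ((firstOcc_eq_iff w).1 h')
      have hcontra : ∀ σ : ℤˣ, (1 + (𝓜.κ : ℤ)) * σ = 1 + 𝓜.κ →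
          𝓜.intEdge π (firstOcc w p) ≠ σ * 𝓜.intEdge π (firstOcc w q) := fun σ hσ h' => by
        have := edgeValue_mid_eq 𝓜 π h' hσ
        rw [hmid] at this
        exact hne _ _ (firstOcc_idem w p) (firstOcc_idem w q) hfne σ this
      rcases 𝓜.of_link_eq (congrArg Fin.val heq) with h' | ⟨hκ, h'⟩
      · exact hcontra _ (by linarith [𝓜.normalized]) h'
      · exact hcontra (-𝓜.ε₀) (by simp [hκ]) h'
    · rw [hlink p, hlink q, (firstOcc_eq_iff w).2 heq]
  refine ⟨π, Finset.mem_filter.2 ⟨Finset.mem_univ _, ?_, hfirst, ?_⟩, hπs⟩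
  · refine Fin.ext ?_
    have : j (Fin.last h) = j 0 := signedForm_last_eq _ _ _ _ heven hclose
    rw [← hπj, ← hπj] at this
    exact_mod_cast this
  · funext p
    rw [Model.pathSign, if_pos]
    rw [hfirst]
    by_cases hp : firstOcc w p = p
    · exact Or.inr hp
    · exact Or.inl (hrel p hp)

/-- The circuits of a word whose forms close up give the integral of the word. -/
theorem Model.tendsto_sum_weight_wordIntegrand (heven : Even h)
    (hb : ∀ i, firstOcc w i = i → blockSize w i = 2)
    (hclose : ∀ i, firstOcc w i = i → closeCoeff 𝓜.κ (fun _ => 𝓜.ε₀) w i = 0) :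
    Tendsto (fun n : ℕ => (1 / (n + 1 : ℕ) : ℝ) *
      ∑ π ∈ 𝓜.circuits (n + 1) (firstOcc w) (fun _ => 𝓜.ε₀),
        𝓜.weight (n + 1) (fun v => mid (n + 1) (π v))) atTop
      (𝓝 (∫ u, wordIntegrand 𝓜.step 𝓜.φ w u ∂uniformLaw w)) := by
  refine 𝓜.tendsto_sum_weight (fun i hi => (hb i hi).ge) ?_
  have hae1 : ∀ᵐ u ∂uniformLaw w, ∀ v, signedForm 𝓜.κ (fun _ => 𝓜.ε₀) w u v ≠ 0 ∧
      signedForm 𝓜.κ (fun _ => 𝓜.ε₀) w u v ≠ 1 :=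
    ae_all_iff.2 fun v => (ae_signedForm_ne 𝓜.κ _ w v 0).and (ae_signedForm_ne 𝓜.κ _ w v 1)
  have hae2 : ∀ᵐ u ∂uniformLaw w, ∀ i j, firstOcc w i = i → firstOcc w j = j → i ≠ j →
      ∀ σ : ℤˣ, edgeValue 𝓜.κ (signedForm 𝓜.κ (fun _ => 𝓜.ε₀) w u) i ≠
        (σ : ℤ) • edgeValue 𝓜.κ (signedForm 𝓜.κ (fun _ => 𝓜.ε₀) w u) j := by
    simp only [ae_all_iff]
    exact fun i j hi hj hij σ => ae_edgeValue_add_ne 𝓜.κ _ w hi hj hij σ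
  filter_upwards [hae1, hae2] with u h1 h2 hu
  set L := signedForm 𝓜.κ (fun _ => 𝓜.ε₀) w u with hL
  have htL := fun v => tendsto_signedForm_mid_cell (ε := fun _ => 𝓜.ε₀) hu 𝓜.κ v
  have hlast : L (Fin.last h) = L 0 := signedForm_last_eq _ _ _ _ heven hclose
  have hS : ∀ v, v ∈ indepVertices w → L v ∈ Set.Ioo (0 : ℝ) 1 := fun v hv => by
    rw [hL, signedForm_apply_mem u ⟨v, hv⟩]; exact hu _
  by_cases hin : ∀ v, v ∉ indepVertices w → v ≠ Fin.last h → L v ∈ Set.Ioo (0 : ℝ) 1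
  · have hall : ∀ v, L v ∈ Set.Ioo (0 : ℝ) 1 := fun v => by
      by_cases hv : v ∈ indepVertices w
      · exact hS v hv
      · by_cases hv' : v = Fin.last h
        · rw [hv', hlast]; exact hS 0 (zero_mem_indepVertices w)
        · exact hin v hv hv'
    have hW : wordIntegrand 𝓜.step 𝓜.φ w u =
        ∏ p with firstOcc w p = p, (𝓜.φ (L p.castSucc) (L p.succ))⁻¹ := by
      simp only [wordIntegrand, 𝓜.vertexForm_eq, ← hL]
      rw [if_pos hin, one_div, Finset.prod_inv_distrib]
    have hev1 : ∀ᶠ n : ℕ in atTop, ∀ v, signedForm 𝓜.κ (fun _ => 𝓜.ε₀) w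
        (fun s => mid (n + 1) (cell (n + 1) (u s))) v ∈ Set.Ioo (0 : ℝ) 1 :=
      eventually_all.2 fun v => (htL v).eventually (isOpen_Ioo.mem_nhds (hall v))
    have hev2 : ∀ᶠ n : ℕ in atTop, ∀ i j, firstOcc w i = i → firstOcc w j = j → i ≠ j →
        ∀ σ : ℤˣ, edgeValue 𝓜.κ (signedForm 𝓜.κ (fun _ => 𝓜.ε₀) w
            (fun s => mid (n + 1) (cell (n + 1) (u s)))) i ≠
          (σ : ℤ) • edgeValue 𝓜.κ (signedForm 𝓜.κ (fun _ => 𝓜.ε₀) w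
            (fun s => mid (n + 1) (cell (n + 1) (u s)))) j := by
      simp only [eventually_all]
      intro i j hi hj hij σ
      have hte : ∀ p, Tendsto (fun n : ℕ => edgeValue 𝓜.κ (signedForm 𝓜.κ (fun _ => 𝓜.ε₀) w
          (fun s => mid (n + 1) (cell (n + 1) (u s)))) p) atTop (𝓝 (edgeValue 𝓜.κ L p)) :=
        fun p => (htL p.succ).add ((htL p.castSucc).const_smul _)
      have := ((hte i).sub ((hte j).const_smul (σ : ℤ))).eventually_ne
        (sub_ne_zero.2 (h2 i j hi hj hij σ))
      filter_upwards [this] with n hn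
      exact sub_ne_zero.1 hn
    rw [hW]
    have hlim : Tendsto (fun n : ℕ => ∏ p with firstOcc w p = p,
        (𝓜.φ (signedForm 𝓜.κ (fun _ => 𝓜.ε₀) w
            (fun s => mid (n + 1) (cell (n + 1) (u s))) p.castSucc)
          (signedForm 𝓜.κ (fun _ => 𝓜.ε₀) w
            (fun s => mid (n + 1) (cell (n + 1) (u s))) p.succ))⁻¹) atTop
        (𝓝 (∏ p with firstOcc w p = p, (𝓜.φ (L p.castSucc) (L p.succ))⁻¹)) := by
      refine tendsto_finsetProd _ fun p hp => ?_
      refine Tendsto.inv₀ ?_ ?_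
      · exact (𝓜.continuous_φ.tendsto (L p.castSucc, L p.succ)).comp
          ((htL p.castSucc).prodMk_nhds (htL p.succ))
      · refine ((pos_of_firstOcc (κ := 𝓜.κ) (ε := fun _ => 𝓜.ε₀) hu
          (Finset.mem_filter.1 hp).2).trans_le ?_).ne'
        exact 𝓜.le_φ (hall _) (hall _)
    refine hlim.congr' ?_
    filter_upwards [hev1, hev2] with n hn1 hn2
    obtain ⟨π, hπ, hs⟩ := 𝓜.exists_circuit (Nat.succ_ne_zero n) heven hclose hn1 hn2
    rw [𝓜.latticeIntegrand_eq hπ hs]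
    refine Finset.prod_congr rfl fun i hi => ?_
    have hm : ∀ v, signedForm 𝓜.κ (fun _ => 𝓜.ε₀) w
        (fun s => mid (n + 1) (cell (n + 1) (u s))) v = mid (n + 1) (π v) := fun v => by
      simp_rw [← hs]
      exact 𝓜.signedForm_mid hπ v
    have hpos := 𝓜.φ_mid_pos (π i.castSucc) (π i.succ)
    rw [hm, hm, hb i (Finset.mem_filter.1 hi).2, mul_inv_sqrt_pow_two (by positivity)
      (pos_of_mul_pos_right (by linarith) (Nat.cast_nonneg (n + 1)))]
  · have hW : wordIntegrand 𝓜.step 𝓜.φ w u = 0 := by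
      simp only [wordIntegrand, 𝓜.vertexForm_eq, ← hL]
      rw [if_neg hin, zero_div]
    rw [hW]
    push Not at hin
    obtain ⟨v, -, -, hv⟩ := hin
    have hv' : L v ∈ (Set.Icc (0 : ℝ) 1)ᶜ := fun hc =>
      hv ⟨lt_of_le_of_ne hc.1 (h1 v).1.symm, lt_of_le_of_ne hc.2 (h1 v).2⟩
    refine Tendsto.congr' ?_ tendsto_const_nhds
    filter_upwards [(htL v).eventually (isClosed_Icc.isOpen_compl.mem_nhds hv')] with n hn
    rw [Model.latticeIntegrand, if_neg]
    rintro ⟨π, hπ, hs⟩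
    refine hn ?_
    simp_rw [← hs]
    rw [𝓜.signedForm_mid hπ]
    exact Set.Ioo_subset_Icc_self (mid_mem_Ioo (π v).2)

theorem Model.wordIntegrand_nonneg_le {u : indepVertices w → ℝ}
    (hu : ∀ s, u s ∈ Set.Ioo (0 : ℝ) 1) :
    0 ≤ wordIntegrand 𝓜.step 𝓜.φ w u ∧
      wordIntegrand 𝓜.step 𝓜.φ w u ≤ singularWeight 𝓜.κ (fun _ => 𝓜.ε₀) w u := by
  simp only [wordIntegrand, 𝓜.vertexForm_eq]
  set L := signedForm 𝓜.κ (fun _ => 𝓜.ε₀) w u with hL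
  split_ifs with hin
  · have hcast : ∀ p : Fin h, L p.castSucc ∈ Set.Ioo (0 : ℝ) 1 := fun p => by
      by_cases hv : p.castSucc ∈ indepVertices w
      · rw [hL, signedForm_apply_mem u ⟨_, hv⟩]; exact hu _
      · exact hin _ hv (Fin.castSucc_lt_last p).ne
    have hφ : ∀ p ∈ Finset.univ.filter (fun p => firstOcc w p = p),
        0 < ‖((L p.castSucc : ℝ) : UnitAddCircle)‖ + ‖((L p.succ : ℝ) : UnitAddCircle)‖ ∧
        ‖((L p.castSucc : ℝ) : UnitAddCircle)‖ + ‖((L p.succ : ℝ) : UnitAddCircle)‖ ≤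
          𝓜.φ (L p.castSucc) (L p.succ) := fun p hp => by
      have hp' := (Finset.mem_filter.1 hp).2
      refine ⟨pos_of_firstOcc hu hp', 𝓜.le_φ (hcast p) ?_⟩
      rw [hL, signedForm_succ, dif_pos hp']; exact hu _
    rw [one_div, ← Finset.prod_inv_distrib]
    exact ⟨Finset.prod_nonneg fun p hp => inv_nonneg.2 ((hφ p hp).1.le.trans (hφ p hp).2),
      Finset.prod_le_prod
        (fun p hp => inv_nonneg.2 ((hφ p hp).1.le.trans (hφ p hp).2))
        fun p hp => inv_anti₀ (hφ p hp).1 (hφ p hp).2⟩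
  · rw [zero_div]
    exact ⟨le_rfl, singularWeight_nonneg _ _ _ _⟩

theorem Model.measurable_wordIntegrand : Measurable (wordIntegrand 𝓜.step 𝓜.φ w) := by
  have hL := fun v => measurable_signedForm 𝓜.κ (fun _ => 𝓜.ε₀) w v
  unfold wordIntegrand
  simp only [𝓜.vertexForm_eq]
  refine Measurable.div (Measurable.ite ?_ measurable_const measurable_const) ?_
  · rw [show {u : indepVertices w → ℝ | ∀ v : Fin (h + 1), v ∉ indepVertices w →
        v ≠ Fin.last h → signedForm 𝓜.κ (fun _ => 𝓜.ε₀) w u v ∈ Set.Ioo (0 : ℝ) 1} =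
      ⋂ v : Fin (h + 1), ⋂ (_ : v ∉ indepVertices w), ⋂ (_ : v ≠ Fin.last h),
        (fun u => signedForm 𝓜.κ (fun _ => 𝓜.ε₀) w u v) ⁻¹' Set.Ioo (0 : ℝ) 1 by ext; simp]
    exact MeasurableSet.iInter fun v => MeasurableSet.iInter fun _ => MeasurableSet.iInter fun _ =>
      hL v measurableSet_Ioo
  · exact Finset.measurable_prod _ fun p _ =>
      𝓜.continuous_φ.measurable.comp ((hL p.castSucc).prodMk (hL p.succ))

theorem Model.integrable_wordIntegrand :
    Integrable (wordIntegrand 𝓜.step 𝓜.φ w) (uniformLaw w) := by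
  refine (integrable_singularWeight 𝓜.κ (fun _ => 𝓜.ε₀) w).mono'
    𝓜.measurable_wordIntegrand.aestronglyMeasurable ?_
  filter_upwards [ae_mem_Ioo w] with u hu
  rw [Real.norm_of_nonneg (𝓜.wordIntegrand_nonneg_le hu).1]
  exact (𝓜.wordIntegrand_nonneg_le hu).2

theorem Model.integral_wordIntegrand_le :
    ∫ u, wordIntegrand 𝓜.step 𝓜.φ w u ∂uniformLaw w ≤
      4 ^ (h + 1) * (2 * (numLetters w + 1)) ^ numLetters w := by
  refine le_trans (integral_mono_ae 𝓜.integrable_wordIntegrand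
    (integrable_singularWeight 𝓜.κ (fun _ => 𝓜.ε₀) w) ?_) (integral_singularWeight_le _ _ w)
  filter_upwards [ae_mem_Ioo w] with u hu
  exact (𝓜.wordIntegrand_nonneg_le hu).2

end Survive

/-! ### Pair-matched words -/

section Words

variable {h k : ℕ}

theorem firstOcc_le_of_eq (w : Fin h → Fin k) {p q : Fin h} (hpq : w q = w p) :
    firstOcc w p ≤ q :=
  Finset.min'_le _ _ (by simpa using hpq)

/-- A word is determined by the positions at which new letters appear and by its values at the
other positions. -/
theorem IsWord.eq_of {w w' : Fin h → Fin k} (hw : IsWord w) (hw' : IsWord w')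
    (hF : ∀ p, firstOcc w p = p ↔ firstOcc w' p = p)
    (hN : ∀ p, firstOcc w p ≠ p → (∀ q < p, w q = w' q) → w p = w' p) : w = w' := by
  funext p
  induction p using WellFoundedLT.induction with
  | _ p ih =>
    by_cases hp : firstOcc w p = p
    · have hp' := (hF p).1 hp
      rcases lt_trichotomy (w p) (w' p) with hlt | heq | hlt
      · obtain ⟨q, hq, hqa⟩ := hw' p _ hlt
        rw [← ih q hq] at hqa
        exact absurd (hp ▸ firstOcc_le_of_eq w hqa) (not_le.2 hq)
      · exact heq
      · obtain ⟨q, hq, hqa⟩ := hw p _ hlt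
        rw [ih q hq] at hqa
        exact absurd (hp' ▸ firstOcc_le_of_eq w' hqa) (not_le.2 hq)
    · exact hN p hp ih

theorem IsWord.eq_of_firstOcc_eq {w w' : Fin h → Fin k} (hw : IsWord w) (hw' : IsWord w')
    (hf : firstOcc w = firstOcc w') : w = w' := by
  refine hw.eq_of hw' (fun p => by rw [hf]) fun p hp ih => ?_
  have hlt : firstOcc w p < p := lt_of_le_of_ne (firstOcc_le w p) hp
  rw [← apply_firstOcc w p, ih _ hlt, hf, apply_firstOcc w' p]

theorem card_eq_sum_blockSize (w : Fin h → Fin k) :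
    h = ∑ i with firstOcc w i = i, blockSize w i := by
  have := Finset.card_eq_sum_card_fiberwise (s := (Finset.univ : Finset (Fin h)))
    (f := firstOcc w) (t := Finset.univ.filter fun i => firstOcc w i = i)
    (fun p _ => by simpa using firstOcc_idem w p)
  simpa [blockSize] using this

theorem eq_two_mul_numLetters {w : Fin h → Fin k}
    (hb : ∀ i, firstOcc w i = i → blockSize w i = 2) : h = 2 * numLetters w := by
  have := card_eq_sum_blockSize w
  rw [Finset.sum_congr rfl fun i hi => hb i (Finset.mem_filter.1 hi).2, Finset.sum_const,
    smul_eq_mul, mul_comm] at this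
  exact this

theorem blockSize_eq_of_firstOcc_eq {k' : ℕ} {w : Fin h → Fin k} {w' : Fin h → Fin k'}
    (hf : firstOcc w = firstOcc w') (i : Fin h) : blockSize w i = blockSize w' i := by
  simp only [blockSize, hf]

theorem blockSize_of_isPairMatched {w : Fin h → Fin k} (hw : IsPairMatched w) {i : Fin h}
    (hi : firstOcc w i = i) : blockSize w i = 2 := by
  rw [blockSize, ← hw (w i)]
  congr 1
  ext p
  simp only [Finset.mem_filter, Finset.mem_univ, true_and]
  rw [← firstOcc_eq_iff, hi]

theorem mem_pairWords {w : Fin (2 * k) → Fin k} :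
    w ∈ pairWords k ↔ IsWord w ∧ IsPairMatched w := by
  simp [pairWords]

/-- Every matching into pairs is the matching of a pair-matched word. -/
theorem exists_pairWord {m : ℕ} {v : Fin (2 * k) → Fin m}
    (hb : ∀ i, firstOcc v i = i → blockSize v i = 2) :
    ∃ w ∈ pairWords k, firstOcc w = firstOcc v := by
  classical
  have hcard : (Finset.univ.filter fun i => firstOcc v i = i).card = k := by
    have := eq_two_mul_numLetters hb
    rw [numLetters] at this
    omega
  set F := Finset.univ.filter fun i => firstOcc v i = i
  have hmem : ∀ p, firstOcc v p ∈ F := fun p => by simpa [F] using firstOcc_idem v p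
  set e := F.orderIsoOfFin hcard
  set w : Fin (2 * k) → Fin k := fun p => e.symm ⟨firstOcc v p, hmem p⟩ with hw
  have hwv : ∀ p q, w p = w q ↔ v p = v q := fun p q => by
    rw [hw, ← firstOcc_eq_iff]
    simp
  have hwe : ∀ p a, w p = a ↔ firstOcc v p = e a := fun p a => by
    rw [hw, OrderIso.symm_apply_eq, Subtype.ext_iff]
  refine ⟨w, ?_, firstOcc_congr hwv⟩
  rw [mem_pairWords]
  constructor
  · intro p a ha
    have hfix : firstOcc v (e a) = e a := (Finset.mem_filter.1 (e a).2).2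
    refine ⟨e a, ?_, (hwe _ _).2 hfix⟩
    have h1 : e a < ⟨firstOcc v p, hmem p⟩ := (e.lt_symm_apply).1 ha
    exact lt_of_lt_of_le h1 (firstOcc_le v p)
  · intro a
    have hfix : firstOcc v (e a) = e a := (Finset.mem_filter.1 (e a).2).2
    refine Eq.trans ?_ (hb _ hfix)
    rw [blockSize]
    congr 1
    ext p
    simp [hwe]

theorem numLetters_of_mem_pairWords {w : Fin (2 * k) → Fin k} (hw : w ∈ pairWords k) :
    numLetters w = k := by
  have := eq_two_mul_numLetters fun i hi =>
    blockSize_of_isPairMatched (mem_pairWords.1 hw).2 hi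
  omega

theorem card_pairWords_le (k : ℕ) : (pairWords k).card ≤ 4 ^ k * k ^ k := by
  classical
  set F : (Fin (2 * k) → Fin k) → Finset (Fin (2 * k)) := fun w =>
    Finset.univ.filter fun p => firstOcc w p = p with hF
  set T : Finset (Fin (2 * k)) → Finset (Fin (2 * k) → Option (Fin k)) := fun G =>
    Fintype.piFinset fun p => if p ∈ G then {none} else Finset.univ.image some with hT
  have hTcard : ∀ G : Finset (Fin (2 * k)), G.card = k → (T G).card = k ^ k := fun G hG => by
    rw [hT, Fintype.card_piFinset]
    simp only [apply_ite Finset.card, Finset.card_singleton,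
      Finset.card_image_of_injective _ (Option.some_injective _), Finset.card_univ,
      Fintype.card_fin]
    rw [Finset.prod_ite, Finset.prod_const_one, one_mul, Finset.prod_const]
    congr 1
    rw [Finset.filter_not, Finset.card_sdiff_of_subset (Finset.filter_subset _ _)]
    simp [hG]; omega
  calc (pairWords k).card
      ≤ ((Finset.powersetCard k (Finset.univ : Finset (Fin (2 * k)))).sigma T).card := by
        refine Finset.card_le_card_of_injOn
          (fun w => ⟨F w, fun p => if p ∈ F w then none else some (w p)⟩) ?_ ?_
        · intro w hw
          simp only [Finset.coe_sigma, Set.mem_sigma_iff, Finset.mem_coe, Finset.mem_powersetCard,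
            Finset.subset_univ, true_and]
          refine ⟨numLetters_of_mem_pairWords hw, ?_⟩
          rw [hT, Fintype.mem_piFinset]
          intro p
          split_ifs <;> simp
        · intro w hw w' hw' he
          simp only [Sigma.mk.injEq] at he
          obtain ⟨h1, h2⟩ := he
          have h2 := eq_of_heq h2
          have hmem : ∀ p, p ∈ F w ↔ firstOcc w p = p := fun p => by simp [hF]
          have hmem' : ∀ p, p ∈ F w' ↔ firstOcc w' p = p := fun p => by simp [hF]
          refine (mem_pairWords.1 hw).1.eq_of (mem_pairWords.1 hw').1
            (fun p => by rw [← hmem, ← hmem', h1]) fun p hp _ => ?_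
          have := congrFun h2 p
          rw [if_neg (by rwa [hmem]), if_neg (by rw [← h1]; rwa [hmem])] at this
          exact Option.some_injective _ this
    _ = (Finset.powersetCard k (Finset.univ : Finset (Fin (2 * k)))).card * k ^ k := by
        rw [Finset.card_sigma, Finset.sum_congr rfl fun G hG =>
          hTcard G (Finset.mem_powersetCard.1 hG).2, Finset.sum_const, smul_eq_mul]
    _ ≤ 4 ^ k * k ^ k := by
        gcongr
        rw [Finset.card_powersetCard, Finset.card_univ, Fintype.card_fin]
        refine (Nat.choose_le_two_pow (2 * k) k).trans ?_
        rw [pow_mul]; norm_num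

/-- A block of size two consists of a first and a second position. -/
theorem exists_second {w : Fin h → Fin k} {i : Fin h} (hi : firstOcc w i = i)
    (hb : blockSize w i = 2) : ∃ j, j ≠ i ∧ firstOcc w j ≠ j ∧
      (Finset.univ.filter fun p => firstOcc w p = i) = {i, j} := by
  obtain ⟨a, b, hab, he⟩ := Finset.card_eq_two.1 hb
  have hmem : i ∈ Finset.univ.filter fun p => firstOcc w p = i := by simpa using hi
  have key : ∀ j, j ≠ i → j ∈ (Finset.univ.filter fun p => firstOcc w p = i) →
      firstOcc w j ≠ j := fun j hj hj' => by
    rw [(Finset.mem_filter.1 hj').2]; exact hj.symm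
  rw [he, Finset.mem_insert, Finset.mem_singleton] at hmem
  rcases hmem with rfl | rfl
  · exact ⟨b, hab.symm, key b hab.symm (by rw [he]; simp), he⟩
  · exact ⟨a, hab, key a hab (by rw [he]; simp), by rw [he, Finset.pair_comm]⟩

theorem closeCoeff_eq (κ : ℤˣ) (ε : Fin h → ℤˣ) {w : Fin h → Fin k} {i j : Fin h}
    (hi : firstOcc w i = i) (hji : j ≠ i) (hj : firstOcc w j ≠ j)
    (he : (Finset.univ.filter fun p => firstOcc w p = i) = {i, j}) :
    closeCoeff κ ε w i = (-(κ : ℤ)) ^ (h - 1 - (i : ℕ)) + (-(κ : ℤ)) ^ (h - 1 - (j : ℕ)) * ε j := by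
  rw [closeCoeff, he, Finset.sum_pair hji.symm, if_pos hi, if_neg hj, mul_one]

/-- Toeplitz: the forms of a word close up exactly if all pairs have opposite signs. -/
theorem closeCoeff_neg_one {ε : Fin h → ℤˣ} {w : Fin h → Fin k}
    (hb : ∀ i, firstOcc w i = i → blockSize w i = 2) :
    (∀ i, firstOcc w i = i → closeCoeff (-1) ε w i = 0) ↔
      ∀ j, firstOcc w j ≠ j → ε j = -1 := by
  constructor
  · intro hc j hj
    have hi := firstOcc_idem w j
    obtain ⟨j', h1, h2, h3⟩ := exists_second hi (hb _ hi)
    have hjj : j = j' := by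
      have : j ∈ Finset.univ.filter fun p => firstOcc w p = firstOcc w j := by simp
      rw [h3, Finset.mem_insert, Finset.mem_singleton] at this
      exact this.resolve_left fun h' => hj h'.symm
    have := hc _ hi
    rw [closeCoeff_eq _ _ hi h1 h2 h3, ← hjj] at this
    rcases Int.units_eq_one_or (ε j) with h' | h'
    · simp [h'] at this
    · exact h'
  · intro hε i hi
    obtain ⟨j, h1, h2, h3⟩ := exists_second hi (hb _ hi)
    rw [closeCoeff_eq _ _ hi h1 h2 h3, hε j h2]
    simp

theorem isSymmetric_of_parity {w : Fin h → Fin k} (hw : IsPairMatched w)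
    (hpar : ∀ i j, j ≠ i → firstOcc w i = i →
      (Finset.univ.filter fun p => firstOcc w p = i) = {i, j} → (i + j : ℕ) % 2 = 1) :
    IsSymmetric w := by
  intro a
  obtain ⟨p₀, hp₀⟩ : (Finset.univ.filter fun p => w p = a).Nonempty :=
    Finset.card_pos.1 (by rw [hw a]; norm_num)
  have hp₀ := (Finset.mem_filter.1 hp₀).2
  have hi := firstOcc_idem w p₀
  obtain ⟨j, h1, h2, h3⟩ := exists_second hi (blockSize_of_isPairMatched hw hi)
  have hp := hpar _ _ h1 hi h3
  set i := firstOcc w p₀ with hidef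
  have hiff : ∀ p, w p = a ↔ p = i ∨ p = j := fun p => by
    rw [← hp₀, ← firstOcc_eq_iff, ← hidef]
    have : p ∈ (Finset.univ.filter fun p => firstOcc w p = i) ↔ p ∈ ({i, j} : Finset (Fin h)) := by
      rw [h3]
    simpa using this
  simp only [hiff, Nat.odd_iff, Nat.even_iff]
  rcases Nat.mod_two_eq_zero_or_one (i : ℕ) with hi2 | hi2
  · refine ⟨⟨i, ⟨Or.inl rfl, by omega⟩, ?_⟩, ⟨j, ⟨Or.inr rfl, by omega⟩, ?_⟩⟩ <;>
      rintro p ⟨rfl | rfl, hp2⟩ <;> first | rfl | omega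
  · refine ⟨⟨j, ⟨Or.inr rfl, by omega⟩, ?_⟩, ⟨i, ⟨Or.inl rfl, by omega⟩, ?_⟩⟩ <;>
      rintro p ⟨rfl | rfl, hp2⟩ <;> first | rfl | omega

theorem neg_one_pow_add_eq_zero_iff {a b : ℕ} :
    (-1 : ℤ) ^ a + (-1) ^ b = 0 ↔ (a + b) % 2 = 1 := by
  rcases Nat.even_or_odd a with ha | ha <;> rcases Nat.even_or_odd b with hb | hb <;>
    simp [ha.neg_one_pow, hb.neg_one_pow] <;> grind

/-- Hankel: the forms of a word close up exactly if the word is symmetric. -/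
theorem closeCoeff_one {w : Fin h → Fin k} (hw : IsPairMatched w) :
    (∀ i, firstOcc w i = i → closeCoeff 1 (fun _ => 1) w i = 0) ↔ IsSymmetric w := by
  have key : ∀ i j : Fin h, firstOcc w i = i → j ≠ i → firstOcc w j ≠ j →
      (Finset.univ.filter fun p => firstOcc w p = i) = {i, j} →
      (closeCoeff 1 (fun _ => 1) w i = 0 ↔ (i + j : ℕ) % 2 = 1) := fun i j hi h1 h2 h3 => by
    rw [closeCoeff_eq _ _ hi h1 h2 h3]
    simp only [Units.val_one, mul_one]
    rw [neg_one_pow_add_eq_zero_iff]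
    have := i.2
    have := j.2
    omega
  constructor
  · intro hc
    refine isSymmetric_of_parity hw fun i j hji hi he => ?_
    have hj : firstOcc w j ≠ j := by
      have : j ∈ Finset.univ.filter fun p => firstOcc w p = i := by rw [he]; simp
      rw [(Finset.mem_filter.1 this).2]; exact hji.symm
    exact (key i j hi hji hj he).1 (hc i hi)
  · intro hs i hi
    obtain ⟨j, h1, h2, h3⟩ := exists_second hi (blockSize_of_isPairMatched hw hi)
    rw [key i j hi h1 h2 h3]
    have hwj : w j = w i := by
      have : j ∈ Finset.univ.filter fun p => firstOcc w p = i := by rw [h3]; simp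
      rw [← apply_firstOcc w j, (Finset.mem_filter.1 this).2]
    obtain ⟨ho, he⟩ := hs (w i)
    by_contra hpar
    rcases Nat.even_or_odd ((i : ℕ) + 1) with hp | hp
    · exact h1 (he.unique ⟨hwj, by grind⟩ ⟨rfl, hp⟩)
    · exact h1 (ho.unique ⟨hwj, by grind⟩ ⟨rfl, hp⟩)

end Words

/-! ### Moments of the empirical spectral distribution as sums over circuits -/

theorem exists_orthogonal_diagonalization {n : ℕ} {A : Matrix (Fin n) (Fin n) ℝ}
    (hA : A.IsHermitian) : ∃ V : Matrix (Fin n) (Fin n) ℝ, V.transpose * V = 1 ∧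
      V * V.transpose = 1 ∧ A = V * Matrix.diagonal hA.eigenvalues * V.transpose := by
  refine ⟨hA.eigenvectorUnitary, ?_, ?_, ?_⟩
  · have := Unitary.coe_star_mul_self hA.eigenvectorUnitary
    simpa [Matrix.star_eq_conjTranspose] using this
  · have := Unitary.coe_mul_star_self hA.eigenvectorUnitary
    simpa [Matrix.star_eq_conjTranspose] using this
  · conv_lhs => rw [hA.spectral_theorem, Unitary.conjStarAlgAut_apply]
    simp [Matrix.star_eq_conjTranspose]

theorem trace_pow_eq_sum_eigenvalues {n : ℕ} {A : Matrix (Fin n) (Fin n) ℝ}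
    (hA : A.IsHermitian) (h : ℕ) : (A ^ h).trace = ∑ i, hA.eigenvalues i ^ h := by
  obtain ⟨V, h1, h2, h3⟩ := exists_orthogonal_diagonalization hA
  have hpow : A ^ h = V * Matrix.diagonal (hA.eigenvalues ^ h) * V.transpose := by
    induction h with
    | zero => simp [h2]
    | succ h ih =>
      rw [pow_succ, ih]
      nth_rewrite 2 [h3]
      calc _ = V * Matrix.diagonal (hA.eigenvalues ^ h) * (V.transpose * V) *
            Matrix.diagonal hA.eigenvalues * V.transpose := by simp only [Matrix.mul_assoc]
        _ = _ := by
          rw [h1, Matrix.mul_one, Matrix.mul_assoc V, Matrix.diagonal_mul_diagonal]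
          congr 3
  rw [hpow, Matrix.trace_mul_cycle, h1, Matrix.one_mul, Matrix.trace_diagonal]
  simp

theorem integral_esd {n : ℕ} [NeZero n] {A : Matrix (Fin n) (Fin n) ℝ} (hA : A.IsHermitian)
    {E : Type*} [NormedAddCommGroup E] [NormedSpace ℝ E] [CompleteSpace E] (g : ℝ → E) :
    ∫ y, g y ∂(esd A hA : Measure ℝ) = (1 / n : ℝ) • ∑ i, g (hA.eigenvalues i) := by
  have : (esd A hA : Measure ℝ) = (n : ENNReal)⁻¹ • ∑ i, Measure.dirac (hA.eigenvalues i) := rfl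
  rw [this, integral_smul_measure, integral_finsetSum_measure fun i _ => integrable_dirac (by simp)]
  simp

theorem esdMoment_eq {n : ℕ} [NeZero n] {A : Matrix (Fin n) (Fin n) ℝ} (hA : A.IsHermitian)
    (h : ℕ) : esdMoment h A hA = (1 / n : ℝ) * (A ^ h).trace := by
  rw [esdMoment, integral_esd hA, trace_pow_eq_sum_eigenvalues hA, smul_eq_mul]

theorem pow_apply_eq_sum_paths {n : ℕ} (A : Matrix (Fin n) (Fin n) ℝ) (h : ℕ) (i j : Fin n) :
    (A ^ h) i j = ∑ π : Fin (h + 1) → Fin n, if π 0 = i ∧ π (Fin.last h) = j then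
      ∏ p : Fin h, A (π p.castSucc) (π p.succ) else 0 := by
  induction h generalizing j with
  | zero =>
    rw [← (Equiv.funUnique (Fin 1) (Fin n)).symm.sum_comp]
    simp only [pow_zero, Matrix.one_apply, Finset.univ_eq_empty, Finset.prod_empty]
    rw [Finset.sum_eq_single i]
    · simp
    · intro b _ hb
      simp [hb]
    · simp
  | succ h ih =>
    rw [pow_succ, Matrix.mul_apply, ← (Fin.snocEquiv fun _ => Fin n).sum_comp,
      Fintype.sum_prod_type, Finset.sum_comm]
    simp_rw [ih, Finset.sum_mul]
    rw [Finset.sum_comm]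
    refine Finset.sum_congr rfl fun π _ => ?_
    simp only [Fin.snocEquiv_apply]
    simp only [Fin.prod_univ_castSucc, Fin.succ_castSucc, Fin.succ_last, Fin.snoc_last,
      Fin.snoc_castSucc, ← Fin.castSucc_zero (n := h + 1)]
    rw [Finset.sum_eq_single (π (Fin.last h)), Finset.sum_eq_single j]
    · simp [ite_mul]
    · intro b _ hb
      simp [hb]
    · simp
    · intro b _ hb
      simp [hb.symm]
    · simp

theorem trace_pow_eq_sum_closed {n : ℕ} (A : Matrix (Fin n) (Fin n) ℝ) (h : ℕ) :
    (A ^ h).trace = ∑ π : Fin (h + 1) → Fin n with π (Fin.last h) = π 0,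
      ∏ p : Fin h, A (π p.castSucc) (π p.succ) := by
  simp only [Matrix.trace, Matrix.diag, pow_apply_eq_sum_paths]
  rw [Finset.sum_comm, Finset.sum_filter]
  refine Finset.sum_congr rfl fun π _ => ?_
  rw [Finset.sum_eq_single (π 0)]
  · simp
  · intro b _ hb
    simp [hb.symm]
  · simp

/-- The random matrix of a model. -/
def Model.matrix (𝓜 : Model) (n : ℕ) (x : ℕ → ℝ) : Matrix (Fin n) (Fin n) ℝ :=
  Matrix.of fun i j => x (𝓜.link i j) / √(n * 𝓜.φ (mid n i) (mid n j))

theorem Model.prod_matrix (𝓜 : Model) {n h : ℕ} (x : ℕ → ℝ) (π : Fin (h + 1) → Fin n) :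
    ∏ p : Fin h, 𝓜.matrix n x (π p.castSucc) (π p.succ) =
      (∏ p, x (𝓜.linkWord n π p)) * 𝓜.weight n (fun v => mid n (π v)) := by
  rw [Model.weight, ← Finset.prod_mul_distrib]
  rfl

section Expectation

variable {Ω : Type*} [MeasurableSpace Ω] {P : Measure Ω} {x : ℕ → Ω → ℝ} {h m : ℕ}

theorem ae_abs_le_of_bound {C : ℝ} (hC : ∀ i, ∀ᵐ ω ∂P, |x i ω| ≤ C) (v : Fin h → Fin m) :
    ∀ᵐ ω ∂P, |∏ p, x (v p) ω| ≤ C ^ h := by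
  filter_upwards [ae_all_iff.2 hC] with ω hω
  rw [Finset.abs_prod]
  calc ∏ p, |x (v p) ω| ≤ ∏ _p : Fin h, C :=
        Finset.prod_le_prod (fun _ _ => abs_nonneg _) fun p _ => hω _
    _ = C ^ h := by simp

theorem IsBoundedIIDInput.integrable_prod [IsProbabilityMeasure P] (hx : IsBoundedIIDInput P x) (v : Fin h → Fin m) :
    Integrable (fun ω => ∏ p, x (v p) ω) P := by
  obtain ⟨C, hC⟩ := hx.bounded
  exact Integrable.of_bound (Finset.measurable_prod _ fun p _ => hx.measurable _).aestronglyMeasurable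
    (C ^ h) (ae_abs_le_of_bound hC v)

theorem abs_integral_prod_le [IsProbabilityMeasure P] {C : ℝ} (hC : ∀ i, ∀ᵐ ω ∂P, |x i ω| ≤ C) (v : Fin h → Fin m) :
    |∫ ω, ∏ p, x (v p) ω ∂P| ≤ C ^ h := by
  have := norm_integral_le_of_norm_le_const (f := fun ω => ∏ p, x (v p) ω) (C := C ^ h)
    (by simpa only [Real.norm_eq_abs] using ae_abs_le_of_bound hC v)
  rwa [probReal_univ, mul_one] at this

theorem IsBoundedIIDInput.integral_prod (hx : IsBoundedIIDInput P x) (v : Fin h → Fin m) :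
    ∫ ω, ∏ p, x (v p) ω ∂P =
      ∏ l : Fin m, ∫ ω, x l ω ^ (Finset.univ.filter fun p => v p = l).card ∂P := by
  have hind : iIndepFun (fun l : Fin m => x l) P := hx.indep.precomp Fin.val_injective
  rw [← hind.integral_fun_prod_comp (f := fun l y => y ^ (Finset.univ.filter fun p => v p = l).card)
    (fun l => (hx.measurable l).aemeasurable) (fun l => by fun_prop)]
  refine integral_congr_ae (Eventually.of_forall fun ω => ?_)
  simp only
  rw [← Finset.prod_fiberwise (s := Finset.univ) (g := v)]
  refine Finset.prod_congr rfl fun l _ => ?_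
  rw [← Finset.prod_const]
  exact Finset.prod_congr rfl fun p hp => by rw [(Finset.mem_filter.1 hp).2]

theorem card_filter_eq_blockSize (v : Fin h → Fin m) (p : Fin h) :
    (Finset.univ.filter fun q => v q = v p).card = blockSize v (firstOcc v p) := by
  rw [blockSize]
  congr 1
  ext q
  simp [firstOcc_eq_iff]

theorem IsBoundedIIDInput.integral_prod_eq_zero (hx : IsBoundedIIDInput P x) {v : Fin h → Fin m}
    {i : Fin h} (hi : firstOcc v i = i) (hb : blockSize v i = 1) :
    ∫ ω, ∏ p, x (v p) ω ∂P = 0 := by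
  rw [hx.integral_prod]
  refine Finset.prod_eq_zero (Finset.mem_univ (v i)) ?_
  rw [card_filter_eq_blockSize, hi, hb]
  simpa using hx.mean_zero (v i)

theorem IsBoundedIIDInput.integral_sq (hx : IsBoundedIIDInput P x) (i : ℕ) :
    ∫ ω, x i ω ^ 2 ∂P = 1 := by
  rw [← hx.variance_one i, variance_of_integral_eq_zero (hx.measurable i).aemeasurable
    (hx.mean_zero i)]

theorem IsBoundedIIDInput.integral_prod_eq_one [IsProbabilityMeasure P]
    (hx : IsBoundedIIDInput P x) {v : Fin h → Fin m}
    (hb : ∀ i, firstOcc v i = i → blockSize v i = 2) :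
    ∫ ω, ∏ p, x (v p) ω ∂P = 1 := by
  rw [hx.integral_prod]
  refine Finset.prod_eq_one fun l _ => ?_
  rcases (Finset.univ.filter fun p => v p = l).eq_empty_or_nonempty with he | ⟨p, hp⟩
  · simp [he]
  · have hp' := (Finset.mem_filter.1 hp).2
    subst hp'
    rw [card_filter_eq_blockSize, hb _ (firstOcc_idem v p), hx.integral_sq]

end Expectation

section Moments

variable (𝓜 : Model) {Ω : Type*} [MeasurableSpace Ω] {P : Measure Ω} {x : ℕ → Ω → ℝ}

variable (P x) in
/-- The contribution to the expected moment of the circuits with given matching and signs. -/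
def Model.circuitSum {h : ℕ} (n : ℕ) (f : Fin h → Fin h) (ε : Fin h → ℤˣ) : ℝ :=
  (1 / n : ℝ) * ∑ π ∈ 𝓜.circuits n f ε,
    (∫ ω, ∏ p, x (𝓜.linkWord n π p) ω ∂P) * 𝓜.weight n (fun v => mid n (π v))

theorem Model.esdMoment_matrix {n : ℕ} [NeZero n] (y : ℕ → ℝ)
    (hA : (𝓜.matrix n y).IsHermitian) (h : ℕ) :
    esdMoment h (𝓜.matrix n y) hA = (1 / n : ℝ) *
      ∑ π : Fin (h + 1) → Fin n with π (Fin.last h) = π 0,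
        (∏ p, y (𝓜.linkWord n π p)) * 𝓜.weight n (fun v => mid n (π v)) := by
  rw [esdMoment_eq, trace_pow_eq_sum_closed]
  simp_rw [𝓜.prod_matrix]

theorem Model.integrable_esdMoment [IsProbabilityMeasure P]
    (hx : IsBoundedIIDInput P x) (n : ℕ) [NeZero n]
    (hA : ∀ y, (𝓜.matrix n y).IsHermitian) (h : ℕ) :
    Integrable (fun ω => esdMoment h (𝓜.matrix n fun i => x i ω) (hA _)) P := by
  simp_rw [𝓜.esdMoment_matrix]
  exact (integrable_finsetSum _ fun π _ => (hx.integrable_prod _).mul_const _).const_mul _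

theorem Model.integral_esdMoment [IsProbabilityMeasure P]
    (hx : IsBoundedIIDInput P x) (n : ℕ) [NeZero n]
    (hA : ∀ y, (𝓜.matrix n y).IsHermitian) (h : ℕ) :
    ∫ ω, esdMoment h (𝓜.matrix n fun i => x i ω) (hA _) ∂P =
      ∑ z : (Fin h → Fin h) × (Fin h → ℤˣ), 𝓜.circuitSum P x n z.1 z.2 := by
  classical
  simp_rw [𝓜.esdMoment_matrix]
  rw [integral_const_mul, integral_finsetSum _ fun π _ => (hx.integrable_prod _).mul_const _]
  simp_rw [integral_mul_const, Model.circuitSum]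
  rw [← Finset.mul_sum]
  congr 1
  rw [← Finset.sum_fiberwise (s := Finset.univ.filter _)
    (g := fun π => (firstOcc (𝓜.linkWord n π), 𝓜.pathSign n π))]
  refine Finset.sum_congr rfl fun z _ => Finset.sum_congr ?_ fun _ _ => rfl
  ext π
  simp [Model.circuits, Prod.ext_iff]

theorem Model.mem_circuits {h n : ℕ} {f : Fin h → Fin h} {ε : Fin h → ℤˣ}
    {π : Fin (h + 1) → Fin n} (hπ : π ∈ 𝓜.circuits n f ε) :
    firstOcc (𝓜.linkWord n π) = f := (Finset.mem_filter.1 hπ).2.2.1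

theorem Model.circuitSum_eq_zero {h n : ℕ} {f : Fin h → Fin h} {ε : Fin h → ℤˣ}
    (he : 𝓜.circuits n f ε = ∅) : 𝓜.circuitSum P x n f ε = 0 := by
  simp [Model.circuitSum, he]

theorem Model.weight_nonneg {h n : ℕ} (y : Fin (h + 1) → ℝ) : 0 ≤ 𝓜.weight n y :=
  Finset.prod_nonneg fun _ _ => by positivity

/-- Only matchings into pairs contribute to the limit. -/
theorem Model.tendsto_circuitSum_zero [IsProbabilityMeasure P]
    (hx : IsBoundedIIDInput P x) {h : ℕ} {f : Fin h → Fin h}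
    (hf : ¬ (firstOcc f = f ∧ ∀ i, firstOcc f i = i → blockSize f i = 2)) (ε : Fin h → ℤˣ) :
    Tendsto (fun n : ℕ => 𝓜.circuitSum P x (n + 1) f ε) atTop (𝓝 0) := by
  by_cases hff : firstOcc f = f
  swap
  · refine tendsto_const_nhds.congr fun n => (𝓜.circuitSum_eq_zero ?_).symm
    refine Finset.eq_empty_of_forall_notMem fun π hπ => hff ?_
    have := 𝓜.mem_circuits hπ
    conv_rhs => rw [← this]
    refine firstOcc_congr fun p q => ?_
    rw [← this, firstOcc_eq_iff]
  have hbl : ∀ {n : ℕ} {π : Fin (h + 1) → Fin n}, π ∈ 𝓜.circuits n f ε → ∀ i,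
      blockSize (𝓜.linkWord n π) i = blockSize f i := fun hπ i =>
    blockSize_eq_of_firstOcc_eq (by rw [𝓜.mem_circuits hπ, hff]) i
  by_cases hb1 : ∃ i, firstOcc f i = i ∧ blockSize f i = 1
  · obtain ⟨i, hi, hi1⟩ := hb1
    refine tendsto_const_nhds.congr fun n => ?_
    rw [Model.circuitSum, Finset.sum_eq_zero, mul_zero]
    intro π hπ
    rw [hx.integral_prod_eq_zero (i := i) (by rw [𝓜.mem_circuits hπ, ← hff, hi])
      (by rw [hbl hπ, hi1]), zero_mul]
  · have hb2 : ∀ i, firstOcc f i = i → 2 ≤ blockSize f i := fun i hi => by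
      have h0 : 0 < blockSize f i := Finset.card_pos.2 ⟨i, by simpa using hi⟩
      have h1 : blockSize f i ≠ 1 := fun h1 => hb1 ⟨i, hi, h1⟩
      omega
    obtain ⟨i₀, hi₀, hb₀⟩ : ∃ i, firstOcc f i = i ∧ 3 ≤ blockSize f i := by
      by_contra hcon
      refine hf ⟨hff, fun i hi => le_antisymm ?_ (hb2 i hi)⟩
      by_contra h3
      exact hcon ⟨i, hi, by omega⟩
    obtain ⟨C, hC⟩ := hx.bounded
    have hlim := (𝓜.tendsto_sum_weight_zero_of_blockSize (ε := ε) hb2 hi₀ hb₀).const_mul (C ^ h)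
    rw [mul_zero, hff] at hlim
    refine squeeze_zero_norm (fun n => ?_) hlim
    rw [Model.circuitSum, norm_mul, Real.norm_of_nonneg (by positivity), mul_left_comm]
    refine mul_le_mul_of_nonneg_left ?_ (by positivity)
    refine (norm_sum_le _ _).trans ?_
    rw [Finset.mul_sum]
    refine Finset.sum_le_sum fun π _ => ?_
    rw [norm_mul, Real.norm_of_nonneg (𝓜.weight_nonneg _)]
    exact mul_le_mul_of_nonneg_right (abs_integral_prod_le hC _) (𝓜.weight_nonneg _)

theorem Model.circuitSum_eq [IsProbabilityMeasure P] (hx : IsBoundedIIDInput P x) {h k n : ℕ} {w : Fin h → Fin k}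
    (hb : ∀ i, firstOcc w i = i → blockSize w i = 2) (ε : Fin h → ℤˣ) :
    𝓜.circuitSum P x n (firstOcc w) ε = (1 / n : ℝ) *
      ∑ π ∈ 𝓜.circuits n (firstOcc w) ε, 𝓜.weight n (fun v => mid n (π v)) := by
  rw [Model.circuitSum]
  congr 1
  refine Finset.sum_congr rfl fun π hπ => ?_
  rw [hx.integral_prod_eq_one, one_mul]
  intro i hi
  have := 𝓜.mem_circuits hπ
  rw [blockSize_eq_of_firstOcc_eq this, hb i (by rw [← this, hi])]

theorem Model.tendsto_integral_esdMoment_odd [IsProbabilityMeasure P]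
    (hx : IsBoundedIIDInput P x)
    (hA : ∀ n y, (𝓜.matrix n y).IsHermitian) (k : ℕ) :
    Tendsto (fun n : ℕ => ∫ ω, esdMoment (2 * k + 1) (𝓜.matrix (n + 1) fun i => x i ω) (hA _ _) ∂P)
      atTop (𝓝 0) := by
  simp_rw [fun n : ℕ => 𝓜.integral_esdMoment hx (n + 1) (hA _) (2 * k + 1)]
  rw [← Finset.sum_const_zero (s := (Finset.univ :
    Finset ((Fin (2 * k + 1) → Fin (2 * k + 1)) × (Fin (2 * k + 1) → ℤˣ))))]
  refine tendsto_finsetSum _ fun z _ => 𝓜.tendsto_circuitSum_zero hx (fun hz => ?_) _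
  have := eq_two_mul_numLetters hz.2
  omega

open Classical in
/-- The words whose vertex forms close up. -/
def Model.words (k : ℕ) : Finset (Fin (2 * k) → Fin k) :=
  (pairWords k).filter fun w =>
    ∀ i, firstOcc w i = i → closeCoeff 𝓜.κ (fun _ => 𝓜.ε₀) w i = 0

theorem Model.tendsto_integral_esdMoment_even [IsProbabilityMeasure P]
    (hx : IsBoundedIIDInput P x)
    (hA : ∀ n y, (𝓜.matrix n y).IsHermitian) (k : ℕ)
    (hε : ∀ w ∈ pairWords k, ∀ ε : Fin (2 * k) → ℤˣ, ε ≠ (fun _ => 𝓜.ε₀) →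
      (∀ n, 𝓜.circuits n (firstOcc w) ε = ∅) ∨
        ∃ i, firstOcc w i = i ∧ closeCoeff 𝓜.κ ε w i ≠ 0) :
    Tendsto (fun n : ℕ => ∫ ω, esdMoment (2 * k) (𝓜.matrix (n + 1) fun i => x i ω) (hA _ _) ∂P)
      atTop (𝓝 (∑ w ∈ 𝓜.words k, ∫ u, wordIntegrand 𝓜.step 𝓜.φ w u ∂uniformLaw w)) := by
  classical
  simp_rw [fun n : ℕ => 𝓜.integral_esdMoment hx (n + 1) (hA _) (2 * k)]
  set I : (Fin (2 * k) → Fin k) → ℝ := fun w =>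
    ∫ u, wordIntegrand 𝓜.step 𝓜.φ w u ∂uniformLaw w with hI
  have hsum : ∑ w ∈ 𝓜.words k, I w = ∑ z : (Fin (2 * k) → Fin (2 * k)) × (Fin (2 * k) → ℤˣ),
      ∑ w ∈ 𝓜.words k with (firstOcc w, fun _ => 𝓜.ε₀) = z, I w :=
    (Finset.sum_fiberwise _ _ _).symm
  rw [hsum]
  refine tendsto_finsetSum _ fun z _ => ?_
  obtain ⟨f, ε⟩ := z
  simp only [Prod.mk.injEq]
  by_cases hf : firstOcc f = f ∧ ∀ i, firstOcc f i = i → blockSize f i = 2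
  · obtain ⟨w, hw, hwf⟩ := exists_pairWord hf.2
    rw [hf.1] at hwf
    have hwb : ∀ i, firstOcc w i = i → blockSize w i = 2 := fun i hi =>
      blockSize_of_isPairMatched (mem_pairWords.1 hw).2 hi
    have huniq : ∀ w' ∈ 𝓜.words k, firstOcc w' = f → w' = w := fun w' hw' hf' =>
      (mem_pairWords.1 (Finset.mem_filter.1 hw').1).1.eq_of_firstOcc_eq (mem_pairWords.1 hw).1
        (hf'.trans hwf.symm)
    subst hwf
    simp_rw [𝓜.circuitSum_eq hx hwb]
    by_cases hεc : ε = fun _ => 𝓜.ε₀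
    · subst hεc
      by_cases hcl : ∀ i, firstOcc w i = i → closeCoeff 𝓜.κ (fun _ => 𝓜.ε₀) w i = 0
      · have hmem : w ∈ 𝓜.words k := Finset.mem_filter.2 ⟨hw, hcl⟩
        rw [Finset.sum_eq_single_of_mem w (by simpa using hmem)
          fun w' hw' hne => absurd (huniq w' (Finset.mem_filter.1 hw').1
            (Finset.mem_filter.1 hw').2.1) hne]
        exact 𝓜.tendsto_sum_weight_wordIntegrand (even_two_mul k) hwb hcl
      · rw [Finset.sum_eq_zero fun w' hw' => absurd (Finset.mem_filter.1 (huniq w'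
          (Finset.mem_filter.1 hw').1 (Finset.mem_filter.1 hw').2.1 ▸
            (Finset.mem_filter.1 hw').1)).2 hcl]
        push Not at hcl
        obtain ⟨i, hi, hc⟩ := hcl
        exact 𝓜.tendsto_sum_weight_zero_of_closeCoeff (fun i hi => (hwb i hi).ge) hi hc
    · rw [Finset.sum_eq_zero fun w' hw' => absurd (Finset.mem_filter.1 hw').2.2.symm hεc]
      rcases hε w hw ε hεc with he | ⟨i, hi, hc⟩
      · simp [he]
      · exact 𝓜.tendsto_sum_weight_zero_of_closeCoeff (fun i hi => (hwb i hi).ge) hi hc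
  · rw [Finset.sum_eq_zero fun w' hw' => ?_]
    · exact 𝓜.tendsto_circuitSum_zero hx hf ε
    · exfalso
      obtain ⟨hw'', rfl, -⟩ := Finset.mem_filter.1 hw'
      have hm := (mem_pairWords.1 (Finset.mem_filter.1 hw'').1).2
      have hff : firstOcc (firstOcc w') = firstOcc w' :=
        firstOcc_congr fun p q => firstOcc_eq_iff w'
      refine hf ⟨hff, fun i hi => ?_⟩
      rw [blockSize_eq_of_firstOcc_eq hff, blockSize_of_isPairMatched hm (by rw [← hff, hi])]

end Moments

/-! ### The balanced Toeplitz and Hankel matrices as models -/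

theorem norm_coe_le_of_mem_Ioo {x : ℝ} (hx : x ∈ Set.Ioo (0 : ℝ) 1) :
    ‖(x : UnitAddCircle)‖ ≤ x ∧ ‖(x : UnitAddCircle)‖ ≤ 1 - x := by
  rw [UnitAddCircle.norm_eq]
  refine ⟨(round_le x 0).trans ?_, (round_le x 1).trans ?_⟩
  · simp [abs_of_pos hx.1]
  · rw [Int.cast_one, abs_sub_comm, abs_of_pos (by linarith [hx.2])]

theorem mul_phiT_mid {n : ℕ} (hn : n ≠ 0) (i j : ℕ) :
    n * phiT (mid n i) (mid n j) = n - |(i : ℝ) - j| := by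
  have hn' : (0 : ℝ) < n := by positivity
  have : mid n i - mid n j = ((i : ℝ) - j) / n := by rw [mid, mid]; ring
  rw [phiT, this, abs_div, abs_of_pos hn']
  field_simp

theorem mul_phiH_mid {n : ℕ} (hn : n ≠ 0) (i j : ℕ) :
    n * phiH (mid n i) (mid n j) =
      min ((i : ℝ) + j + 1) (2 * n - ((i : ℝ) + j + 1)) := by
  have hn' : (0 : ℝ) < n := by positivity
  rw [phiH, mul_min_of_nonneg _ _ hn'.le]
  congr 1 <;> simp only [mid] <;> field_simp <;> ring

/-- The balanced Toeplitz matrix as a model. -/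
def toeplitzModel : Model where
  κ := -1
  ε₀ := -1
  link i j := ((i : ℤ) - (j : ℤ)).natAbs
  φ := phiT
  step := stepT
  normalized := by norm_num
  link_lt := by intro n i j hi hj; omega
  link_eq := by
    intro i j i' j' he
    simp only [Units.val_neg, Units.val_one] at he
    omega
  of_link_eq := by
    intro i j i' j' he
    simp only [Units.val_neg, Units.val_one, true_and, neg_neg]
    omega
  continuous_φ := by unfold phiT; fun_prop
  le_φ := by
    intro x y hx hy
    have h1 := norm_coe_le_of_mem_Ioo hx
    have h2 := norm_coe_le_of_mem_Ioo hy
    rw [phiT]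
    rcases abs_cases (x - y) with h | h <;> linarith
  φ_congr := by
    intro n i j i' j' he
    have : |(i : ℝ) - j| = |(i' : ℝ) - j'| := by
      have h1 : |(i : ℤ) - j| = |(i' : ℤ) - j'| := by
        rw [Int.abs_eq_natAbs, Int.abs_eq_natAbs, he]
      exact_mod_cast h1
    have e : ∀ a b : ℕ, mid n a - mid n b = ((a : ℝ) - b) / n := fun a b => by
      rw [mid, mid]; ring
    simp only [phiT, e, abs_div, this]
  vertexForm_eq w u v := vertexForm_stepT w u v

/-- The balanced Hankel matrix as a model. -/
def hankelModel : Model where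
  κ := 1
  ε₀ := 1
  link i j := i + j + 1
  φ := phiH
  step := stepH
  normalized := by norm_num
  link_lt := by intro n i j hi hj; omega
  link_eq := by
    intro i j i' j' he
    simp only [Units.val_one] at he
    omega
  of_link_eq := by
    intro i j i' j' he
    simp only [Units.val_one]
    omega
  continuous_φ := by unfold phiH; fun_prop
  le_φ := by
    intro x y hx hy
    have h1 := norm_coe_le_of_mem_Ioo hx
    have h2 := norm_coe_le_of_mem_Ioo hy
    rw [phiH]
    exact le_min (by linarith) (by linarith)
  φ_congr := by
    intro n i j i' j' he
    have h1 : (i : ℝ) + j = i' + j' := by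
      have : i + j = i' + j' := by omega
      exact_mod_cast this
    have e : ∀ a b : ℕ, mid n a + mid n b = ((a : ℝ) + b + 1) / n := fun a b => by
      rw [mid, mid]; ring
    have e' : ∀ a b : ℕ, 2 - mid n a - mid n b = 2 - ((a : ℝ) + b + 1) / n := fun a b => by
      rw [mid, mid]; ring
    simp only [phiH, e, e', h1]
  vertexForm_eq w u v := vertexForm_stepH w u v

theorem toeplitzModel_matrix (n : ℕ) (x : ℕ → ℝ) : toeplitzModel.matrix n x = toeplitz n x := by
  ext i j
  change x _ / √(n * phiT (mid n i) (mid n j)) = x _ / √(_)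
  rw [mul_phiT_mid (by have := i.2; omega)]
  rfl

theorem hankelModel_matrix (n : ℕ) (x : ℕ → ℝ) : hankelModel.matrix n x = hankel n x := by
  ext i j
  change x _ / √(n * phiH (mid n i) (mid n j)) = x _ / √(_)
  rw [mul_phiH_mid (by have := i.2; omega)]
  rfl

/-- The balancing is by the number of occurrences of a variable, up to a factor of `2`. -/
def Model.IsBalanced (𝓜 : Model) : Prop :=
  ∀ (n : ℕ) (i j : Fin n),
    ((Finset.univ.filter fun p : Fin n × Fin n => 𝓜.link p.1 p.2 = 𝓜.link i j).card : ℝ) ≤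
      2 * (n * 𝓜.φ (mid n i) (mid n j))

theorem toeplitzModel_isBalanced : toeplitzModel.IsBalanced := by
  intro n i j
  change _ ≤ 2 * (n * phiT (mid n i) (mid n j))
  rw [mul_phiT_mid (by have := i.2; omega)]
  have hc : (Finset.univ.filter fun p : Fin n × Fin n =>
      toeplitzModel.link p.1 p.2 = toeplitzModel.link i j).card ≤
      (Finset.range (n - ((i : ℤ) - (j : ℤ)).natAbs) ×ˢ (Finset.univ : Finset Bool)).card := by
    refine Finset.card_le_card_of_injOn (fun p => (min (p.1 : ℕ) p.2, decide (p.1 ≤ p.2))) ?_ ?_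
    · rintro ⟨⟨a, ha⟩, ⟨b, hb⟩⟩ hp
      have hp' : ((a : ℤ) - (b : ℤ)).natAbs = ((i : ℤ) - (j : ℤ)).natAbs :=
        (Finset.mem_filter.1 hp).2
      simp
      omega
    · rintro ⟨⟨a, ha⟩, ⟨b, hb⟩⟩ hp ⟨⟨a', ha'⟩, ⟨b', hb'⟩⟩ hp' he
      have h1 : ((a : ℤ) - (b : ℤ)).natAbs = ((i : ℤ) - (j : ℤ)).natAbs :=
        (Finset.mem_filter.1 hp).2
      have h2 : ((a' : ℤ) - (b' : ℤ)).natAbs = ((i : ℤ) - (j : ℤ)).natAbs :=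
        (Finset.mem_filter.1 hp').2
      simp only [Prod.mk.injEq, Fin.mk_le_mk, decide_eq_decide, Fin.mk.injEq] at he ⊢
      omega
  rw [Finset.card_product, Finset.card_range] at hc
  have h2 : (((n - ((i : ℤ) - (j : ℤ)).natAbs : ℕ) : ℤ) : ℝ) = n - |(i : ℝ) - j| := by
    have : ((n - ((i : ℤ) - (j : ℤ)).natAbs : ℕ) : ℤ) = n - |(i : ℤ) - j| := by
      rw [Int.abs_eq_natAbs]; omega
    rw [this]; push_cast; rfl
  rw [← h2]
  have hc' : ((Finset.univ.filter fun p : Fin n × Fin n =>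
      toeplitzModel.link p.1 p.2 = toeplitzModel.link i j).card : ℝ) ≤
      ((n - ((i : ℤ) - (j : ℤ)).natAbs : ℕ) : ℝ) * (2 : ℕ) := by exact_mod_cast hc
  push_cast at hc' ⊢
  linarith

theorem hankelModel_isBalanced : hankelModel.IsBalanced := by
  intro n i j
  change _ ≤ 2 * (n * phiH (mid n i) (mid n j))
  rw [mul_phiH_mid (by have := i.2; omega)]
  have hc : (Finset.univ.filter fun p : Fin n × Fin n =>
      hankelModel.link p.1 p.2 = hankelModel.link i j).card ≤
      (Finset.Ico ((i : ℕ) + j + 1 - n) (min n (i + j + 1))).card := by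
    refine Finset.card_le_card_of_injOn (fun p => (p.1 : ℕ)) ?_ ?_
    · rintro ⟨⟨a, ha⟩, ⟨b, hb⟩⟩ hp
      have hp' : a + b + 1 = i + j + 1 := (Finset.mem_filter.1 hp).2
      simp
      omega
    · rintro ⟨⟨a, ha⟩, ⟨b, hb⟩⟩ hp ⟨⟨a', ha'⟩, ⟨b', hb'⟩⟩ hp' he
      have h1 : a + b + 1 = i + j + 1 := (Finset.mem_filter.1 hp).2
      have h2 : a' + b' + 1 = i + j + 1 := (Finset.mem_filter.1 hp').2
      simp only [Prod.mk.injEq, Fin.mk.injEq] at he ⊢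
      omega
  rw [Nat.card_Ico] at hc
  have h2 : ((min n (i + j + 1) - ((i : ℕ) + j + 1 - n) : ℕ) : ℝ) ≤
      min ((i : ℝ) + j + 1) (2 * n - ((i : ℝ) + j + 1)) := by
    refine le_min ?_ ?_
    · have : min n (i + j + 1) - ((i : ℕ) + j + 1 - n) ≤ (i : ℕ) + j + 1 := by omega
      exact_mod_cast this
    · have : min n (i + j + 1) - ((i : ℕ) + j + 1 - n) + ((i : ℕ) + j + 1) ≤ 2 * n := by omega
      rw [le_sub_iff_add_le]
      exact_mod_cast this
  have h3 : (0 : ℝ) ≤ ((min n (i + j + 1) - ((i : ℕ) + j + 1 - n) : ℕ) : ℝ) := Nat.cast_nonneg _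
  have hc' : ((Finset.univ.filter fun p : Fin n × Fin n =>
      hankelModel.link p.1 p.2 = hankelModel.link i j).card : ℝ) ≤
      ((min n (i + j + 1) - ((i : ℕ) + j + 1 - n) : ℕ) : ℝ) := by exact_mod_cast hc
  linarith

theorem Model.pathSign_firstOcc (𝓜 : Model) {h n : ℕ} {π : Fin (h + 1) → Fin n} {p : Fin h}
    (hp : firstOcc (𝓜.linkWord n π) p = p) : 𝓜.pathSign n π p = 𝓜.ε₀ :=
  if_pos (Or.inr hp)

/-- In a Toeplitz circuit, signs other than the standard ones do not close up. -/
theorem toeplitzModel_signs {k : ℕ} {w : Fin (2 * k) → Fin k} (hw : w ∈ pairWords k)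
    {ε : Fin (2 * k) → ℤˣ} (hε : ε ≠ fun _ => toeplitzModel.ε₀) :
    (∀ n, toeplitzModel.circuits n (firstOcc w) ε = ∅) ∨
      ∃ i, firstOcc w i = i ∧ closeCoeff toeplitzModel.κ ε w i ≠ 0 := by
  by_cases hf : ∀ j, firstOcc w j = j → ε j = -1
  · right
    by_contra hcon
    push Not at hcon
    have := (closeCoeff_neg_one fun i hi =>
      blockSize_of_isPairMatched (mem_pairWords.1 hw).2 hi).1 hcon
    exact hε (funext fun j => by by_cases hj : firstOcc w j = j <;> [exact hf j hj; exact this j hj])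
  · left
    push Not at hf
    obtain ⟨j, hj, hj'⟩ := hf
    intro n
    refine Finset.eq_empty_of_forall_notMem fun π hπ => hj' ?_
    obtain ⟨-, h1, h2⟩ := (Finset.mem_filter.1 hπ).2
    rw [← h2, toeplitzModel.pathSign_firstOcc (by rw [h1, hj])]
    rfl

/-- In a Hankel circuit, all signs are the standard ones. -/
theorem hankelModel_signs {k : ℕ} (w : Fin (2 * k) → Fin k)
    {ε : Fin (2 * k) → ℤˣ} (hε : ε ≠ fun _ => hankelModel.ε₀) (n : ℕ) :
    hankelModel.circuits n (firstOcc w) ε = ∅ := by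
  refine Finset.eq_empty_of_forall_notMem fun π hπ => hε (funext fun j => ?_)
  obtain ⟨-, h1, h2⟩ := (Finset.mem_filter.1 hπ).2
  rw [← h2]
  by_cases hj : firstOcc (hankelModel.linkWord n π) j = j
  · exact hankelModel.pathSign_firstOcc hj
  · have h3 := (hankelModel.intEdge_eq_pathSign hj).2
    have h4 : (1 + (1 : ℤ)) * (hankelModel.pathSign n π j : ℤ) = 1 + 1 := h3
    exact Units.ext (by change _ = (1 : ℤ); linarith)

theorem toeplitzModel_words (k : ℕ) : toeplitzModel.words k = pairWords k :=
  Finset.filter_true_of_mem fun _ hw => (closeCoeff_neg_one fun _ hi =>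
    blockSize_of_isPairMatched (mem_pairWords.1 hw).2 hi).2 fun _ _ => rfl

theorem hankelModel_words (k : ℕ) : hankelModel.words k = symPairWords k := by
  classical
  unfold Model.words symPairWords
  exact Finset.filter_congr fun w hw => closeCoeff_one (mem_pairWords.1 hw).2

/-- The limiting even moments of a model. -/
def Model.moment (𝓜 : Model) (k : ℕ) : ℝ :=
  ∑ w ∈ 𝓜.words k, ∫ u, wordIntegrand 𝓜.step 𝓜.φ w u ∂uniformLaw w

theorem toeplitzModel_moment (k : ℕ) : toeplitzModel.moment k = momentT k := by
  rw [Model.moment, toeplitzModel_words]; rfl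

theorem hankelModel_moment (k : ℕ) : hankelModel.moment k = momentH k := by
  rw [Model.moment, hankelModel_words]; rfl

/-- The number of pair-matched words of length `2 * k` is of order `k ^ k`, and so is the bound for
the contribution of a word; the moments therefore grow at most like `(2 * k)!`, up to an
exponential factor. -/
theorem Model.moment_le (𝓜 : Model) (k : ℕ) :
    𝓜.moment k ≤ (4 * Real.exp 2) * (32 * Real.exp 2) ^ k * (2 * k).factorial := by
  have h1 : 𝓜.moment k ≤ ∑ w ∈ 𝓜.words k, (4 ^ (2 * k + 1) * (2 * (k + 1)) ^ k : ℝ) := by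
    refine Finset.sum_le_sum fun w hw => ?_
    have := 𝓜.integral_wordIntegrand_le (w := w)
    rwa [numLetters_of_mem_pairWords (Finset.mem_filter.1 hw).1] at this
  rw [Finset.sum_const, nsmul_eq_mul] at h1
  have h2 : ((𝓜.words k).card : ℝ) ≤ 4 ^ k * (k + 1) ^ k := by
    have h3 : ((𝓜.words k).card : ℝ) ≤ 4 ^ k * k ^ k := by
      exact_mod_cast (Finset.card_filter_le _ _).trans (card_pairWords_le k)
    refine h3.trans ?_
    gcongr
    linarith
  have h4 : ((2 * (k + 1) : ℝ)) ^ (2 * k) ≤ Real.exp (2 * (k + 1)) * (2 * k).factorial := by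
    have := Real.pow_div_factorial_le_exp (2 * (k + 1) : ℝ) (by positivity) (2 * k)
    rwa [div_le_iff₀ (by positivity)] at this
  have h5 : Real.exp (2 * (k + 1)) = Real.exp 2 * Real.exp 2 ^ k := by
    rw [← Real.exp_nat_mul, ← Real.exp_add]; congr 1; ring
  calc 𝓜.moment k ≤ (4 ^ k * (k + 1) ^ k) * (4 ^ (2 * k + 1) * (2 * (k + 1)) ^ k) :=
        h1.trans (by gcongr)
    _ = 4 * 32 ^ k * (2 * (k + 1)) ^ (2 * k) := by
        rw [mul_pow 2 _ k, mul_pow 2 _ (2 * k), pow_mul (2 : ℝ) 2 k, pow_add, pow_mul (4 : ℝ) 2 k,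
          show (32 : ℝ) = 4 * 4 * 2 by norm_num, show (4 : ℝ) ^ 2 = 4 * 4 by norm_num,
          show (2 : ℝ) ^ 2 = 4 by norm_num]
        simp only [mul_pow]
        ring
    _ ≤ 4 * 32 ^ k * (Real.exp (2 * (k + 1)) * (2 * k).factorial) := by gcongr
    _ = _ := by rw [h5, mul_pow]; ring

/-! ### The method of moments on the real line -/

/-- Even moments that grow at most like `(2 * k)!` give exponential moments. -/
theorem integrable_exp_mul_of_moments {μ : Measure ℝ} [IsFiniteMeasure μ]
    (hint : ∀ h : ℕ, Integrable (fun y : ℝ => y ^ h) μ) {A C : ℝ} (hC : 0 ≤ C)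
    (hm : ∀ k : ℕ, ∫ y, y ^ (2 * k) ∂μ ≤ A * C ^ k * (2 * k).factorial) {t : ℝ}
    (ht : t ^ 2 * C < 1) : Integrable (fun y => Real.exp (t * y)) μ := by
  have hnn : ∀ (k : ℕ) (y : ℝ), 0 ≤ (t * y) ^ (2 * k) / (2 * k).factorial := fun k y =>
    div_nonneg ((even_two_mul k).pow_nonneg _) (Nat.cast_nonneg _)
  have hcosh : ∀ y : ℝ, ENNReal.ofReal (Real.cosh (t * y)) =
      ∑' k : ℕ, ENNReal.ofReal ((t * y) ^ (2 * k) / (2 * k).factorial) := fun y => by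
    rw [← (Real.hasSum_cosh (t * y)).tsum_eq,
      ENNReal.ofReal_tsum_of_nonneg (fun k => hnn k y) (Real.hasSum_cosh (t * y)).summable]
  have hfin : ∫⁻ y, ENNReal.ofReal (Real.cosh (t * y)) ∂μ < ⊤ := by
    simp_rw [hcosh]
    rw [lintegral_tsum fun k => by fun_prop]
    have hle : ∀ k : ℕ, ∫⁻ y, ENNReal.ofReal ((t * y) ^ (2 * k) / (2 * k).factorial) ∂μ ≤
        ENNReal.ofReal (A * (t ^ 2 * C) ^ k) := fun k => by
      have hi : Integrable (fun y => (t * y) ^ (2 * k) / (2 * k).factorial) μ := by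
        simp_rw [mul_pow]
        exact ((hint _).const_mul _).div_const _
      rw [← ofReal_integral_eq_lintegral_ofReal hi (Eventually.of_forall fun y => hnn k y)]
      refine ENNReal.ofReal_le_ofReal ?_
      simp_rw [mul_pow]
      rw [integral_div, integral_const_mul, div_le_iff₀ (by positivity)]
      calc t ^ (2 * k) * ∫ y, y ^ (2 * k) ∂μ ≤ t ^ (2 * k) * (A * C ^ k * (2 * k).factorial) :=
            mul_le_mul_of_nonneg_left (hm k) ((even_two_mul k).pow_nonneg _)
        _ = _ := by rw [pow_mul]; ring
    refine (ENNReal.tsum_le_tsum hle).trans_lt ?_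
    have hA : 0 ≤ A := by
      have h0 := hm 0
      simp only [mul_zero, pow_zero, mul_one, Nat.factorial_zero, Nat.cast_one] at h0
      exact (integral_nonneg fun _ => zero_le_one).trans h0
    rw [← ENNReal.ofReal_tsum_of_nonneg (fun k => by positivity)
      ((summable_geometric_of_lt_one (by positivity) ht).mul_left A)]
    exact ENNReal.ofReal_lt_top
  have hci : Integrable (fun y => Real.cosh (t * y)) μ := by
    refine ⟨by fun_prop, ?_⟩
    rw [hasFiniteIntegral_iff_ofReal (Eventually.of_forall fun y => (Real.cosh_pos _).le)]
    exact hfin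
  refine (hci.const_mul 2).mono' (by fun_prop) (Eventually.of_forall fun y => ?_)
  rw [Real.norm_of_nonneg (Real.exp_pos _).le, Real.cosh_eq]
  linarith [Real.exp_pos (-(t * y))]

/-- Moment determinacy: the characteristic functions extend to analytic functions on a common
strip, where they have the same Taylor series at `0`. -/
theorem eq_of_moments_eq {μ ν : Measure ℝ} [IsFiniteMeasure μ] [IsFiniteMeasure ν]
    (hμ : ∀ h : ℕ, Integrable (fun y : ℝ => y ^ h) μ)
    (hν : ∀ h : ℕ, Integrable (fun y : ℝ => y ^ h) ν)
    (he : ∀ h : ℕ, ∫ y, y ^ h ∂μ = ∫ y, y ^ h ∂ν) {A C : ℝ} (hC : 0 < C)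
    (hm : ∀ k : ℕ, ∫ y, y ^ (2 * k) ∂μ ≤ A * C ^ k * (2 * k).factorial) : μ = ν := by
  set s : ℝ := 1 / √C with hs
  have hs0 : 0 < s := by positivity
  have hsub : ∀ t ∈ Set.Ioo (-s) s, t ^ 2 * C < 1 := fun t ht => by
    have h1 : t ^ 2 < s ^ 2 := sq_lt_sq.2 (by rw [abs_of_pos hs0]; exact abs_lt.2 ht)
    have h2 : s ^ 2 * C = 1 := by
      rw [hs, div_pow, Real.sq_sqrt hC.le]; field_simp
    nlinarith
  have hIμ : Set.Ioo (-s) s ⊆ interior (integrableExpSet id μ) :=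
    interior_maximal (fun t ht => integrable_exp_mul_of_moments hμ hC.le hm (hsub t ht)) isOpen_Ioo
  have hIν : Set.Ioo (-s) s ⊆ interior (integrableExpSet id ν) :=
    interior_maximal (fun t ht => integrable_exp_mul_of_moments hν hC.le
      (fun k => (he (2 * k)) ▸ hm k) (hsub t ht)) isOpen_Ioo
  set U : Set ℂ := {z | z.re ∈ Set.Ioo (-s) s} with hU
  have h0U : (0 : ℂ) ∈ U := by
    simp only [hU, Set.mem_ofPred_eq, Complex.zero_re, Set.mem_Ioo]
    constructor <;> linarith
  have haμ : AnalyticOnNhd ℂ (complexMGF id μ) U := fun z hz => analyticOnNhd_complexMGF z (hIμ hz)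
  have haν : AnalyticOnNhd ℂ (complexMGF id ν) U := fun z hz => analyticOnNhd_complexMGF z (hIν hz)
  have hderiv : ∀ n, iteratedDeriv n (complexMGF id μ) 0 = iteratedDeriv n (complexMGF id ν) 0 :=
    fun n => by
      rw [iteratedDeriv_complexMGF (hIμ h0U), iteratedDeriv_complexMGF (hIν h0U)]
      simp only [id, zero_mul, Complex.exp_zero, mul_one]
      have := he n
      rw [← Complex.ofReal_inj, ← integral_complex_ofReal, ← integral_complex_ofReal] at this
      simpa using this
  have hgerm : complexMGF id μ =ᶠ[𝓝 0] complexMGF id ν := by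
    have h1 := (haμ 0 h0U).hasFPowerSeriesAt
    have h2 := (haν 0 h0U).hasFPowerSeriesAt
    simp_rw [hderiv] at h1
    have h3 := h1.sub h2
    rw [sub_self] at h3
    filter_upwards [h3.eventually_eq_zero] with z hz
    exact sub_eq_zero.1 hz
  have hconv : IsPreconnected U :=
    ((convex_Ioo (-s) s).linear_preimage Complex.reLm).isPreconnected
  have heq := haμ.eqOn_of_preconnected_of_eventuallyEq haν hconv h0U hgerm
  refine Measure.ext_of_charFun (funext fun t => ?_)
  rw [← complexMGF_id_mul_I, ← complexMGF_id_mul_I]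
  refine heq ?_
  simp only [hU, Set.mem_ofPred_eq, Complex.mul_re, Complex.ofReal_re, Complex.I_re,
    Complex.ofReal_im, Complex.I_im, Set.mem_Ioo]
  constructor <;> linarith

section Weak

variable {ι : Type*} {l : Filter ι} {μ : ι → ProbabilityMeasure ℝ} {ν : ProbabilityMeasure ℝ}

/-- The bounded continuous function that truncates `g` to values in `[-R, R]`. -/
def truncation (g : ℝ → ℝ) (hg : Continuous g) {R : ℝ} (hR : 0 ≤ R) :
    BoundedContinuousFunction ℝ ℝ :=
  BoundedContinuousFunction.ofNormedAddCommGroup (fun y => max (-R) (min R (g y)))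
    (by fun_prop) R fun y => by
      rw [Real.norm_eq_abs, abs_le]
      exact ⟨le_max_left _ _, max_le (by linarith) (min_le_left _ _)⟩

theorem tendsto_integral_truncation (hμ : Tendsto μ l (𝓝 ν)) (g : ℝ → ℝ) (hg : Continuous g)
    {R : ℝ} (hR : 0 ≤ R) :
    Tendsto (fun i => ∫ y, max (-R) (min R (g y)) ∂(μ i : Measure ℝ)) l
      (𝓝 (∫ y, max (-R) (min R (g y)) ∂(ν : Measure ℝ))) :=
  (ProbabilityMeasure.tendsto_iff_forall_integral_tendsto.1 hμ) (truncation g hg hR)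

/-- Uniformly bounded even moments stay bounded in a weak limit. -/
theorem integrable_pow_of_tendsto [l.NeBot] (hμ : Tendsto μ l (𝓝 ν)) {k : ℕ} {M : ℝ}
    (hint : ∀ i, Integrable (fun y : ℝ => y ^ (2 * k)) (μ i : Measure ℝ))
    (hM : ∀ᶠ i in l, ∫ y, y ^ (2 * k) ∂(μ i : Measure ℝ) ≤ M) :
    Integrable (fun y : ℝ => y ^ (2 * k)) (ν : Measure ℝ) ∧
      ∫ y, y ^ (2 * k) ∂(ν : Measure ℝ) ≤ M := by
  have hnn : ∀ y : ℝ, 0 ≤ y ^ (2 * k) := fun y => (even_two_mul k).pow_nonneg y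
  have hb : ∀ R : ℕ, ∫ y, max (-(R : ℝ)) (min R (y ^ (2 * k))) ∂(ν : Measure ℝ) ≤ M := fun R => by
    refine le_of_tendsto (tendsto_integral_truncation hμ (fun y => y ^ (2 * k)) (by fun_prop)
      (Nat.cast_nonneg R)) ?_
    filter_upwards [hM] with i hi
    refine (integral_mono ((truncation (fun y => y ^ (2 * k)) (by fun_prop)
      (Nat.cast_nonneg R)).integrable _) (hint i) fun y => ?_).trans hi
    exact max_le (by have := hnn y; have := Nat.cast_nonneg (α := ℝ) R; linarith) (min_le_right _ _)
  have hlim : ∫⁻ y, ENNReal.ofReal (y ^ (2 * k)) ∂(ν : Measure ℝ) ≤ ENNReal.ofReal M := by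
    have hsup : ∀ y : ℝ, ENNReal.ofReal (y ^ (2 * k)) =
        ⨆ R : ℕ, ENNReal.ofReal (min R (y ^ (2 * k))) := fun y => by
      refine le_antisymm ?_ (iSup_le fun R => ENNReal.ofReal_le_ofReal (min_le_right _ _))
      obtain ⟨R, hR⟩ := exists_nat_ge (y ^ (2 * k))
      exact le_iSup_of_le R (by rw [min_eq_right hR])
    simp_rw [hsup]
    rw [lintegral_iSup (f := fun (R : ℕ) (y : ℝ) => ENNReal.ofReal (min R (y ^ (2 * k))))
      (fun R => by fun_prop) fun R R' hR y =>
        ENNReal.ofReal_le_ofReal (min_le_min (by exact_mod_cast hR) le_rfl)]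
    refine iSup_le fun R => ?_
    have hmin : ∀ y : ℝ, max (-(R : ℝ)) (min R (y ^ (2 * k))) = min (R : ℝ) (y ^ (2 * k)) := fun y =>
      max_eq_right (by
        have := hnn y; have := Nat.cast_nonneg (α := ℝ) R
        exact (by linarith : -(R : ℝ) ≤ 0).trans (le_min this (hnn y)))
    have hbR := hb R
    have hiR : Integrable (fun y : ℝ => max (-(R : ℝ)) (min R (y ^ (2 * k)))) (ν : Measure ℝ) :=
      (truncation (fun y => y ^ (2 * k)) (by fun_prop) (Nat.cast_nonneg R)).integrable _
    simp_rw [hmin] at hbR hiR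
    rw [← ofReal_integral_eq_lintegral_ofReal hiR
      (Eventually.of_forall fun y => le_min (Nat.cast_nonneg R) (hnn y))]
    exact ENNReal.ofReal_le_ofReal hbR
  have hi : Integrable (fun y : ℝ => y ^ (2 * k)) (ν : Measure ℝ) := by
    refine ⟨by fun_prop, ?_⟩
    rw [hasFiniteIntegral_iff_ofReal (Eventually.of_forall hnn)]
    exact hlim.trans_lt ENNReal.ofReal_lt_top
  refine ⟨hi, ?_⟩
  rw [← ofReal_integral_eq_lintegral_ofReal hi (Eventually.of_forall hnn)] at hlim
  have hM0 : 0 ≤ M := by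
    obtain ⟨i, hi⟩ := hM.exists
    exact (integral_nonneg fun y => hnn y).trans hi
  exact (ENNReal.ofReal_le_ofReal_iff hM0).1 hlim

theorem integrable_pow_of_even {ρ : Measure ℝ} [IsFiniteMeasure ρ] {h : ℕ}
    (hint : Integrable (fun y : ℝ => y ^ (2 * h)) ρ) : Integrable (fun y : ℝ => y ^ h) ρ := by
  refine ((integrable_const (1 : ℝ)).add hint).mono' (by fun_prop) (Eventually.of_forall fun y => ?_)
  simp only [Pi.add_apply]
  have : y ^ (2 * h) = ‖y ^ h‖ ^ 2 := by rw [Real.norm_eq_abs, sq_abs]; ring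
  rw [this]
  nlinarith [sq_nonneg (‖y ^ h‖ - 1), norm_nonneg (y ^ h)]

/-- The truncation error of a moment is controlled by a higher moment. -/
theorem abs_integral_pow_sub_truncation_le {ρ : Measure ℝ} [IsFiniteMeasure ρ] {h : ℕ} {M R : ℝ}
    (hR : 0 < R) (hint : Integrable (fun y : ℝ => y ^ (2 * h)) ρ)
    (hM : ∫ y, y ^ (2 * h) ∂ρ ≤ M) :
    |∫ y, y ^ h ∂ρ - ∫ y, max (-R) (min R (y ^ h)) ∂ρ| ≤ M / R := by
  have hpt : ∀ y : ℝ, ‖y ^ h - max (-R) (min R (y ^ h))‖ ≤ y ^ (2 * h) / R := fun y => by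
    have e : y ^ (2 * h) = (y ^ h) ^ 2 := by ring
    rw [e, Real.norm_eq_abs, le_div_iff₀ hR]
    set z := y ^ h
    rcases le_total z R with h1 | h1
    · rw [min_eq_right h1]
      rcases le_total (-R) z with h2 | h2
      · rw [max_eq_right h2, sub_self, abs_zero, zero_mul]; positivity
      · rw [max_eq_left h2, abs_of_nonpos (by linarith)]; nlinarith
    · rw [min_eq_left h1, max_eq_right (by linarith), abs_of_nonneg (by linarith)]; nlinarith
  have hi : Integrable (fun y : ℝ => max (-R) (min R (y ^ h))) ρ :=
    (truncation (fun y => y ^ h) (by fun_prop) hR.le).integrable _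
  rw [← integral_sub (integrable_pow_of_even hint) hi, ← Real.norm_eq_abs]
  refine (norm_integral_le_of_norm_le (hint.div_const R) (Eventually.of_forall hpt)).trans ?_
  rw [integral_div]
  gcongr

/-- Along a weakly convergent family whose moments converge, the limits of the moments are the
moments of the limit. -/
theorem moments_of_tendsto [l.NeBot] (hμ : Tendsto μ l (𝓝 ν)) {m : ℕ → ℝ}
    (hint : ∀ i (h : ℕ), Integrable (fun y : ℝ => y ^ h) (μ i : Measure ℝ))
    (hm : ∀ h, Tendsto (fun i => ∫ y, y ^ h ∂(μ i : Measure ℝ)) l (𝓝 (m h))) (h : ℕ) :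
    Integrable (fun y : ℝ => y ^ h) (ν : Measure ℝ) ∧ ∫ y, y ^ h ∂(ν : Measure ℝ) = m h := by
  set M := m (2 * h) + 1 with hMdef
  have hM : ∀ᶠ i in l, ∫ y, y ^ (2 * h) ∂(μ i : Measure ℝ) ≤ M :=
    ((hm (2 * h)).eventually_lt_const (lt_add_one _)).mono fun i hi => hi.le
  obtain ⟨h1, h2⟩ := integrable_pow_of_tendsto hμ (fun i => hint i _) hM
  refine ⟨integrable_pow_of_even h1, ?_⟩
  have hM0 : 0 ≤ M := (integral_nonneg fun y => (even_two_mul h).pow_nonneg y).trans h2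
  have hdist : ∀ R : ℝ, 0 < R → |m h - ∫ y, y ^ h ∂(ν : Measure ℝ)| ≤ 2 * M / R := fun R hR => by
    have ht := ((hm h).sub (tendsto_integral_truncation hμ (fun y => y ^ h) (by fun_prop) hR.le)).abs
    have h3 : |m h - ∫ y, max (-R) (min R (y ^ h)) ∂(ν : Measure ℝ)| ≤ M / R :=
      le_of_tendsto ht (hM.mono fun i hi => abs_integral_pow_sub_truncation_le hR (hint i _) hi)
    have h4 := abs_integral_pow_sub_truncation_le hR h1 h2
    rw [abs_sub_comm] at h4
    calc _ ≤ _ := abs_sub_le _ (∫ y, max (-R) (min R (y ^ h)) ∂(ν : Measure ℝ)) _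
      _ ≤ M / R + M / R := add_le_add h3 h4
      _ = _ := by ring
  have hz : |m h - ∫ y, y ^ h ∂(ν : Measure ℝ)| ≤ 0 := by
    have ht : Tendsto (fun R : ℝ => 2 * M / R) atTop (𝓝 0) := tendsto_const_nhds.div_atTop tendsto_id
    exact ge_of_tendsto ht ((eventually_gt_atTop 0).mono hdist)
  exact (sub_eq_zero.1 (abs_nonpos_iff.1 hz)).symm

end Weak

section Moments

variable {μ : ℕ → ProbabilityMeasure ℝ} {m : ℕ → ℝ}

theorem isCompact_closure_range_of_moments
    (hint : ∀ i (h : ℕ), Integrable (fun y : ℝ => y ^ h) (μ i : Measure ℝ))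
    (hm : ∀ h, Tendsto (fun i => ∫ y, y ^ h ∂(μ i : Measure ℝ)) atTop (𝓝 (m h))) :
    IsCompact (closure (Set.range μ)) := by
  obtain ⟨M, hM⟩ := (hm 2).bddAbove_range
  refine isCompact_closure_of_isTightMeasureSet (isTightMeasureSet_of_tendsto_measure_norm_gt ?_)
  have hb : ∀ r : ℝ, 0 < r → ⨆ ρ ∈ {((ρ : ProbabilityMeasure ℝ) : Measure ℝ) | ρ ∈ Set.range μ},
      ρ {x | r < ‖x‖} ≤ ENNReal.ofReal (M / r ^ 2) := fun r hr => by
    refine iSup₂_le ?_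
    rintro _ ⟨_, ⟨i, rfl⟩, rfl⟩
    have h1 := mul_meas_ge_le_integral_of_nonneg (μ := (μ i : Measure ℝ)) (f := fun y => y ^ 2)
      (Eventually.of_forall fun y => sq_nonneg y) (hint i 2) (r ^ 2)
    have h2 : (μ i : Measure ℝ) {x | r < ‖x‖} ≤ (μ i : Measure ℝ) {x | r ^ 2 ≤ x ^ 2} :=
      measure_mono fun x (hx : r < ‖x‖) =>
        show r ^ 2 ≤ x ^ 2 from sq_le_sq.2 (by rw [abs_of_pos hr]; exact hx.le)
    refine h2.trans ?_
    rw [← ofReal_measureReal]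
    refine ENNReal.ofReal_le_ofReal ?_
    rw [le_div_iff₀ (by positivity), mul_comm]
    exact h1.trans (hM ⟨i, rfl⟩)
  have ht : Tendsto (fun r : ℝ => ENNReal.ofReal (M / r ^ 2)) atTop (𝓝 0) := by
    have h1 : Tendsto (fun r : ℝ => M / r ^ 2) atTop (𝓝 0) :=
      tendsto_const_nhds.div_atTop (tendsto_pow_atTop (by norm_num))
    simpa using ENNReal.tendsto_ofReal h1
  exact tendsto_of_tendsto_of_tendsto_of_le_of_le' tendsto_const_nhds ht
    (Eventually.of_forall fun _ => zero_le) ((eventually_gt_atTop 0).mono hb)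

/-- The limits of the moments of a sequence of probability measures are moments. -/
theorem exists_probabilityMeasure_of_tendsto_moments
    (hint : ∀ i (h : ℕ), Integrable (fun y : ℝ => y ^ h) (μ i : Measure ℝ))
    (hm : ∀ h, Tendsto (fun i => ∫ y, y ^ h ∂(μ i : Measure ℝ)) atTop (𝓝 (m h))) :
    ∃ ν : ProbabilityMeasure ℝ, ∀ h : ℕ, Integrable (fun y : ℝ => y ^ h) (ν : Measure ℝ) ∧
      ∫ y, y ^ h ∂(ν : Measure ℝ) = m h := by
  obtain ⟨ν, -, hν⟩ := (isCompact_closure_range_of_moments hint hm) (f := map μ atTop)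
    (le_principal_iff.2 (mem_map.2 (Eventually.of_forall fun i => subset_closure ⟨i, rfl⟩)))
  obtain ⟨U, hU, hUν⟩ := mapClusterPt_iff_ultrafilter.1 hν
  exact ⟨ν, fun h => moments_of_tendsto hUν hint (fun h => (hm h).mono_left hU) h⟩

/-- The method of moments. -/
theorem tendsto_of_tendsto_moments
    (hint : ∀ i (h : ℕ), Integrable (fun y : ℝ => y ^ h) (μ i : Measure ℝ))
    (hm : ∀ h, Tendsto (fun i => ∫ y, y ^ h ∂(μ i : Measure ℝ)) atTop (𝓝 (m h)))
    {A C : ℝ} (hC : 0 < C) (hgrowth : ∀ k : ℕ, m (2 * k) ≤ A * C ^ k * (2 * k).factorial)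
    {ν : ProbabilityMeasure ℝ}
    (hν : ∀ h : ℕ, Integrable (fun y : ℝ => y ^ h) (ν : Measure ℝ) ∧
      ∫ y, y ^ h ∂(ν : Measure ℝ) = m h) :
    Tendsto μ atTop (𝓝 ν) := by
  refine (isCompact_closure_range_of_moments hint hm).tendsto_nhds_of_unique_mapClusterPt
    (Eventually.of_forall fun i => subset_closure ⟨i, rfl⟩) fun ν' _ hν' => ?_
  obtain ⟨U, hU, hUν⟩ := mapClusterPt_iff_ultrafilter.1 hν'
  have h' := moments_of_tendsto hUν hint (fun h => (hm h).mono_left hU)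
  refine Subtype.ext (eq_of_moments_eq (μ := (ν' : Measure ℝ)) (ν := (ν : Measure ℝ)) (A := A)
    (fun h => (h' h).1) (fun h => (hν h).1)
    (fun h => (h' h).2.trans (hν h).2.symm) hC fun k => ?_)
  rw [(h' (2 * k)).2]
  exact hgrowth k

end Moments

/-! ### Perturbation of linear spectral statistics -/

section Perturbation

variable {n : ℕ}

theorem trace_mul_transpose_eq (M : Matrix (Fin n) (Fin n) ℝ) :
    (M * M.transpose).trace = ∑ i, ∑ j, M i j ^ 2 := by
  simp [Matrix.trace, Matrix.mul_apply, sq]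

theorem sum_sq_orthogonal {P : Matrix (Fin n) (Fin n) ℝ} (hP : P * P.transpose = 1) (i : Fin n) :
    ∑ j, P i j ^ 2 = 1 := by
  have := congrFun (congrFun hP i) i
  simpa [Matrix.mul_apply, sq] using this

/-- The Frobenius distance and the linear term of the expansion of a spectral statistic, in terms
of the eigenvalues and the doubly stochastic matrix of squared inner products of eigenvectors. -/
theorem perturbation_eq {A B V W : Matrix (Fin n) (Fin n) ℝ} {a b : Fin n → ℝ}
    (hV : V.transpose * V = 1) (hV' : V * V.transpose = 1) (hW' : W * W.transpose = 1)
    (hW : W.transpose * W = 1)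
    (hA : A = V * Matrix.diagonal a * V.transpose)
    (hB : B = W * Matrix.diagonal b * W.transpose) :
    ∃ p : Fin n → Fin n → ℝ, (∀ i j, 0 ≤ p i j) ∧ (∀ i, ∑ j, p i j = 1) ∧ (∀ j, ∑ i, p i j = 1) ∧
      ∑ i, ∑ j, (A i j - B i j) ^ 2 = ∑ i, ∑ j, p i j * (a i - b j) ^ 2 ∧
      ∀ d : Fin n → ℝ, (V * Matrix.diagonal d * V.transpose * (B - A)).trace =
        ∑ i, ∑ j, p i j * (d i * (b j - a i)) := by
  set P := V.transpose * W with hP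
  have hPP : P * P.transpose = 1 := by
    rw [hP, Matrix.transpose_mul, Matrix.transpose_transpose, Matrix.mul_assoc,
      ← Matrix.mul_assoc W, hW', Matrix.one_mul, hV]
  have hPP' : P.transpose * P.transpose.transpose = 1 := by
    rw [hP, Matrix.transpose_mul, Matrix.transpose_mul, Matrix.transpose_transpose,
      Matrix.transpose_transpose, Matrix.mul_assoc, ← Matrix.mul_assoc V, hV', Matrix.one_mul, hW]
  have hrow := sum_sq_orthogonal hPP
  refine ⟨fun i j => P i j ^ 2, fun _ _ => sq_nonneg _, hrow, fun j => sum_sq_orthogonal hPP' j,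
    ?_, fun d => ?_⟩
  · have h1 : V.transpose * (A - B) * W = Matrix.diagonal a * P - P * Matrix.diagonal b := by
      have e1 : V.transpose * A * W = Matrix.diagonal a * P := by
        rw [hA, hP]
        calc _ = (V.transpose * V) * Matrix.diagonal a * (V.transpose * W) := by
              simp only [Matrix.mul_assoc]
          _ = _ := by rw [hV, Matrix.one_mul]
      have e2 : V.transpose * B * W = P * Matrix.diagonal b := by
        rw [hB, hP]
        calc _ = (V.transpose * W) * Matrix.diagonal b * (W.transpose * W) := by
              simp only [Matrix.mul_assoc]
          _ = _ := by rw [hW, Matrix.mul_one]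
      rw [Matrix.mul_sub, Matrix.sub_mul, e1, e2]
    have h2 : ((A - B) * (A - B).transpose).trace =
        ((V.transpose * (A - B) * W) * (V.transpose * (A - B) * W).transpose).trace := by
      have : (V.transpose * (A - B) * W) * (V.transpose * (A - B) * W).transpose =
          V.transpose * ((A - B) * (A - B).transpose) * V := by
        rw [Matrix.transpose_mul, Matrix.transpose_mul, Matrix.transpose_transpose]
        calc _ = V.transpose * (A - B) * (W * W.transpose) * (A - B).transpose * V := by
              simp only [Matrix.mul_assoc]
          _ = _ := by rw [hW', Matrix.mul_one]; simp only [Matrix.mul_assoc]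
      rw [this, Matrix.trace_mul_cycle, hV', Matrix.one_mul]
    rw [h1, trace_mul_transpose_eq, trace_mul_transpose_eq] at h2
    simp only [Matrix.sub_apply] at h2
    rw [h2]
    refine Finset.sum_congr rfl fun i _ => Finset.sum_congr rfl fun j _ => ?_
    rw [Matrix.diagonal_mul, Matrix.mul_diagonal]
    ring
  · have h1 : V.transpose * (B - A) * V = P * Matrix.diagonal b * P.transpose - Matrix.diagonal a := by
      rw [Matrix.mul_sub, Matrix.sub_mul, hA, hB, hP, Matrix.transpose_mul,
        Matrix.transpose_transpose]
      congr 1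
      · simp only [Matrix.mul_assoc]
      · calc _ = (V.transpose * V) * Matrix.diagonal a * (V.transpose * V) := by
              simp only [Matrix.mul_assoc]
          _ = _ := by rw [hV, Matrix.one_mul, Matrix.mul_one]
    have h2 : (V * Matrix.diagonal d * V.transpose * (B - A)).trace =
        (Matrix.diagonal d * (V.transpose * (B - A) * V)).trace := by
      rw [Matrix.mul_assoc, Matrix.mul_assoc, Matrix.trace_mul_comm]
      simp only [Matrix.mul_assoc]
    rw [h2, h1]
    simp only [Matrix.trace, Matrix.diag, Matrix.diagonal_mul, Matrix.sub_apply,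
      Matrix.diagonal_apply_eq]
    refine Finset.sum_congr rfl fun i _ => ?_
    rw [Matrix.mul_apply]
    simp only [Matrix.mul_diagonal, Matrix.transpose_apply]
    calc d i * (∑ j, P i j * b j * P i j - a i) =
          d i * (∑ j, P i j * b j * P i j - (∑ j, P i j ^ 2) * a i) := by rw [hrow, one_mul]
      _ = _ := by
        rw [Finset.sum_mul, ← Finset.sum_sub_distrib, Finset.mul_sum]
        exact Finset.sum_congr rfl fun j _ => by ring

theorem sum_eq_double_sum {p : Fin n → Fin n → ℝ} (hrow : ∀ i, ∑ j, p i j = 1)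
    (g : Fin n → ℝ) : ∑ i, g i = ∑ i, ∑ j, p i j * g i := by
  simp_rw [← Finset.sum_mul, hrow, one_mul]

theorem sum_eq_double_sum' {p : Fin n → Fin n → ℝ} (hcol : ∀ j, ∑ i, p i j = 1)
    (g : Fin n → ℝ) : ∑ j, g j = ∑ i, ∑ j, p i j * g j := by
  rw [Finset.sum_comm]
  simp_rw [← Finset.sum_mul, hcol, one_mul]

/-- A Lipschitz spectral statistic is Lipschitz for the Frobenius norm. -/
theorem sq_sum_eigenvalues_sub_le {A B : Matrix (Fin n) (Fin n) ℝ} (hA : A.IsHermitian)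
    (hB : B.IsHermitian) {f : ℝ → ℝ} {K : ℝ} (hf : ∀ x y, |f x - f y| ≤ K * |x - y|) :
    (∑ i, f (hA.eigenvalues i) - ∑ i, f (hB.eigenvalues i)) ^ 2 ≤
      n * K ^ 2 * ∑ i, ∑ j, (A i j - B i j) ^ 2 := by
  obtain ⟨V, hV, hV', hAV⟩ := exists_orthogonal_diagonalization hA
  obtain ⟨W, hW, hW', hBW⟩ := exists_orthogonal_diagonalization hB
  obtain ⟨p, hp, hrow, hcol, hfrob, -⟩ := perturbation_eq hV hV' hW' hW hAV hBW
  set a := hA.eigenvalues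
  set b := hB.eigenvalues
  rw [hfrob, sum_eq_double_sum hrow fun i => f (a i), sum_eq_double_sum' hcol fun j => f (b j),
    ← Finset.sum_sub_distrib]
  simp_rw [← Finset.sum_sub_distrib, ← mul_sub, ← Fintype.sum_prod_type']
  have hcs := Finset.sum_mul_sq_le_sq_mul_sq Finset.univ
    (fun z : Fin n × Fin n => √(p z.1 z.2)) fun z => √(p z.1 z.2) * (f (a z.1) - f (b z.2))
  have hsum : ∑ z : Fin n × Fin n, √(p z.1 z.2) ^ 2 = n := by
    simp_rw [Real.sq_sqrt (hp _ _)]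
    rw [Fintype.sum_prod_type]
    simp [hrow]
  simp_rw [← mul_assoc, Real.mul_self_sqrt (hp _ _)] at hcs
  rw [hsum] at hcs
  refine hcs.trans ((mul_le_mul_of_nonneg_left ?_ n.cast_nonneg).trans_eq (mul_assoc _ _ _).symm)
  rw [Finset.mul_sum]
  refine Finset.sum_le_sum fun z _ => ?_
  rw [mul_pow, Real.sq_sqrt (hp _ _)]
  have h1 : (f (a z.1) - f (b z.2)) ^ 2 ≤ K ^ 2 * (a z.1 - b z.2) ^ 2 := by
    rw [← sq_abs, ← sq_abs (a z.1 - b z.2), ← mul_pow]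
    exact pow_le_pow_left₀ (abs_nonneg _) (hf _ _) 2
  calc _ ≤ p z.1 z.2 * (K ^ 2 * (a z.1 - b z.2) ^ 2) := mul_le_mul_of_nonneg_left h1 (hp _ _)
    _ = _ := by ring

/-- The first order expansion of a smooth spectral statistic: the matrix `G` represents the
derivative at `A`, and the error is quadratic in the Frobenius norm. -/
theorem exists_gradient {A : Matrix (Fin n) (Fin n) ℝ} (hA : A.IsHermitian) {f f' : ℝ → ℝ}
    {K L : ℝ} (hL : ∀ x, |f' x| ≤ L) (hf : ∀ x y, |f y - f x - f' x * (y - x)| ≤ K * (y - x) ^ 2) :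
    ∃ G : Matrix (Fin n) (Fin n) ℝ, ∑ i, ∑ j, G i j ^ 2 ≤ n * L ^ 2 ∧
      ∀ (B : Matrix (Fin n) (Fin n) ℝ) (hB : B.IsHermitian),
        |∑ i, f (hB.eigenvalues i) - ∑ i, f (hA.eigenvalues i) - (G * (B - A)).trace| ≤
          K * ∑ i, ∑ j, (A i j - B i j) ^ 2 := by
  obtain ⟨V, hV, hV', hAV⟩ := exists_orthogonal_diagonalization hA
  set a := hA.eigenvalues
  refine ⟨V * Matrix.diagonal (fun i => f' (a i)) * V.transpose, ?_, fun B hB => ?_⟩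
  · rw [← trace_mul_transpose_eq]
    have : V * Matrix.diagonal (fun i => f' (a i)) * V.transpose *
        (V * Matrix.diagonal (fun i => f' (a i)) * V.transpose).transpose =
        V * Matrix.diagonal (fun i => f' (a i) ^ 2) * V.transpose := by
      rw [Matrix.transpose_mul, Matrix.transpose_mul, Matrix.transpose_transpose,
        Matrix.diagonal_transpose]
      calc _ = V * Matrix.diagonal (fun i => f' (a i)) * (V.transpose * V) *
            Matrix.diagonal (fun i => f' (a i)) * V.transpose := by simp only [Matrix.mul_assoc]
        _ = _ := by
          rw [hV, Matrix.mul_one, Matrix.mul_assoc V, Matrix.diagonal_mul_diagonal]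
          simp only [sq]
    rw [this, Matrix.trace_mul_cycle, hV, Matrix.one_mul, Matrix.trace_diagonal]
    calc ∑ i, f' (a i) ^ 2 ≤ ∑ _i : Fin n, L ^ 2 := Finset.sum_le_sum fun i _ => by
          rw [← sq_abs]; exact pow_le_pow_left₀ (abs_nonneg _) (hL _) 2
      _ = n * L ^ 2 := by simp
  · obtain ⟨W, hW, hW', hBW⟩ := exists_orthogonal_diagonalization hB
    obtain ⟨p, hp, hrow, hcol, hfrob, hlin⟩ := perturbation_eq hV hV' hW' hW hAV hBW
    set b := hB.eigenvalues
    rw [hfrob, hlin, sum_eq_double_sum hrow fun i => f (a i),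
      sum_eq_double_sum' hcol fun j => f (b j), ← Finset.sum_sub_distrib, ← Finset.sum_sub_distrib]
    simp_rw [← Finset.sum_sub_distrib, ← mul_sub]
    rw [Finset.mul_sum]
    refine (Finset.abs_sum_le_sum_abs _ _).trans (Finset.sum_le_sum fun i _ => ?_)
    rw [Finset.mul_sum]
    refine (Finset.abs_sum_le_sum_abs _ _).trans (Finset.sum_le_sum fun j _ => ?_)
    rw [abs_mul, abs_of_nonneg (hp i j)]
    calc _ ≤ p i j * (K * (b j - a i) ^ 2) := mul_le_mul_of_nonneg_left (hf _ _) (hp i j)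
      _ = _ := by ring

end Perturbation

/-! ### The Efron–Stein inequality -/

section EfronStein

theorem integrable_of_abs_le {α : Type*} [MeasurableSpace α] {μ : Measure α} [IsFiniteMeasure μ]
    {F : α → ℝ} (hF : Measurable F) {K : ℝ} (hK : ∀ x, |F x| ≤ K) : Integrable F μ :=
  Integrable.of_bound hF.aestronglyMeasurable K (Eventually.of_forall hK)

theorem variance_eq_of_abs_le {α : Type*} [MeasurableSpace α] {μ : Measure α}
    [IsProbabilityMeasure μ] {F : α → ℝ} (hF : Measurable F) {K : ℝ} (hK : ∀ x, |F x| ≤ K) :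
    variance F μ = ∫ x, F x ^ 2 ∂μ - (∫ x, F x ∂μ) ^ 2 :=
  variance_eq_sub (MemLp.of_bound hF.aestronglyMeasurable K (Eventually.of_forall hK))

theorem abs_sq_le {z K : ℝ} (h : |z| ≤ K) : |z ^ 2| ≤ K ^ 2 := by
  rw [abs_pow]; exact pow_le_pow_left₀ (abs_nonneg _) h 2

theorem abs_integral_le_of_abs_le {α : Type*} [MeasurableSpace α] {μ : Measure α}
    [IsProbabilityMeasure μ] {F : α → ℝ} {K : ℝ} (hK : ∀ x, |F x| ≤ K) : |∫ x, F x ∂μ| ≤ K := by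
  have := norm_integral_le_of_norm_le_const (μ := μ) (f := F) (C := K) (Eventually.of_forall hK)
  rwa [probReal_univ, mul_one] at this

/-- The Efron–Stein inequality for two independent components. -/
theorem variance_prod_le {α β : Type*} [MeasurableSpace α] [MeasurableSpace β] {μ : Measure α}
    {ν : Measure β} [IsProbabilityMeasure μ] [IsProbabilityMeasure ν] {F : α × β → ℝ}
    (hF : Measurable F) {K : ℝ} (hK : ∀ z, |F z| ≤ K) :
    variance F (μ.prod ν) ≤ ∫ x, variance (fun y => F (x, y)) ν ∂μ +
      ∫ y, variance (fun x => F (x, y)) μ ∂ν := by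
  have hFx : ∀ x, Measurable fun y => F (x, y) := fun x => hF.comp measurable_prodMk_left
  have hFy : ∀ y, Measurable fun x => F (x, y) := fun y => hF.comp measurable_prodMk_right
  have ha : Measurable fun x => ∫ y, F (x, y) ∂ν :=
    hF.stronglyMeasurable.integral_prod_right'.measurable
  have hb : Measurable fun y => ∫ x, F (x, y) ∂μ :=
    hF.stronglyMeasurable.integral_prod_left'.measurable
  have haK : ∀ x, |∫ y, F (x, y) ∂ν| ≤ K := fun x => abs_integral_le_of_abs_le fun y => hK _
  have hbK : ∀ y, |∫ x, F (x, y) ∂μ| ≤ K := fun y => abs_integral_le_of_abs_le fun x => hK _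
  have hiF : Integrable F (μ.prod ν) := integrable_of_abs_le hF hK
  have hiF2 : Integrable (fun z => F z ^ 2) (μ.prod ν) :=
    integrable_of_abs_le (hF.pow_const 2) fun z => abs_sq_le (hK z)
  -- the law of total variance
  have htotal : variance F (μ.prod ν) = ∫ x, variance (fun y => F (x, y)) ν ∂μ +
      variance (fun x => ∫ y, F (x, y) ∂ν) μ := by
    rw [variance_eq_of_abs_le hF hK, variance_eq_of_abs_le ha haK, integral_prod _ hiF,
      integral_prod _ hiF2]
    simp_rw [fun x => variance_eq_of_abs_le (μ := ν) (hFx x) fun y => hK (x, y)]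
    rw [integral_sub hiF2.integral_prod_left
      (integrable_of_abs_le (ha.pow_const 2) fun x => abs_sq_le (haK x))]
    ring
  rw [htotal]
  gcongr
  have hint : Measurable fun z : α × β => (F z - ∫ x, F (x, z.2) ∂μ) ^ 2 :=
    (hF.sub (hb.comp measurable_snd)).pow_const 2
  have hdK : ∀ z : α × β, |F z - ∫ x, F (x, z.2) ∂μ| ≤ 2 * K := fun z =>
    (abs_sub _ _).trans (by have := hK z; have := hbK z.2; linarith)
  have hi : Integrable (fun z : α × β => (F z - ∫ x, F (x, z.2) ∂μ) ^ 2) (μ.prod ν) :=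
    integrable_of_abs_le hint fun z => abs_sq_le (hdK z)
  have hv : ∀ y, variance (fun x => F (x, y)) μ = ∫ x, (F (x, y) - ∫ x, F (x, y) ∂μ) ^ 2 ∂μ :=
    fun y => variance_eq_integral (hFy y).aemeasurable
  rw [variance_eq_integral ha.aemeasurable]
  simp_rw [hv]
  rw [← integral_prod_symm _ hi, integral_prod _ hi, ← integral_prod _ hiF,
    integral_prod_symm _ hiF]
  have hm : ∀ x, ∫ y, F (x, y) ∂ν - ∫ y, ∫ x, F (x, y) ∂μ ∂ν =
      ∫ y, (F (x, y) - ∫ x, F (x, y) ∂μ) ∂ν := fun x =>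
    (integral_sub (integrable_of_abs_le (hFx x) fun y => hK _)
      (integrable_of_abs_le hb hbK)).symm
  simp_rw [hm]
  have hdx : ∀ x, Measurable fun y => F (x, y) - ∫ x, F (x, y) ∂μ := fun x => (hFx x).sub hb
  refine integral_mono (integrable_of_abs_le
    ((hF.sub (hb.comp measurable_snd)).stronglyMeasurable.integral_prod_right'.measurable.pow_const 2)
    fun x => abs_sq_le (abs_integral_le_of_abs_le fun y => hdK (x, y))) hi.integral_prod_left
    fun x => ?_
  have := variance_nonneg (fun y => F (x, y) - ∫ x, F (x, y) ∂μ) ν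
  rw [variance_eq_of_abs_le (hdx x) fun y => hdK (x, y)] at this
  simp only
  linarith

theorem measurable_variance_update {m : ℕ} {μ : Fin m → Measure ℝ} [∀ i, IsProbabilityMeasure (μ i)]
    {F : (Fin m → ℝ) → ℝ} (hF : Measurable F) {K : ℝ} (hK : ∀ x, |F x| ≤ K) (l : Fin m) :
    Measurable fun x => variance (fun t => F (Function.update x l t)) (μ l) := by
  have hu : Measurable fun z : (Fin m → ℝ) × ℝ => F (Function.update z.1 l z.2) :=
    hF.comp measurable_update'
  simp_rw [fun x => variance_eq_of_abs_le (μ := μ l) (F := fun t => F (Function.update x l t))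
    (hF.comp (measurable_update x)) fun t => hK _]
  exact (hu.pow_const 2).stronglyMeasurable.integral_prod_right'.measurable.sub
    (hu.stronglyMeasurable.integral_prod_right'.measurable.pow_const 2)

/-- The Efron–Stein inequality on a finite product of probability spaces. -/
theorem variance_pi_le {m : ℕ} (μ : Fin m → Measure ℝ) [∀ i, IsProbabilityMeasure (μ i)]
    {F : (Fin m → ℝ) → ℝ} (hF : Measurable F) {K : ℝ} (hK : ∀ x, |F x| ≤ K) :
    variance F (Measure.pi μ) ≤
      ∑ l, ∫ x, variance (fun t => F (Function.update x l t)) (μ l) ∂Measure.pi μ := by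
  induction m with
  | zero =>
    have : F = fun _ => F 0 := funext fun x => congrArg F (Subsingleton.elim _ _)
    rw [this, variance_eq_integral measurable_const.aemeasurable]
    simp
  | succ m ih =>
    set ν := Measure.pi fun j : Fin m => μ j.succ with hν
    have hmp := (measurePreserving_piFinSuccAbove μ 0).symm
    set e := (MeasurableEquiv.piFinSuccAbove (fun _ : Fin (m + 1) => ℝ) 0).symm with he
    have hcons : ∀ t u, e (t, u) = Fin.cons t u := fun t u => by
      simp [he, MeasurableEquiv.piFinSuccAbove, Fin.insertNthEquiv]
    have hFe : Measurable (F ∘ e) := hF.comp e.measurable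
    have hvar : variance F (Measure.pi μ) = variance (F ∘ e) ((μ 0).prod ν) := by
      rw [← hmp.map_eq, variance_map hF.aemeasurable hmp.aemeasurable]
      rfl
    have hint : ∀ g : (Fin (m + 1) → ℝ) → ℝ, Measurable g → ∀ L : ℝ, (∀ x, |g x| ≤ L) →
        ∫ x, g x ∂Measure.pi μ = ∫ t, ∫ u, g (Fin.cons t u) ∂ν ∂(μ 0) := fun g hg L hL => by
      rw [← hmp.integral_comp e.measurableEmbedding, integral_prod]
      · simp_rw [hcons]; rfl
      · exact integrable_of_abs_le (hg.comp e.measurable) fun z => hL _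
    have hvm := fun l => measurable_variance_update (μ := μ) hF hK l
    have hvb : ∀ l x, |variance (fun t => F (Function.update x l t)) (μ l)| ≤ K ^ 2 :=
      fun l x => by
        rw [abs_of_nonneg (variance_nonneg _ _)]
        refine (variance_le_expectation_sq
          (hF.comp (measurable_update x)).aestronglyMeasurable).trans ?_
        exact (le_abs_self _).trans (abs_integral_le_of_abs_le fun t => abs_sq_le (hK _))
    rw [hvar, Fin.sum_univ_succ, add_comm (∫ x, _ ∂_)]
    refine (variance_prod_le hFe fun z => hK _).trans (add_le_add ?_ ?_)
    · have hstep : ∀ t, variance (fun u => (F ∘ e) (t, u)) ν ≤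
          ∑ l : Fin m, ∫ u, variance (fun s => F (Function.update (Fin.cons t u) l.succ s))
            (μ l.succ) ∂ν := fun t => by
        have := ih (fun j => μ j.succ) (F := fun u => (F ∘ e) (t, u))
          (hFe.comp measurable_prodMk_left) (fun u => hK _)
        simpa only [Function.comp_apply, hcons, Fin.cons_update] using this
      have hvFe : Measurable fun t => variance (fun u => (F ∘ e) (t, u)) ν := by
        simp_rw [fun t => variance_eq_of_abs_le (μ := ν) (F := fun u => (F ∘ e) (t, u))
          (hFe.comp measurable_prodMk_left) fun u => hK _]
        exact (hFe.pow_const 2).stronglyMeasurable.integral_prod_right'.measurable.sub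
          (hFe.stronglyMeasurable.integral_prod_right'.measurable.pow_const 2)
      have hvK : ∀ t, |variance (fun u => (F ∘ e) (t, u)) ν| ≤ K ^ 2 := fun t => by
        rw [abs_of_nonneg (variance_nonneg _ _)]
        refine (variance_le_expectation_sq
          (hFe.comp measurable_prodMk_left).aestronglyMeasurable).trans ?_
        exact (le_abs_self _).trans (abs_integral_le_of_abs_le fun t => abs_sq_le (hK _))
      have hI : ∀ l : Fin m, Integrable (fun t => ∫ u, variance (fun s =>
          F (Function.update (Fin.cons t u) l.succ s)) (μ l.succ) ∂ν) (μ 0) := fun l => by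
        have hm := ((hvm l.succ).comp e.measurable).stronglyMeasurable.integral_prod_right' (ν := ν)
        simp only [Function.comp_apply, hcons] at hm
        exact integrable_of_abs_le hm.measurable fun t => abs_integral_le_of_abs_le fun u => hvb _ _
      refine (integral_mono (integrable_of_abs_le hvFe hvK)
        (integrable_finsetSum _ fun l _ => hI l) hstep).trans ?_
      rw [integral_finsetSum _ fun l _ => hI l]
      exact (Finset.sum_congr rfl fun l _ => (hint _ (hvm l.succ) _ (hvb l.succ)).symm).le
    · rw [hint _ (hvm 0) _ (hvb 0)]
      have he0 : ∀ (t s : ℝ) (u : Fin m → ℝ),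
          Function.update (Fin.cons t u : Fin (m + 1) → ℝ) 0 s = Fin.cons s u := fun t s u =>
        Fin.update_cons_zero _ _ _
      simp only [Function.comp_apply, hcons, he0]
      simp

end EfronStein

/-! ### Fourth moments of functions with small discrete gradient -/

section FourthMoment

variable {m : ℕ} {μ : Fin m → Measure ℝ} [∀ i, IsProbabilityMeasure (μ i)] {C : ℝ}

theorem ae_forall_abs_le (hC : ∀ l, ∀ᵐ t ∂μ l, |t| ≤ C) :
    ∀ᵐ x ∂Measure.pi μ, ∀ l, |x l| ≤ C :=
  ae_all_iff.2 fun l => (Measure.quasiMeasurePreserving_eval μ l).ae (hC l)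

theorem variance_le_integral_of_update (hC : ∀ l, ∀ᵐ t ∂μ l, |t| ≤ C) {G b : (Fin m → ℝ) → ℝ}
    (hG : Measurable G) {K : ℝ} (hK : ∀ x, |G x| ≤ K) (hb : Integrable b (Measure.pi μ))
    (hβ : ∀ x : Fin m → ℝ, (∀ l, |x l| ≤ C) → ∃ β : Fin m → ℝ,
      (∀ l t, |t| ≤ C → (G (Function.update x l t) - G x) ^ 2 ≤ β l) ∧ ∑ l, β l ≤ b x) :
    variance G (Measure.pi μ) ≤ ∫ x, b x ∂Measure.pi μ := by
  have hvb : ∀ l x, |variance (fun t => G (Function.update x l t)) (μ l)| ≤ K ^ 2 := fun l x => by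
    rw [abs_of_nonneg (variance_nonneg _ _)]
    refine (variance_le_expectation_sq
      (hG.comp (measurable_update x)).aestronglyMeasurable).trans ?_
    exact (le_abs_self _).trans (abs_integral_le_of_abs_le fun t => abs_sq_le (hK _))
  have hi : ∀ l, Integrable (fun x => variance (fun t => G (Function.update x l t)) (μ l))
      (Measure.pi μ) := fun l =>
    integrable_of_abs_le (measurable_variance_update hG hK l) (hvb l)
  refine (variance_pi_le μ hG hK).trans ?_
  rw [← integral_finsetSum _ fun l _ => hi l]
  refine integral_mono_ae (integrable_finsetSum _ fun l _ => hi l) hb ?_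
  filter_upwards [ae_forall_abs_le hC] with x hx
  obtain ⟨β, h1, h2⟩ := hβ x hx
  refine (Finset.sum_le_sum fun l _ => ?_).trans h2
  have hm : Measurable fun t => G (Function.update x l t) := hG.comp (measurable_update x)
  rw [← variance_sub_const hm.aestronglyMeasurable (G x)]
  refine (variance_le_expectation_sq (hm.sub_const _).aestronglyMeasurable).trans ?_
  have hd : ∀ t, |(G (Function.update x l t) - G x) ^ 2| ≤ (K + K) ^ 2 := fun t =>
    abs_sq_le ((abs_sub _ _).trans (add_le_add (hK _) (hK _)))
  calc _ = ∫ t, (G (Function.update x l t) - G x) ^ 2 ∂μ l := rfl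
    _ ≤ ∫ _t, β l ∂μ l := by
      refine integral_mono_ae (integrable_of_abs_le ((hm.sub_const _).pow_const 2) hd)
        (integrable_const _) ?_
      filter_upwards [hC l] with t ht using h1 l t ht
    _ = β l := by simp

/-- The Efron–Stein inequality applied to a function and then to the square of its deviation from
the mean. -/
theorem integral_pow_four_le (hC : ∀ l, ∀ᵐ t ∂μ l, |t| ≤ C) {F : (Fin m → ℝ) → ℝ}
    (hF : Measurable F) {K κ : ℝ} (hK : ∀ x, |F x| ≤ K)
    (hβ : ∀ x : Fin m → ℝ, (∀ l, |x l| ≤ C) → ∃ β : Fin m → ℝ,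
      (∀ l t, |t| ≤ C → (F (Function.update x l t) - F x) ^ 2 ≤ β l) ∧ ∑ l, β l ≤ κ) :
    ∫ x, (F x - ∫ y, F y ∂Measure.pi μ) ^ 4 ∂Measure.pi μ ≤ 11 * κ ^ 2 := by
  set e := ∫ y, F y ∂Measure.pi μ with he
  have heK : |e| ≤ K := abs_integral_le_of_abs_le hK
  have hdev : ∀ x, |F x - e| ≤ 2 * K := fun x =>
    (abs_sub _ _).trans (by linarith [hK x])
  have hm2 : Measurable fun x => (F x - e) ^ 2 := (hF.sub_const e).pow_const 2
  have hi2 : Integrable (fun x => (F x - e) ^ 2) (Measure.pi μ) :=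
    integrable_of_abs_le hm2 fun x => abs_sq_le (hdev x)
  have hv1 : ∫ x, (F x - e) ^ 2 ∂Measure.pi μ ≤ κ := by
    have := variance_le_integral_of_update hC hF hK (integrable_const κ) hβ
    rw [variance_eq_integral hF.aemeasurable] at this
    simpa using this
  have hv0 : 0 ≤ ∫ x, (F x - e) ^ 2 ∂Measure.pi μ := integral_nonneg fun x => sq_nonneg _
  have hib : Integrable (fun x => κ * (8 * (F x - e) ^ 2 + 2 * κ)) (Measure.pi μ) :=
    ((hi2.const_mul 8).add (integrable_const _)).const_mul κ
  have hv2 := variance_le_integral_of_update hC hm2 (fun x => abs_sq_le (hdev x)) hib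
    fun x hx => by
      obtain ⟨β, h1, h2⟩ := hβ x hx
      have hβ0 : ∀ l, 0 ≤ β l := fun l => (sq_nonneg _).trans (h1 l (x l) (hx l))
      refine ⟨fun l => β l * (8 * (F x - e) ^ 2 + 2 * κ), fun l t ht => ?_, ?_⟩
      · have h3 := h1 l t ht
        have h4 : β l ≤ κ := (Finset.single_le_sum (fun l _ => hβ0 l) (Finset.mem_univ l)).trans h2
        set y := F (Function.update x l t)
        have h5 : ((y - e) ^ 2 - (F x - e) ^ 2) ^ 2 =
            (y - F x) ^ 2 * ((y - F x) + 2 * (F x - e)) ^ 2 := by ring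
        rw [h5]
        refine mul_le_mul h3 ?_ (sq_nonneg _) (hβ0 l)
        nlinarith [sq_nonneg ((y - F x) - 2 * (F x - e))]
      · rw [← Finset.sum_mul]
        have : 0 ≤ κ := (Finset.sum_nonneg fun l _ => hβ0 l).trans h2
        exact mul_le_mul_of_nonneg_right h2 (by positivity)
  rw [variance_eq_of_abs_le hm2 fun x => abs_sq_le (hdev x), integral_const_mul,
    integral_add (hi2.const_mul 8) (integrable_const _), integral_const_mul] at hv2
  simp only [integral_const, probReal_univ, smul_eq_mul, one_mul] at hv2
  have h4 : ∀ x, (F x - e) ^ 4 = ((F x - e) ^ 2) ^ 2 := fun x => by ring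
  simp_rw [h4]
  nlinarith

end FourthMoment

/-! ### Concentration of linear spectral statistics -/

theorem continuous_sum_eigenvalues {X : Type*} [TopologicalSpace X] {n : ℕ}
    {A : X → Matrix (Fin n) (Fin n) ℝ} (hA : ∀ x, (A x).IsHermitian)
    (hc : ∀ i j, Continuous fun x => A x i j) {f : ℝ → ℝ} {K : ℝ}
    (hf : ∀ x y, |f x - f y| ≤ K * |x - y|) :
    Continuous fun x => ∑ i, f ((hA x).eigenvalues i) := by
  refine continuous_iff_continuousAt.2 fun x₀ => ?_
  have hlim : Tendsto (fun x => n * K ^ 2 * ∑ i, ∑ j, (A x i j - A x₀ i j) ^ 2) (𝓝 x₀) (𝓝 0) := by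
    have hcont : Continuous fun x => n * K ^ 2 * ∑ i, ∑ j, (A x i j - A x₀ i j) ^ 2 :=
      continuous_const.mul (continuous_finsetSum _ fun i _ => continuous_finsetSum _ fun j _ =>
        ((hc i j).sub continuous_const).pow 2)
    simpa using hcont.tendsto x₀
  have hsq : Tendsto (fun x => (∑ i, f ((hA x).eigenvalues i) -
      ∑ i, f ((hA x₀).eigenvalues i)) ^ 2) (𝓝 x₀) (𝓝 0) :=
    squeeze_zero (fun _ => sq_nonneg _) (fun x => sq_sum_eigenvalues_sub_le (hA x) (hA x₀) hf) hlim
  have habs := hsq.sqrt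
  simp_rw [Real.sqrt_sq_eq_abs, Real.sqrt_zero] at habs
  exact tendsto_sub_nhds_zero_iff.1 ((tendsto_zero_iff_abs_tendsto_zero _).2 habs)

/-- Extension of a finite sequence by zero. -/
def extend {m : ℕ} (z : Fin m → ℝ) (i : ℕ) : ℝ := if h : i < m then z ⟨i, h⟩ else 0

theorem extend_apply {m : ℕ} (z : Fin m → ℝ) (i : Fin m) : extend z i = z i := by
  simp [extend]

section Concentration

variable (𝓜 : Model) {n : ℕ}

/-- The factor of the entry of the matrix at a given place. -/
def Model.factor (n : ℕ) (p : Fin n × Fin n) : ℝ := (√(n * 𝓜.φ (mid n p.1) (mid n p.2)))⁻¹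

/-- The link at a place, as an index of the finitely many variables that occur in the matrix. -/
def Model.finLink (p : Fin n × Fin n) : Fin (2 * n) := ⟨𝓜.link p.1 p.2, 𝓜.link_lt p.1.2 p.2.2⟩

theorem Model.matrix_apply (x : ℕ → ℝ) (i j : Fin n) :
    𝓜.matrix n x i j = x (𝓜.finLink (i, j)) * 𝓜.factor n (i, j) := rfl

theorem Model.matrix_extend (x : ℕ → ℝ) :
    𝓜.matrix n (extend fun l : Fin (2 * n) => x l) = 𝓜.matrix n x := by
  ext i j
  rw [𝓜.matrix_apply, 𝓜.matrix_apply, extend_apply]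

theorem Model.mul_φ_pos (p : Fin n × Fin n) : 0 < n * 𝓜.φ (mid n p.1) (mid n p.2) := by
  have hn : n ≠ 0 := by have := p.1.2; omega
  have hn' : (0 : ℝ) < n := by positivity
  have h1 := le_norm_mid hn p.1
  have h2 : (0 : ℝ) < 1 / (2 * n) := by positivity
  have h3 := 𝓜.le_φ (mid_mem_Ioo p.1.2) (mid_mem_Ioo p.2.2)
  have h4 := norm_nonneg (mid n p.2 : UnitAddCircle)
  exact mul_pos hn' (by linarith)

theorem Model.IsBalanced.sum_factor_sq_le {𝓜 : Model} (hb : 𝓜.IsBalanced) (l : Fin (2 * n)) :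
    ∑ p with 𝓜.finLink p = l, 𝓜.factor n p ^ 2 ≤ 2 := by
  rcases (Finset.univ.filter fun p => 𝓜.finLink (n := n) p = l).eq_empty_or_nonempty with he | ⟨q, hq⟩
  · rw [he]; simp
  have hq' := (Finset.mem_filter.1 hq).2
  set N : ℝ := ((Finset.univ.filter fun p => 𝓜.finLink (n := n) p = l).card : ℝ) with hN
  have hN0 : 0 < N := by
    rw [hN]; exact_mod_cast Finset.card_pos.2 ⟨q, hq⟩
  have hle : ∀ p ∈ Finset.univ.filter (fun p => 𝓜.finLink (n := n) p = l),
      𝓜.factor n p ^ 2 ≤ 2 / N := fun p hp => by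
    have hpos := 𝓜.mul_φ_pos p
    have h1 := hb n p.1 p.2
    have h2 : (Finset.univ.filter fun r : Fin n × Fin n =>
        𝓜.link r.1 r.2 = 𝓜.link p.1 p.2) = Finset.univ.filter fun r => 𝓜.finLink r = l := by
      refine Finset.filter_congr fun r _ => ?_
      rw [← (Finset.mem_filter.1 hp).2, Fin.ext_iff]
      rfl
    rw [h2] at h1
    rw [Model.factor, inv_pow, Real.sq_sqrt hpos.le, inv_le_comm₀ hpos (by positivity), inv_div]
    linarith
  refine (Finset.sum_le_sum hle).trans ?_
  rw [Finset.sum_const, nsmul_eq_mul, ← hN]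
  field_simp
  exact le_rfl

theorem Model.sum_sum_eq_sum_fiber (g : Fin n × Fin n → ℝ) :
    ∑ i, ∑ j, g (i, j) = ∑ l, ∑ p with 𝓜.finLink p = l, g p := by
  rw [Finset.sum_fiberwise, Fintype.sum_prod_type]

variable {𝓜} in
theorem Model.IsBalanced.sum_sq_matrix_le (hb : 𝓜.IsBalanced) {x : ℕ → ℝ} {C : ℝ}
    (hx : ∀ l, |x l| ≤ C) : ∑ i, ∑ j, 𝓜.matrix n x i j ^ 2 ≤ 4 * C ^ 2 * n := by
  simp_rw [𝓜.matrix_apply]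
  rw [𝓜.sum_sum_eq_sum_fiber fun p => (x (𝓜.finLink p) * 𝓜.factor n p) ^ 2]
  calc _ ≤ ∑ _l : Fin (2 * n), C ^ 2 * 2 := Finset.sum_le_sum fun l _ => by
        refine le_trans ?_ (mul_le_mul_of_nonneg_left (hb.sum_factor_sq_le l) (sq_nonneg C))
        rw [Finset.mul_sum]
        refine Finset.sum_le_sum fun p _ => ?_
        rw [mul_pow]
        exact mul_le_mul_of_nonneg_right
          ((le_abs_self _).trans (abs_sq_le (hx _))) (sq_nonneg _)
    _ = _ := by simp; ring

theorem Model.matrix_update_sub (z : Fin (2 * n) → ℝ) (l : Fin (2 * n)) (t : ℝ) (i j : Fin n) :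
    𝓜.matrix n (extend (Function.update z l t)) i j - 𝓜.matrix n (extend z) i j =
      if 𝓜.finLink (i, j) = l then (t - z l) * 𝓜.factor n (i, j) else 0 := by
  rw [𝓜.matrix_apply, 𝓜.matrix_apply, extend_apply, extend_apply]
  split_ifs with h
  · subst h; rw [Function.update_self]; ring
  · rw [Function.update_of_ne h, sub_self]

/-- Changing one variable changes a smooth linear spectral statistic little; the squares of the
changes for the different variables add up to at most a constant times the order, because the
variables occupy disjoint sets of places. -/
theorem Model.IsBalanced.exists_gradient_bound {𝓜 : Model} (hb : 𝓜.IsBalanced)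
    (hA : ∀ y, (𝓜.matrix n y).IsHermitian) {f f' : ℝ → ℝ} {K L C : ℝ}
    (hL : ∀ x, |f' x| ≤ L) (hf : ∀ x y, |f y - f x - f' x * (y - x)| ≤ K * (y - x) ^ 2)
    {z : Fin (2 * n) → ℝ} (hz : ∀ l, |z l| ≤ C) :
    ∃ β : Fin (2 * n) → ℝ, (∀ l t, |t| ≤ C →
      (∑ i, f ((hA (extend (Function.update z l t))).eigenvalues i) -
        ∑ i, f ((hA (extend z)).eigenvalues i)) ^ 2 ≤ β l) ∧
      ∑ l, β l ≤ n * (16 * C ^ 2 * L ^ 2 + 256 * K ^ 2 * C ^ 4) := by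
  obtain ⟨G, hG, hexp⟩ := exists_gradient (hA (extend z)) hL hf
  have hK0 : 0 ≤ K := by have := (abs_nonneg _).trans (hf 0 1); simpa using this
  set g : Fin (2 * n) → ℝ := fun l => ∑ p : Fin n × Fin n with 𝓜.finLink p = l, G p.1 p.2 ^ 2
    with hg
  have hg0 : ∀ l, 0 ≤ g l := fun l => Finset.sum_nonneg fun _ _ => sq_nonneg _
  refine ⟨fun l => 2 * (8 * C ^ 2 * g l + K ^ 2 * (64 * C ^ 4)), fun l t ht => ?_, ?_⟩
  · have hd : (t - z l) ^ 2 ≤ 4 * C ^ 2 := by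
      have : |t - z l| ≤ 2 * C := (abs_sub _ _).trans (by linarith [hz l])
      calc (t - z l) ^ 2 ≤ (2 * C) ^ 2 := (le_abs_self _).trans (abs_sq_le this)
        _ = _ := by ring
    set A := 𝓜.matrix n (extend z) with hAdef
    set B := 𝓜.matrix n (extend (Function.update z l t)) with hBdef
    have hBA : ∀ i j, B i j - A i j =
        if 𝓜.finLink (i, j) = l then (t - z l) * 𝓜.factor n (i, j) else 0 :=
      𝓜.matrix_update_sub z l t
    have hfrob : ∑ i, ∑ j, (A i j - B i j) ^ 2 ≤ 8 * C ^ 2 := by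
      have e : ∀ i j, (A i j - B i j) ^ 2 =
          if 𝓜.finLink (i, j) = l then (t - z l) ^ 2 * 𝓜.factor n (i, j) ^ 2 else 0 :=
        fun i j => by
          rw [← neg_sub, neg_sq, hBA]
          split_ifs <;> ring
      simp_rw [e]
      rw [← Fintype.sum_prod_type' fun i j =>
        if 𝓜.finLink (i, j) = l then (t - z l) ^ 2 * 𝓜.factor n (i, j) ^ 2 else 0,
        ← Finset.sum_filter, ← Finset.mul_sum]
      have := hb.sum_factor_sq_le l
      have h0 : 0 ≤ ∑ p with 𝓜.finLink p = l, 𝓜.factor n p ^ 2 :=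
        Finset.sum_nonneg fun _ _ => sq_nonneg _
      nlinarith [sq_nonneg C]
    have htr : (G * (B - A)).trace ^ 2 ≤ 8 * C ^ 2 * g l := by
      have e : (G * (B - A)).trace =
          (t - z l) * ∑ p with 𝓜.finLink p = l, G p.1 p.2 * 𝓜.factor n p := by
        have hsymm : ∀ i j, (B - A) j i = (B - A) i j := fun i j => by
          have := ((hA (extend (Function.update z l t))).sub (hA (extend z))).apply i j
          simpa using this
        simp only [Matrix.trace, Matrix.diag, Matrix.mul_apply]
        simp_rw [fun i j => hsymm i j, Matrix.sub_apply, hBA]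
        rw [← Fintype.sum_prod_type' fun i j =>
          G i j * if 𝓜.finLink (i, j) = l then (t - z l) * 𝓜.factor n (i, j) else 0]
        simp_rw [mul_ite, mul_zero]
        rw [← Finset.sum_filter, Finset.mul_sum]
        exact Finset.sum_congr rfl fun p _ => by ring
      have hcs := Finset.sum_mul_sq_le_sq_mul_sq
        (Finset.univ.filter fun p => 𝓜.finLink (n := n) p = l) (fun p => G p.1 p.2)
        (𝓜.factor n)
      rw [e, mul_pow]
      have h2 : (∑ p with 𝓜.finLink p = l, G p.1 p.2 * 𝓜.factor n p) ^ 2 ≤ g l * 2 :=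
        hcs.trans (mul_le_mul_of_nonneg_left (hb.sum_factor_sq_le l) (hg0 l))
      calc _ ≤ 4 * C ^ 2 * (g l * 2) := mul_le_mul hd h2 (sq_nonneg _) (by positivity)
        _ = _ := by ring
    have hmain := hexp B (hA _)
    set S := ∑ i, f ((hA (extend (Function.update z l t))).eigenvalues i) -
      ∑ i, f ((hA (extend z)).eigenvalues i) with hS
    have hmain' : |S - (G * (B - A)).trace| ≤ K * (8 * C ^ 2) :=
      hmain.trans (mul_le_mul_of_nonneg_left hfrob hK0)
    have h3 : (S - (G * (B - A)).trace) ^ 2 ≤ (K * (8 * C ^ 2)) ^ 2 :=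
      (le_abs_self _).trans (abs_sq_le hmain')
    calc S ^ 2 ≤ 2 * ((G * (B - A)).trace ^ 2 + (S - (G * (B - A)).trace) ^ 2) := by
          nlinarith [sq_nonneg (S - 2 * (G * (B - A)).trace)]
      _ ≤ 2 * (8 * C ^ 2 * g l + (K * (8 * C ^ 2)) ^ 2) := by linarith
      _ = _ := by ring
  · have hsum : ∑ l, g l ≤ n * L ^ 2 := by
      rw [← 𝓜.sum_sum_eq_sum_fiber fun p => G p.1 p.2 ^ 2]
      exact hG
    have e : ∑ l : Fin (2 * n), 2 * (8 * C ^ 2 * g l + K ^ 2 * (64 * C ^ 4)) =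
        16 * C ^ 2 * ∑ l, g l + n * (256 * K ^ 2 * C ^ 4) := by
      rw [← Finset.mul_sum, Finset.sum_add_distrib, ← Finset.mul_sum]
      simp
      ring
    rw [e]
    nlinarith [mul_le_mul_of_nonneg_left hsum (by positivity : 0 ≤ 16 * C ^ 2)]

end Concentration

/-! ### Fluctuations and means of linear spectral statistics -/

theorem esd_congr {n : ℕ} [NeZero n] {A B : Matrix (Fin n) (Fin n) ℝ} (hAB : A = B)
    (hA : A.IsHermitian) (hB : B.IsHermitian) : esd A hA = esd B hB := by
  subst hAB; rfl

/-- A function bounded by `1`, with bounded and Lipschitz derivative. -/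
structure IsSmoothTest (f f' : ℝ → ℝ) (L M : ℝ) : Prop where
  abs_le : ∀ x, |f x| ≤ 1
  hasDerivAt : ∀ x, HasDerivAt f (f' x) x
  abs_deriv_le : ∀ x, |f' x| ≤ L
  lipschitz_deriv : ∀ x y, |f' x - f' y| ≤ M * |x - y|

theorem IsSmoothTest.lipschitz {f f' : ℝ → ℝ} {L M : ℝ} (hf : IsSmoothTest f f' L M) (x y : ℝ) :
    |f x - f y| ≤ L * |x - y| :=
  Convex.norm_image_sub_le_of_norm_hasDerivWithin_le (s := Set.univ) (f := f) (f' := f')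
    (fun z _ => (hf.hasDerivAt z).hasDerivWithinAt) (fun z _ => hf.abs_deriv_le z) convex_univ
    (Set.mem_univ y) (Set.mem_univ x)

theorem IsSmoothTest.taylor {f f' : ℝ → ℝ} {L M : ℝ} (hf : IsSmoothTest f f' L M) (x y : ℝ) :
    |f y - f x - f' x * (y - x)| ≤ M * (y - x) ^ 2 := by
  have hM : 0 ≤ M := by
    have := (abs_nonneg _).trans (hf.lipschitz_deriv 0 1)
    simpa using this
  have h := Convex.norm_image_sub_le_of_norm_hasDerivWithin_le (s := Set.uIcc x y)
    (f := fun s => f s - f' x * s) (f' := fun s => f' s - f' x * 1) (C := M * |y - x|)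
    (fun z _ => ((hf.hasDerivAt z).sub ((hasDerivAt_id z).const_mul _)).hasDerivWithinAt)
    (fun z hz => by
      rw [mul_one, Real.norm_eq_abs]
      refine (hf.lipschitz_deriv z x).trans (mul_le_mul_of_nonneg_left ?_ hM)
      exact Set.abs_sub_left_of_mem_uIcc hz)
    (convex_uIcc x y) Set.left_mem_uIcc Set.right_mem_uIcc
  rw [Real.norm_eq_abs, Real.norm_eq_abs, mul_assoc, ← sq, sq_abs] at h
  convert h using 2
  ring

theorem isSmoothTest_cos (t : ℝ) :
    IsSmoothTest (fun y => Real.cos (t * y)) (fun y => -Real.sin (t * y) * t) |t| (t ^ 2) where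
  abs_le x := Real.abs_cos_le_one _
  hasDerivAt x := by
    simpa using (((hasDerivAt_id x).const_mul t).cos)
  abs_deriv_le x := by
    rw [abs_mul, abs_neg]
    exact mul_le_of_le_one_left (abs_nonneg t) (Real.abs_sin_le_one _)
  lipschitz_deriv x y := by
    rw [← sub_mul, abs_mul, ← sq_abs t, sq, mul_right_comm]
    refine mul_le_mul_of_nonneg_right ?_ (abs_nonneg t)
    rw [neg_sub_neg, abs_sub_comm, ← abs_mul, mul_sub]
    exact Real.abs_sin_sub_sin_le _ _

theorem isSmoothTest_sin (t : ℝ) :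
    IsSmoothTest (fun y => Real.sin (t * y)) (fun y => Real.cos (t * y) * t) |t| (t ^ 2) where
  abs_le x := Real.abs_sin_le_one _
  hasDerivAt x := by
    simpa using (((hasDerivAt_id x).const_mul t).sin)
  abs_deriv_le x := by
    rw [abs_mul]
    exact mul_le_of_le_one_left (abs_nonneg t) (Real.abs_cos_le_one _)
  lipschitz_deriv x y := by
    rw [← sub_mul, abs_mul, ← sq_abs t, sq, mul_right_comm]
    refine mul_le_mul_of_nonneg_right ?_ (abs_nonneg t)
    rw [← abs_mul, mul_sub]
    exact Real.abs_cos_sub_cos_le _ _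

/-- Summable fourth moments imply almost sure convergence. -/
theorem ae_tendsto_zero_of_integral_pow_four_le {Ω : Type*} [MeasurableSpace Ω] {P : Measure Ω}
    {Y : ℕ → Ω → ℝ} (hm : ∀ n, Measurable (Y n)) (hi : ∀ n, Integrable (fun ω => Y n ω ^ 4) P)
    {c : ℝ} (hY : ∀ n : ℕ, ∫ ω, Y n ω ^ 4 ∂P ≤ c * (1 / (n + 1 : ℝ) ^ 2)) :
    ∀ᵐ ω ∂P, Tendsto (fun n => Y n ω) atTop (𝓝 0) := by
  have hc : 0 ≤ c := by
    have := (integral_nonneg fun ω => (by positivity : (0 : ℝ) ≤ Y 0 ω ^ 4)).trans (hY 0)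
    simpa using this
  have hsum : Summable fun n : ℕ => c * (1 / (n + 1 : ℝ) ^ 2) := by
    have := (summable_nat_add_iff 1).2 (Real.summable_one_div_nat_pow.2 (one_lt_two))
    simp only [Nat.cast_add, Nat.cast_one] at this
    exact this.mul_left c
  have hfin : ∫⁻ ω, ∑' n, ENNReal.ofReal (Y n ω ^ 4) ∂P < ⊤ := by
    rw [lintegral_tsum fun n => ((hm n).pow_const 4).ennreal_ofReal.aemeasurable]
    refine lt_of_le_of_lt (ENNReal.tsum_le_tsum (g := fun n : ℕ =>
      ENNReal.ofReal (c * (1 / (n + 1 : ℝ) ^ 2))) fun n => ?_) ?_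
    · rw [← ofReal_integral_eq_lintegral_ofReal (hi n)
        (Eventually.of_forall fun ω => by positivity)]
      exact ENNReal.ofReal_le_ofReal (hY n)
    · rw [← ENNReal.ofReal_tsum_of_nonneg (fun n => by positivity) hsum]
      exact ENNReal.ofReal_lt_top
  filter_upwards [ae_lt_top (Measurable.tsum fun n => ((hm n).pow_const 4).ennreal_ofReal)
    hfin.ne] with ω hω
  have h4 := ENNReal.tendsto_atTop_zero_of_tsum_ne_top hω.ne
  have h4' : Tendsto (fun n => Y n ω ^ 4) atTop (𝓝 0) := by
    have := (ENNReal.tendsto_toReal ENNReal.zero_ne_top).comp h4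
    refine (this.congr fun n => ?_)
    exact ENNReal.toReal_ofReal (by positivity)
  have h2 : Tendsto (fun n => |Y n ω|) atTop (𝓝 0) := by
    have := h4'.sqrt.sqrt
    simp only [Real.sqrt_zero] at this
    refine this.congr fun n => ?_
    rw [show Y n ω ^ 4 = (Y n ω ^ 2) ^ 2 by ring, Real.sqrt_sq (sq_nonneg _), Real.sqrt_sq_eq_abs]
  exact (tendsto_zero_iff_abs_tendsto_zero _).2 h2

section Statistics

variable {𝓜 : Model} {Ω : Type*} [MeasurableSpace Ω] {P : Measure Ω} {x : ℕ → Ω → ℝ} {n : ℕ}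

theorem measurable_restrict (hx : ∀ i, Measurable (x i)) (m : ℕ) :
    Measurable fun (ω : Ω) (l : Fin m) => x l ω :=
  measurable_pi_lambda _ fun l => hx l

theorem Model.continuous_integral_esd [NeZero n] (hA : ∀ y, (𝓜.matrix n y).IsHermitian)
    {f : ℝ → ℝ} {K : ℝ} (hf : ∀ x y, |f x - f y| ≤ K * |x - y|) :
    Continuous fun z : Fin (2 * n) → ℝ =>
      ∫ y, f y ∂(esd (𝓜.matrix n (extend z)) (hA _) : Measure ℝ) := by
  simp_rw [fun z : Fin (2 * n) → ℝ => integral_esd (hA (extend z)) f]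
  refine (continuous_sum_eigenvalues (fun z => hA (extend z)) (fun i j => ?_) hf).const_smul
    (1 / n : ℝ)
  simp_rw [𝓜.matrix_apply, extend_apply]
  fun_prop

theorem Model.measurable_integral_esd [NeZero n] (hx : ∀ i, Measurable (x i))
    (hA : ∀ y, (𝓜.matrix n y).IsHermitian) {f : ℝ → ℝ} {K : ℝ}
    (hf : ∀ x y, |f x - f y| ≤ K * |x - y|) :
    Measurable fun ω => ∫ y, f y ∂(esd (𝓜.matrix n fun i => x i ω) (hA _) : Measure ℝ) := by
  have := (𝓜.continuous_integral_esd hA hf).measurable.comp (measurable_restrict hx (2 * n))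
  convert this using 2 with ω
  rw [Function.comp_apply, esd_congr (𝓜.matrix_extend fun i => x i ω) (hA _) (hA _)]

theorem Model.measurable_esd [NeZero n] (hx : ∀ i, Measurable (x i))
    (hA : ∀ y, (𝓜.matrix n y).IsHermitian) :
    Measurable fun ω => (esd (𝓜.matrix n fun i => x i ω) (hA _) : Measure ℝ) := by
  refine Measurable.measure_of_isPiSystem_of_isProbabilityMeasure
    (by rw [BorelSpace.measurable_eq (α := ℝ), borel_eq_generateFrom_isClosed])
    isPiSystem_isClosed fun F hF => ?_
  have hδ : ∀ k : ℕ, (0 : ℝ) < 1 / (k + 1) := fun k => by positivity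
  have hreal : Measurable fun ω => (esd (𝓜.matrix n fun i => x i ω) (hA _) : Measure ℝ).real F := by
    refine measurable_of_tendsto_metrizable (fun k => ?_) (tendsto_pi_nhds.2 fun ω =>
      tendsto_integral_thickenedIndicator_of_isClosed
        (esd (𝓜.matrix n fun i => x i ω) (hA _) : Measure ℝ) hF hδ
        tendsto_one_div_add_atTop_nhds_zero_nat)
    refine 𝓜.measurable_integral_esd hx hA (K := ((1 / (k + 1 : ℝ)).toNNReal⁻¹ : NNReal))
      fun y y' => ?_
    have := (lipschitzWith_thickenedIndicator (hδ k) F).dist_le_mul y y'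
    rwa [NNReal.dist_eq, Real.dist_eq] at this
  simp_rw [fun ω => (ofReal_measureReal (μ := (esd (𝓜.matrix n fun i => x i ω) (hA _) :
    Measure ℝ)) (s := F)).symm]
  exact hreal.ennreal_ofReal

theorem abs_integral_esd_le [NeZero n] {A : Matrix (Fin n) (Fin n) ℝ} (hA : A.IsHermitian)
    {f : ℝ → ℝ} {K : ℝ} (hf : ∀ x, |f x| ≤ K) : |∫ y, f y ∂(esd A hA : Measure ℝ)| ≤ K :=
  abs_integral_le_of_abs_le hf

variable [IsProbabilityMeasure P]

theorem IsBoundedIIDInput.map_restrict (hx : IsBoundedIIDInput P x) (m : ℕ) :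
    P.map (fun (ω : Ω) (l : Fin m) => x l ω) = Measure.pi fun l : Fin m => P.map (x l) := by
  have hind : iIndepFun (fun l : Fin m => x l) P := hx.indep.precomp Fin.val_injective
  exact (iIndepFun_iff_map_fun_eq_pi_map (f := fun l : Fin m => x l)
    fun l => (hx.measurable l).aemeasurable).1 hind

/-- The fluctuations of a smooth linear spectral statistic vanish almost surely. -/
theorem Model.ae_tendsto_integral_esd_sub (hb : 𝓜.IsBalanced) (hx : IsBoundedIIDInput P x)
    (hA : ∀ n y, (𝓜.matrix n y).IsHermitian) {f f' : ℝ → ℝ} {L M : ℝ}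
    (hf : IsSmoothTest f f' L M) :
    ∀ᵐ ω ∂P, Tendsto (fun n : ℕ =>
      ∫ y, f y ∂(esd (𝓜.matrix (n + 1) fun i => x i ω) (hA _ _) : Measure ℝ) -
      ∫ ω', ∫ y, f y ∂(esd (𝓜.matrix (n + 1) fun i => x i ω') (hA _ _) : Measure ℝ) ∂P)
      atTop (𝓝 0) := by
  obtain ⟨C, hC⟩ := hx.bounded
  set F : (n : ℕ) → (Fin (2 * (n + 1)) → ℝ) → ℝ := fun n z =>
    ∫ y, f y ∂(esd (𝓜.matrix (n + 1) (extend z)) (hA _ _) : Measure ℝ) with hF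
  have hFx : ∀ n ω, ∫ y, f y ∂(esd (𝓜.matrix (n + 1) fun i => x i ω) (hA _ _) : Measure ℝ) =
      F n fun l => x l ω := fun n ω => by
    simp only [hF]
    rw [esd_congr (𝓜.matrix_extend fun i => x i ω) (hA _ _) (hA _ _)]
  have hFm : ∀ n, Measurable (F n) := fun n =>
    (𝓜.continuous_integral_esd (hA (n + 1)) hf.lipschitz).measurable
  have hF1 : ∀ n z, |F n z| ≤ 1 := fun n z => abs_integral_esd_le _ hf.abs_le
  have hZ : ∀ n : ℕ, Measurable fun (ω : Ω) (l : Fin (2 * (n + 1))) => x l ω := fun n =>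
    measurable_restrict hx.measurable _
  simp_rw [hFx]
  have hYm : ∀ n, Measurable fun ω => F n (fun l => x l ω) - ∫ ω', F n (fun l => x l ω') ∂P :=
    fun n => ((hFm n).comp (hZ n)).sub_const _
  have hY2 : ∀ n ω, |F n (fun l => x l ω) - ∫ ω', F n (fun l => x l ω') ∂P| ≤ 2 := fun n ω =>
    (abs_sub _ _).trans (by
      have h1 := hF1 n fun l => x l ω
      have h2 := abs_integral_le_of_abs_le (μ := P) fun ω' => hF1 n fun l => x l ω'
      linarith)
  refine ae_tendsto_zero_of_integral_pow_four_le hYm (fun n => ?_)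
    (c := 11 * (16 * C ^ 2 * L ^ 2 + 256 * M ^ 2 * C ^ 4) ^ 2) fun n => ?_
  · refine integrable_of_abs_le ((hYm n).pow_const 4) (K := 2 ^ 4) fun ω => ?_
    rw [abs_pow]
    exact pow_le_pow_left₀ (abs_nonneg _) (hY2 n ω) 4
  · have hpr : ∀ l : Fin (2 * (n + 1)), IsProbabilityMeasure (P.map (x l)) := fun l =>
      Measure.isProbabilityMeasure_map (hx.measurable l).aemeasurable
    have hbd : ∀ l : Fin (2 * (n + 1)), ∀ᵐ t ∂P.map (x l), |t| ≤ C := fun l =>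
      (ae_map_iff (hx.measurable l).aemeasurable (measurableSet_le (by fun_prop) (by fun_prop))).2
        (hC l)
    have hmain := integral_pow_four_le hbd (hFm n) (hF1 n)
      (κ := (16 * C ^ 2 * L ^ 2 + 256 * M ^ 2 * C ^ 4) / (n + 1)) fun z hz => by
        obtain ⟨β, h1, h2⟩ := hb.exists_gradient_bound (hA (n + 1)) hf.abs_deriv_le hf.taylor hz
        refine ⟨fun l => (1 / ((n + 1 : ℕ) : ℝ)) ^ 2 * β l, fun l t ht => ?_, ?_⟩
        · simp only [hF]
          rw [integral_esd, integral_esd, ← smul_sub, smul_eq_mul, mul_pow]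
          exact mul_le_mul_of_nonneg_left (h1 l t ht) (sq_nonneg _)
        · rw [← Finset.mul_sum]
          refine (mul_le_mul_of_nonneg_left h2 (sq_nonneg _)).trans_eq ?_
          push_cast
          field_simp
    rw [← hx.map_restrict, integral_map (hZ n).aemeasurable
      (((hFm n).sub_const _).pow_const 4).aestronglyMeasurable,
      integral_map (hZ n).aemeasurable (hFm n).aestronglyMeasurable] at hmain
    refine hmain.trans_eq ?_
    field_simp

/-- The random empirical spectral distribution as a kernel. -/
def Model.esdKernel (𝓜 : Model) (hx : ∀ i, Measurable (x i)) (n : ℕ) [NeZero n]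
    (hA : ∀ y, (𝓜.matrix n y).IsHermitian) : Kernel Ω ℝ :=
  ⟨fun ω => (esd (𝓜.matrix n fun i => x i ω) (hA _) : Measure ℝ), 𝓜.measurable_esd hx hA⟩

instance (𝓜 : Model) (hx : ∀ i, Measurable (x i)) (n : ℕ) [NeZero n]
    (hA : ∀ y, (𝓜.matrix n y).IsHermitian) : IsMarkovKernel (𝓜.esdKernel hx n hA) :=
  ⟨fun ω => (esd (𝓜.matrix n fun i => x i ω) (hA _)).2⟩

/-- The mean of the empirical spectral distribution. -/
def Model.meanEsd (𝓜 : Model) (P : Measure Ω) [IsProbabilityMeasure P]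
    (hx : ∀ i, Measurable (x i)) (n : ℕ) [NeZero n]
    (hA : ∀ y, (𝓜.matrix n y).IsHermitian) : ProbabilityMeasure ℝ :=
  ⟨(𝓜.esdKernel hx n hA) ∘ₘ P, inferInstance⟩

theorem integrable_esd [NeZero n] {A : Matrix (Fin n) (Fin n) ℝ} (hA : A.IsHermitian)
    {E : Type*} [NormedAddCommGroup E] (g : ℝ → E) :
    Integrable g (esd A hA : Measure ℝ) := by
  have : (esd A hA : Measure ℝ) = (n : ENNReal)⁻¹ • ∑ i, Measure.dirac (hA.eigenvalues i) := rfl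
  rw [this]
  refine Integrable.smul_measure ?_ (by simp [NeZero.ne n])
  exact integrable_finsetSum_measure.2 fun i _ => integrable_dirac (by simp)

end Statistics

/-! ### The limiting spectral distribution -/

section Mean

variable (𝓜 : Model) {Ω : Type*} [MeasurableSpace Ω] {P : Measure Ω} [IsProbabilityMeasure P]
  {x : ℕ → Ω → ℝ} (n : ℕ) [NeZero n]

theorem Model.integral_meanEsd (hx : ∀ i, Measurable (x i))
    (hA : ∀ y, (𝓜.matrix n y).IsHermitian) {g : ℝ → ℝ}
    (hg : Integrable g (𝓜.meanEsd P hx n hA : Measure ℝ)) :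
    ∫ y, g y ∂(𝓜.meanEsd P hx n hA : Measure ℝ) =
      ∫ ω, ∫ y, g y ∂(esd (𝓜.matrix n fun i => x i ω) (hA _) : Measure ℝ) ∂P := by
  change Integrable g (𝓜.esdKernel hx n hA ∘ₘ P) at hg
  change ∫ y, g y ∂(𝓜.esdKernel hx n hA ∘ₘ P) = _
  rw [Measure.comp_eq_comp_const_apply] at hg ⊢
  rw [Kernel.integral_comp hg]
  rfl

theorem Model.integrable_pow_meanEsd (hx : IsBoundedIIDInput P x)
    (hA : ∀ y, (𝓜.matrix n y).IsHermitian) (h : ℕ) :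
    Integrable (fun y : ℝ => y ^ h) (𝓜.meanEsd P hx.measurable n hA : Measure ℝ) := by
  refine integrable_pow_of_even ?_
  change Integrable _ (𝓜.esdKernel hx.measurable n hA ∘ₘ P)
  rw [Measure.integrable_comp_iff (by fun_prop)]
  refine ⟨Eventually.of_forall fun ω => integrable_esd (hA _) _, ?_⟩
  refine (𝓜.integrable_esdMoment hx n hA (2 * h)).congr (Eventually.of_forall fun ω => ?_)
  simp only [esdMoment]
  refine integral_congr_ae (Eventually.of_forall fun y => ?_)
  exact (Real.norm_of_nonneg ((even_two_mul h).pow_nonneg y)).symm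

theorem Model.integral_pow_meanEsd (hx : IsBoundedIIDInput P x)
    (hA : ∀ y, (𝓜.matrix n y).IsHermitian) (h : ℕ) :
    ∫ y, y ^ h ∂(𝓜.meanEsd P hx.measurable n hA : Measure ℝ) =
      ∫ ω, esdMoment h (𝓜.matrix n fun i => x i ω) (hA _) ∂P :=
  𝓜.integral_meanEsd n hx.measurable hA (𝓜.integrable_pow_meanEsd n hx hA h)

end Mean

/-- The signs that occur in circuits either are the standard ones or do not close up. -/
def Model.IsRigid (𝓜 : Model) : Prop :=
  ∀ k, ∀ w ∈ pairWords k, ∀ ε : Fin (2 * k) → ℤˣ, ε ≠ (fun _ => 𝓜.ε₀) →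
    (∀ n, 𝓜.circuits n (firstOcc w) ε = ∅) ∨
      ∃ i, firstOcc w i = i ∧ closeCoeff 𝓜.κ ε w i ≠ 0

/-- The limiting moments of a model. -/
def Model.limitMoment (𝓜 : Model) (h : ℕ) : ℝ := if Even h then 𝓜.moment (h / 2) else 0

theorem Model.limitMoment_even (𝓜 : Model) (k : ℕ) : 𝓜.limitMoment (2 * k) = 𝓜.moment k := by
  rw [Model.limitMoment, if_pos (even_two_mul k), Nat.mul_div_cancel_left k two_pos]

theorem Model.limitMoment_odd (𝓜 : Model) (k : ℕ) : 𝓜.limitMoment (2 * k + 1) = 0 :=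
  if_neg (Nat.not_even_iff_odd.2 (odd_two_mul_add_one k))

section Limit

variable {𝓜 : Model} {Ω : Type*} [MeasurableSpace Ω] {P : Measure Ω} [IsProbabilityMeasure P]
  {x : ℕ → Ω → ℝ}

theorem Model.tendsto_integral_esdMoment (hr : 𝓜.IsRigid) (hx : IsBoundedIIDInput P x)
    (hA : ∀ n y, (𝓜.matrix n y).IsHermitian) (h : ℕ) :
    Tendsto (fun n : ℕ => ∫ ω, esdMoment h (𝓜.matrix (n + 1) fun i => x i ω) (hA _ _) ∂P)
      atTop (𝓝 (𝓜.limitMoment h)) := by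
  rcases Nat.even_or_odd' h with ⟨k, rfl | rfl⟩
  · rw [𝓜.limitMoment_even]
    exact 𝓜.tendsto_integral_esdMoment_even hx hA k (hr k)
  · rw [𝓜.limitMoment_odd]
    exact 𝓜.tendsto_integral_esdMoment_odd hx hA k

theorem Model.tendsto_integral_pow_meanEsd (hr : 𝓜.IsRigid) (hx : IsBoundedIIDInput P x)
    (hA : ∀ n y, (𝓜.matrix n y).IsHermitian) (h : ℕ) :
    Tendsto (fun n : ℕ => ∫ y, y ^ h ∂(𝓜.meanEsd P hx.measurable (n + 1) (hA _) : Measure ℝ))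
      atTop (𝓝 (𝓜.limitMoment h)) := by
  simp_rw [fun n : ℕ => 𝓜.integral_pow_meanEsd (n + 1) hx (hA _) h]
  exact 𝓜.tendsto_integral_esdMoment hr hx hA h

theorem Model.tendsto_meanEsd (hr : 𝓜.IsRigid) (hx : IsBoundedIIDInput P x)
    (hA : ∀ n y, (𝓜.matrix n y).IsHermitian) {ν : ProbabilityMeasure ℝ}
    (hν : ∀ h : ℕ, Integrable (fun y : ℝ => y ^ h) (ν : Measure ℝ) ∧
      ∫ y, y ^ h ∂(ν : Measure ℝ) = 𝓜.limitMoment h) :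
    Tendsto (fun n : ℕ => 𝓜.meanEsd P hx.measurable (n + 1) (hA _)) atTop (𝓝 ν) :=
  tendsto_of_tendsto_moments (A := 4 * Real.exp 2) (C := 32 * Real.exp 2)
    (fun n h => 𝓜.integrable_pow_meanEsd (n + 1) hx (hA _) h)
    (𝓜.tendsto_integral_pow_meanEsd hr hx hA) (by positivity)
    (fun k => by rw [𝓜.limitMoment_even]; exact 𝓜.moment_le k) hν

theorem Model.IsBalanced.esdMoment_two_le (hb : 𝓜.IsBalanced) {n : ℕ} [NeZero n] {y : ℕ → ℝ}
    {C : ℝ} (hy : ∀ l, |y l| ≤ C) (hA : (𝓜.matrix n y).IsHermitian) :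
    esdMoment 2 (𝓜.matrix n y) hA ≤ 4 * C ^ 2 := by
  have hn : (0 : ℝ) < n := by exact_mod_cast NeZero.pos n
  have htr : (𝓜.matrix n y).transpose = 𝓜.matrix n y := by
    simpa [Matrix.conjTranspose_eq_transpose_of_trivial] using hA.eq
  rw [esdMoment_eq, sq]
  nth_rewrite 2 [← htr]
  rw [trace_mul_transpose_eq]
  have := hb.sum_sq_matrix_le (n := n) hy
  rw [one_div, inv_mul_le_iff₀ hn]
  linarith

/-- The dependence of the integrals of `φ (t * ·)` on `t` is controlled by the second moment. -/
theorem abs_integral_dilate_sub_le {ρ : Measure ℝ} [IsProbabilityMeasure ρ] {φ : ℝ → ℝ}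
    (hφ : ∀ a b, |φ a - φ b| ≤ |a - b|) (hφ1 : ∀ a, |φ a| ≤ 1) {D : ℝ}
    (hi : Integrable (fun y : ℝ => y ^ 2) ρ) (hD : ∫ y, y ^ 2 ∂ρ ≤ D) (t s : ℝ) :
    |∫ y, φ (t * y) ∂ρ - ∫ y, φ (s * y) ∂ρ| ≤ |t - s| * (1 + D) := by
  have hφc : Continuous φ :=
    (LipschitzWith.of_dist_le_mul (K := 1) fun a b => by
      simpa [Real.dist_eq] using hφ a b).continuous
  have hint : ∀ t : ℝ, Integrable (fun y => φ (t * y)) ρ := fun t =>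
    integrable_of_abs_le (hφc.comp (continuous_const_mul t)).measurable fun y => hφ1 _
  rw [← integral_sub (hint t) (hint s), ← Real.norm_eq_abs]
  have hbound : ∀ y, ‖φ (t * y) - φ (s * y)‖ ≤ |t - s| * (1 + y ^ 2) := fun y => by
    refine (hφ _ _).trans ?_
    rw [← sub_mul, abs_mul]
    refine mul_le_mul_of_nonneg_left ?_ (abs_nonneg _)
    nlinarith [sq_abs y, sq_nonneg (|y| - 1), abs_nonneg y]
  refine (norm_integral_le_of_norm_le (((integrable_const 1).add hi).const_mul _)
    (Eventually.of_forall hbound)).trans ?_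
  rw [integral_const_mul]
  refine mul_le_mul_of_nonneg_left ?_ (abs_nonneg _)
  have : ∫ y, (1 + y ^ 2) ∂ρ = 1 + ∫ y, y ^ 2 ∂ρ := by
    rw [integral_add (integrable_const 1) hi]; simp
  exact this.trans_le (by linarith)

/-- The almost sure convergence of trigonometric linear spectral statistics, for all frequencies
at once. -/
theorem Model.ae_forall_tendsto_integral_esd (hb : 𝓜.IsBalanced) (hr : 𝓜.IsRigid)
    (hx : IsBoundedIIDInput P x) (hA : ∀ n y, (𝓜.matrix n y).IsHermitian)
    {ν : ProbabilityMeasure ℝ}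
    (hν : ∀ h : ℕ, Integrable (fun y : ℝ => y ^ h) (ν : Measure ℝ) ∧
      ∫ y, y ^ h ∂(ν : Measure ℝ) = 𝓜.limitMoment h) {φ : ℝ → ℝ}
    (hφ : ∀ a b, |φ a - φ b| ≤ |a - b|) (hφ1 : ∀ a, |φ a| ≤ 1)
    (hsmooth : ∀ t : ℝ, ∃ f' L M, IsSmoothTest (fun y => φ (t * y)) f' L M) :
    ∀ᵐ ω ∂P, ∀ t : ℝ, Tendsto (fun n : ℕ => ∫ y, φ (t * y)
      ∂(esd (𝓜.matrix (n + 1) fun i => x i ω) (hA _ _) : Measure ℝ)) atTop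
      (𝓝 (∫ y, φ (t * y) ∂(ν : Measure ℝ))) := by
  obtain ⟨C, hC⟩ := hx.bounded
  have hφc : Continuous φ :=
    (LipschitzWith.of_dist_le_mul (K := 1) fun a b => by
      simpa [Real.dist_eq] using hφ a b).continuous
  have hone : ∀ t : ℝ, ∀ᵐ ω ∂P, Tendsto (fun n : ℕ => ∫ y, φ (t * y)
      ∂(esd (𝓜.matrix (n + 1) fun i => x i ω) (hA _ _) : Measure ℝ)) atTop
      (𝓝 (∫ y, φ (t * y) ∂(ν : Measure ℝ))) := fun t => by
    obtain ⟨f', L, M, hf⟩ := hsmooth t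
    have hct : Continuous fun y => φ (t * y) := hφc.comp (continuous_const_mul t)
    have hmean : Tendsto (fun n : ℕ => ∫ y, φ (t * y)
        ∂(𝓜.meanEsd P hx.measurable (n + 1) (hA _) : Measure ℝ)) atTop
        (𝓝 (∫ y, φ (t * y) ∂(ν : Measure ℝ))) :=
      (ProbabilityMeasure.tendsto_iff_forall_integral_tendsto.1
        (𝓜.tendsto_meanEsd hr hx hA hν)) (BoundedContinuousFunction.ofNormedAddCommGroup
          (fun y => φ (t * y)) hct 1 fun y => hφ1 _)
    have hmean' : ∀ n : ℕ, ∫ y, φ (t * y)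
        ∂(𝓜.meanEsd P hx.measurable (n + 1) (hA _) : Measure ℝ) =
        ∫ ω, ∫ y, φ (t * y) ∂(esd (𝓜.matrix (n + 1) fun i => x i ω) (hA _ _) : Measure ℝ) ∂P :=
      fun n => 𝓜.integral_meanEsd (n + 1) hx.measurable (hA _)
        (integrable_of_abs_le hct.measurable fun y => hφ1 _)
    simp_rw [hmean'] at hmean
    filter_upwards [𝓜.ae_tendsto_integral_esd_sub hb hx hA hf] with ω hω
    simpa using hω.add hmean
  filter_upwards [ae_all_iff.2 hC, ae_all_iff.2 fun q : ℚ => hone q] with ω hω hq t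
  set D := 4 * C ^ 2 + ∫ y, y ^ 2 ∂(ν : Measure ℝ) with hD
  have hν0 : 0 ≤ ∫ y, y ^ 2 ∂(ν : Measure ℝ) := integral_nonneg fun y => sq_nonneg y
  have hD0 : 0 < 1 + D := by positivity
  rw [Metric.tendsto_atTop]
  intro δ hδ
  obtain ⟨q, hq1, hq2⟩ := exists_rat_btwn (show t < t + δ / (4 * (1 + D)) by
    have : 0 < δ / (4 * (1 + D)) := by positivity
    linarith)
  have htq : |t - q| * (1 + D) ≤ δ / 4 := by
    rw [abs_sub_comm, abs_of_pos (by linarith)]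
    calc (q - t) * (1 + D) ≤ δ / (4 * (1 + D)) * (1 + D) :=
          mul_le_mul_of_nonneg_right (by linarith) hD0.le
      _ = δ / 4 := by field_simp
  obtain ⟨N, hN⟩ := Metric.tendsto_atTop.1 (hq q) (δ / 4) (by positivity)
  refine ⟨N, fun n hn => ?_⟩
  have h1 := hN n hn
  rw [Real.dist_eq] at h1 ⊢
  have h2 := abs_integral_dilate_sub_le hφ hφ1 (D := D)
    (integrable_esd (hA (n + 1) fun i => x i ω) fun y => y ^ 2)
    (by have := hb.esdMoment_two_le hω (hA (n + 1) _); rw [esdMoment] at this; linarith) t q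
  have h3 := abs_integral_dilate_sub_le hφ hφ1 (ρ := (ν : Measure ℝ)) (D := D) (hν 2).1
    (by have := sq_nonneg C; linarith) q t
  rw [abs_sub_comm (q : ℝ) t] at h3
  have h4 := abs_sub_le (∫ y, φ (t * y)
    ∂(esd (𝓜.matrix (n + 1) fun i => x i ω) (hA _ _) : Measure ℝ)) (∫ y, φ (q * y)
    ∂(esd (𝓜.matrix (n + 1) fun i => x i ω) (hA _ _) : Measure ℝ))
    (∫ y, φ (t * y) ∂(ν : Measure ℝ))
  have h5 := abs_sub_le (∫ y, φ (q * y)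
    ∂(esd (𝓜.matrix (n + 1) fun i => x i ω) (hA _ _) : Measure ℝ))
    (∫ y, φ (q * y) ∂(ν : Measure ℝ)) (∫ y, φ (t * y) ∂(ν : Measure ℝ))
  linarith

theorem charFun_eq_integral_cos_sin (ρ : Measure ℝ) [IsProbabilityMeasure ρ] (t : ℝ) :
    charFun ρ t = ((∫ y, Real.cos (t * y) ∂ρ : ℝ) : ℂ) +
      ((∫ y, Real.sin (t * y) ∂ρ : ℝ) : ℂ) * Complex.I := by
  have hc : Integrable (fun y => Real.cos (t * y)) ρ :=
    integrable_of_abs_le (by fun_prop) fun y => Real.abs_cos_le_one _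
  have hs : Integrable (fun y => Real.sin (t * y)) ρ :=
    integrable_of_abs_le (by fun_prop) fun y => Real.abs_sin_le_one _
  rw [charFun_apply_real, ← integral_complex_ofReal, ← integral_complex_ofReal,
    ← integral_mul_const, ← integral_add hc.ofReal (hs.ofReal.mul_const _)]
  refine integral_congr_ae (Eventually.of_forall fun y => ?_)
  simp only
  rw [Complex.exp_mul_I]
  push_cast
  rfl

/-- Almost surely, the empirical spectral distributions converge weakly to the measure with the
limiting moments. -/
theorem Model.ae_tendsto_esd (hb : 𝓜.IsBalanced) (hr : 𝓜.IsRigid)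
    (hx : IsBoundedIIDInput P x) (hA : ∀ n y, (𝓜.matrix n y).IsHermitian)
    {ν : ProbabilityMeasure ℝ}
    (hν : ∀ h : ℕ, Integrable (fun y : ℝ => y ^ h) (ν : Measure ℝ) ∧
      ∫ y, y ^ h ∂(ν : Measure ℝ) = 𝓜.limitMoment h) :
    ∀ᵐ ω ∂P, Tendsto (fun n : ℕ => esd (𝓜.matrix (n + 1) fun i => x i ω) (hA _ _)) atTop
      (𝓝 ν) := by
  filter_upwards [𝓜.ae_forall_tendsto_integral_esd hb hr hx hA hν Real.abs_cos_sub_cos_le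
      Real.abs_cos_le_one fun t => ⟨_, _, _, isSmoothTest_cos t⟩,
    𝓜.ae_forall_tendsto_integral_esd hb hr hx hA hν Real.abs_sin_sub_sin_le
      Real.abs_sin_le_one fun t => ⟨_, _, _, isSmoothTest_sin t⟩] with ω hc hs
  refine ProbabilityMeasure.tendsto_of_tendsto_charFun fun t => ?_
  simp_rw [charFun_eq_integral_cos_sin]
  exact ((Complex.continuous_ofReal.tendsto _).comp (hc t)).add
    (((Complex.continuous_ofReal.tendsto _).comp (hs t)).mul_const _)

end Limit

/-! ### Existence of an input sequence -/

/-- The law of a fair sign. -/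
def signLaw : Measure ℝ := (2 : ENNReal)⁻¹ • (Measure.dirac 1 + Measure.dirac (-1))

instance : IsProbabilityMeasure signLaw := ⟨by
  simp only [signLaw, Measure.smul_apply, Measure.add_apply, measure_univ, smul_eq_mul]
  rw [one_add_one_eq_two]
  exact ENNReal.inv_mul_cancel two_ne_zero ENNReal.ofNat_ne_top⟩

theorem integral_signLaw (g : ℝ → ℝ) : ∫ y, g y ∂signLaw = (g 1 + g (-1)) / 2 := by
  rw [signLaw, integral_smul_measure, integral_add_measure (integrable_dirac (by simp))
    (integrable_dirac (by simp)), integral_dirac, integral_dirac]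
  simp
  ring

theorem isBoundedIIDInput_signs :
    IsBoundedIIDInput (Measure.infinitePi fun _ : ℕ => signLaw) fun i (ω : ℕ → ℝ) => ω i := by
  have hmap : ∀ i : ℕ, (Measure.infinitePi fun _ : ℕ => signLaw).map (fun ω : ℕ → ℝ => ω i) =
      signLaw := fun i => Measure.infinitePi_map_eval _ i
  have hint : ∀ (i : ℕ) (g : ℝ → ℝ), Measurable g →
      ∫ ω, g (ω i) ∂(Measure.infinitePi fun _ : ℕ => signLaw) = (g 1 + g (-1)) / 2 :=
    fun i g hg => by
      have := integral_map (μ := Measure.infinitePi fun _ : ℕ => signLaw)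
        (measurable_pi_apply i).aemeasurable hg.aestronglyMeasurable
      rw [← integral_signLaw, ← this, hmap i]
  have hmean : ∀ i : ℕ, ∫ ω, ω i ∂(Measure.infinitePi fun _ : ℕ => signLaw) = 0 := fun i => by
    rw [hint i (fun y => y) measurable_id]; norm_num
  refine ⟨fun i => measurable_pi_apply i, ?_, fun i => ?_, ⟨1, fun i => ?_⟩, hmean, fun i => ?_⟩
  · exact iIndepFun_infinitePi (X := fun _ y => y) fun i => measurable_id
  · exact ⟨(measurable_pi_apply i).aemeasurable, (measurable_pi_apply 0).aemeasurable,
      (hmap i).trans (hmap 0).symm⟩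
  · have : ∀ᵐ y ∂signLaw, |y| ≤ 1 := by
      rw [signLaw]
      refine Measure.ae_smul_measure ?_ _
      rw [ae_add_measure_iff, ae_dirac_iff (measurableSet_le (by fun_prop) (by fun_prop)),
        ae_dirac_iff (measurableSet_le (by fun_prop) (by fun_prop))]
      norm_num
    rw [← hmap i] at this
    exact ae_of_ae_map (measurable_pi_apply i).aemeasurable this
  · rw [variance_of_integral_eq_zero (measurable_pi_apply i).aemeasurable (hmean i),
      hint i (fun y => y ^ 2) (by fun_prop)]
    norm_num

/-! ### The limit theorem for a model -/

theorem Model.exists_limit {𝓜 : Model} (hb : 𝓜.IsBalanced) (hr : 𝓜.IsRigid)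
    {B : (n : ℕ) → (ℕ → ℝ) → Matrix (Fin n) (Fin n) ℝ} (hB : ∀ n y, 𝓜.matrix n y = B n y)
    (hA : ∀ n y, (B n y).IsHermitian) :
    ∃ ν : ProbabilityMeasure ℝ,
      (∀ h : ℕ, Integrable (fun y : ℝ => y ^ h) (ν : Measure ℝ)) ∧
      (∀ k : ℕ, ∫ y, y ^ (2 * k) ∂(ν : Measure ℝ) = 𝓜.moment k) ∧
      (∀ k : ℕ, ∫ y, y ^ (2 * k + 1) ∂(ν : Measure ℝ) = 0) ∧
      ∀ (Ω : Type*) [MeasurableSpace Ω] (P : Measure Ω) [IsProbabilityMeasure P]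
        (x : ℕ → Ω → ℝ), IsBoundedIIDInput P x →
        (∀ h n : ℕ, Integrable (fun ω => esdMoment h (B (n + 1) fun i => x i ω) (hA _ _)) P) ∧
        (∀ k : ℕ, Tendsto (fun n : ℕ => ∫ ω, esdMoment (2 * k) (B (n + 1) fun i => x i ω)
          (hA _ _) ∂P) atTop (𝓝 (𝓜.moment k))) ∧
        (∀ k : ℕ, Tendsto (fun n : ℕ => ∫ ω, esdMoment (2 * k + 1) (B (n + 1) fun i => x i ω)
          (hA _ _) ∂P) atTop (𝓝 0)) ∧
        ∀ᵐ ω ∂P, Tendsto (fun n : ℕ => esd (B (n + 1) fun i => x i ω) (hA _ _)) atTop (𝓝 ν) := by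
  obtain rfl : 𝓜.matrix = B := funext fun n => funext fun y => hB n y
  obtain ⟨ν, hν⟩ := exists_probabilityMeasure_of_tendsto_moments
    (fun n h => 𝓜.integrable_pow_meanEsd (n + 1) isBoundedIIDInput_signs (hA _) h)
    (𝓜.tendsto_integral_pow_meanEsd hr isBoundedIIDInput_signs hA)
  refine ⟨ν, fun h => (hν h).1, fun k => (hν _).2.trans (𝓜.limitMoment_even k),
    fun k => (hν _).2.trans (𝓜.limitMoment_odd k), fun Ω _ P _ x hx =>
    ⟨fun h n => 𝓜.integrable_esdMoment hx (n + 1) (hA _) h, fun k => ?_, fun k => ?_,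
      𝓜.ae_tendsto_esd hb hr hx hA hν⟩⟩
  · rw [← 𝓜.limitMoment_even]
    exact 𝓜.tendsto_integral_esdMoment hr hx hA _
  · exact 𝓜.tendsto_integral_esdMoment_odd hx hA k
end

end BalancedMatrix

theorem mainTheorem2 :
    -- the expectations in the moment formulas are finite
    (∀ k : ℕ, ∀ w ∈ BalancedMatrix.pairWords k,
      Integrable (BalancedMatrix.wordIntegrand BalancedMatrix.stepT BalancedMatrix.phiT w)
        (BalancedMatrix.uniformLaw w)) ∧
    (∀ k : ℕ, ∀ w ∈ BalancedMatrix.symPairWords k,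
      Integrable (BalancedMatrix.wordIntegrand BalancedMatrix.stepH BalancedMatrix.phiH w)
        (BalancedMatrix.uniformLaw w)) ∧
    -- the limiting distributions, with their moments
    ∃ BT BH : ProbabilityMeasure ℝ,
      (∀ h : ℕ, Integrable (fun y : ℝ => y ^ h) (BT : Measure ℝ)) ∧
      (∀ h : ℕ, Integrable (fun y : ℝ => y ^ h) (BH : Measure ℝ)) ∧
      (∀ k : ℕ, ∫ y, y ^ (2 * k) ∂(BT : Measure ℝ) = BalancedMatrix.momentT k) ∧
      (∀ k : ℕ, ∫ y, y ^ (2 * k) ∂(BH : Measure ℝ) = BalancedMatrix.momentH k) ∧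
      (∀ k : ℕ, ∫ y, y ^ (2 * k + 1) ∂(BT : Measure ℝ) = 0) ∧
      (∀ k : ℕ, ∫ y, y ^ (2 * k + 1) ∂(BH : Measure ℝ) = 0) ∧
      ∀ (Ω : Type*) [MeasurableSpace Ω] (P : Measure Ω) [IsProbabilityMeasure P]
        (x : ℕ → Ω → ℝ), BalancedMatrix.IsBoundedIIDInput P x →
        -- the expected moments of the empirical spectral distributions are finite
        (∀ h n : ℕ, Integrable (fun ω => BalancedMatrix.esdMoment h
          (BalancedMatrix.toeplitz (n + 1) fun i => x i ω)
          (BalancedMatrix.toeplitz_isHermitian _ _)) P) ∧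
        (∀ h n : ℕ, Integrable (fun ω => BalancedMatrix.esdMoment h
          (BalancedMatrix.hankel (n + 1) fun i => x i ω)
          (BalancedMatrix.hankel_isHermitian _ _)) P) ∧
        -- limits of the even expected moments
        (∀ k : ℕ, Tendsto (fun n : ℕ => ∫ ω, BalancedMatrix.esdMoment (2 * k)
          (BalancedMatrix.toeplitz (n + 1) fun i => x i ω)
          (BalancedMatrix.toeplitz_isHermitian _ _) ∂P) atTop (𝓝 (BalancedMatrix.momentT k))) ∧
        (∀ k : ℕ, Tendsto (fun n : ℕ => ∫ ω, BalancedMatrix.esdMoment (2 * k)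
          (BalancedMatrix.hankel (n + 1) fun i => x i ω)
          (BalancedMatrix.hankel_isHermitian _ _) ∂P) atTop (𝓝 (BalancedMatrix.momentH k))) ∧
        -- limits of the odd expected moments
        (∀ k : ℕ, Tendsto (fun n : ℕ => ∫ ω, BalancedMatrix.esdMoment (2 * k + 1)
          (BalancedMatrix.toeplitz (n + 1) fun i => x i ω)
          (BalancedMatrix.toeplitz_isHermitian _ _) ∂P) atTop (𝓝 0)) ∧
        (∀ k : ℕ, Tendsto (fun n : ℕ => ∫ ω, BalancedMatrix.esdMoment (2 * k + 1)
          (BalancedMatrix.hankel (n + 1) fun i => x i ω)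
          (BalancedMatrix.hankel_isHermitian _ _) ∂P) atTop (𝓝 0)) ∧
        -- `BT` and `BH` are the almost sure limiting spectral distributions
        (∀ᵐ ω ∂P, Tendsto (fun n : ℕ => BalancedMatrix.esd
          (BalancedMatrix.toeplitz (n + 1) fun i => x i ω)
          (BalancedMatrix.toeplitz_isHermitian _ _)) atTop (𝓝 BT)) ∧
        (∀ᵐ ω ∂P, Tendsto (fun n : ℕ => BalancedMatrix.esd
          (BalancedMatrix.hankel (n + 1) fun i => x i ω)
          (BalancedMatrix.hankel_isHermitian _ _)) atTop (𝓝 BH)) := by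
  obtain ⟨BT, hT1, hT2, hT3, hT⟩ := BalancedMatrix.Model.exists_limit
    BalancedMatrix.toeplitzModel_isBalanced
    (fun _ _ hw _ hε => BalancedMatrix.toeplitzModel_signs hw hε)
    BalancedMatrix.toeplitzModel_matrix BalancedMatrix.toeplitz_isHermitian
  obtain ⟨BH, hH1, hH2, hH3, hH⟩ := BalancedMatrix.Model.exists_limit
    BalancedMatrix.hankelModel_isBalanced
    (fun _ w _ _ hε => Or.inl (BalancedMatrix.hankelModel_signs w hε))
    BalancedMatrix.hankelModel_matrix BalancedMatrix.hankel_isHermitian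
  simp_rw [BalancedMatrix.toeplitzModel_moment] at hT2 hT
  simp_rw [BalancedMatrix.hankelModel_moment] at hH2 hH
  refine ⟨fun k w _ => BalancedMatrix.toeplitzModel.integrable_wordIntegrand,
    fun k w _ => BalancedMatrix.hankelModel.integrable_wordIntegrand,
    BT, BH, hT1, hH1, hT2, hH2, hT3, hH3, fun Ω _ P _ x hx => ?_⟩
  obtain ⟨t1, t2, t3, t4⟩ := hT Ω P x hx
  obtain ⟨h1, h2, h3, h4⟩ := hH Ω P x hx
  exact ⟨t1, h1, t2, h2, t3, h3, t4, h4⟩
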